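/- **Setting.** Let $A$ be a cluster algebra over $\mathbb Z$ with $n$ mutable and finitely many invertible frozen variables, of type $\mathsf A_n$ (some seed has as mutable quiver an orientation of the Dynkin diagram $\mathsf A_n$) and of really full rank (the rows of the extended exchange matrix span $\mathbb Z^n$ over $\mathbb Z$). Let $\mathsf{Seeds}(A)$ be its set of (unlabelled) seeds. For a field $\mathbb F$, the cluster torus $\mathbb T_{\mathbf x}^{\mathbb F}$ of a seed is the set of $\mathbb F$-algebra homomorphisms $\varphi:\mathbb F\otimes_{\mathbb Z}A\to\mathbb F$ that vanish on no element of its cluster $\mathbf x$, and the cluster manifold $\mathcal M_{\mathbb F}$ is the union of all cluster tori. A set $C\subseteq\mathsf{Seeds}(A)$ is an *$\mathbb F$-covering* if the tori of the seeds in $C$ cover $\mathcal M_{\mathbb F}$, and a *minimal* $\mathbb F$-covering if moreover no proper subset of $C$ is an $\mathbb F$-covering. Put $\mathbf 0=[1:0]$, $\infty=[0:1]$ in $\mathbb{FP}^1$, and let $X'_{\mathbb F}(m)$ be the set of $(y_0,\dots,y_m)\in(\mathbb{FP}^1)^{m+1}$ with $y_0=\mathbf 0$, $y_m=\infty$, $y_i\ne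 y_{i+1}$ for $0\le i<m$, other than $(\mathbf 0,\infty,\mathbf 0,\infty,\dots,\mathbf 0,\infty)$. Let $P_{m+1}$ be the $(m+1)$-gon with vertices $0,\dots,m$. *Dictionary.* By an identification of seeds with triangulations we mean an injective assignment $ij\mapsto x_{ij}$ of an element of $A$ to every diagonal of $P_{n+3}$, and a bijection from the triangulations $T$ of $P_{n+3}$ to $\mathsf{Seeds}(A)$ such that the mutable cluster variables of the seed of $T$ are the $x_{ij}$ with $ij\in T$. *Algorithm $\Upsilon$.* Input: $y\in X'_{\mathbb F}(m)$. Put $i_0=0$, and as long as possible let $i_{k}$ be the least $j>i_{k-1}$ with $y_j\ne\mathbf 0,\infty$ (if $k$ is odd) or with $y_j=\mathbf 0$ (if $k$ is even). Let $i_K$ be the last index found. For $1\le k<K$ join $i_k$ to $m$ and to $i_{k-1},i_{k-1}+1,\dots,i_k-1$. If $K$ is odd, let $\ell$ be the largest index with $y_\ell=\mathbf 0$, and join $\ell$ to $\ell+1,\dots,m-1$, and $m-1$ to $i_{K-1},\dots,\ell$. If $K$ is even, join $i_{K-1}$ to $i_K,\dots,m$, and $i_K$ to $i_{K-1},\dots,i_K-1$.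 Output: the set $\Upsilon(y)$ of all diagonals of $P_{m+1}$ so obtained (sides are discarded). **Theorem.** (a) Let $n>0$ and let $A$ be as above, of type $\mathsf A_n$. For every field $\mathbb F$ and every $y\in X'_{\mathbb F}(n+2)$, $\Upsilon(y)$ is a triangulation of $P_{n+3}$, and $y_i\neq y_j$ for all its diagonals $ij$. Under a suitable identification of seeds with triangulations, let $C\subseteq\mathsf{Seeds}(A)$ be the set of the seeds of the triangulations $\Upsilon(y)$, $y\in X'_{\mathbb F_2}(n+2)$. Then $C$ is also the set of the seeds of the triangulations $\Upsilon(y)$, $y\in X'_{\mathbb F}(n+2)$, for every field $\mathbb F$; it is a minimal $\mathbb F_2$-covering and a minimal $\mathbb F$-covering for every field $\mathbb F$; and $\#C=\#X'_{\mathbb F_2}(n+2)$. (b) Let $A$ be as above, of type $\mathsf A_9$ or of type $\mathsf A_{11}$. There is an $\mathbb F_2$-covering $C\subseteq\mathsf{Seeds}(A)$ that is not an $\mathbb F$-covering for any field $\mathbb F\not\cong\mathbb F_2$. In type $\mathsf A_9$, where seeds correspond to triangulations of the $12$-gon, $C$ and an identification of seeds with triangulations can be chosen such that moreover for every field $\mathbb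 F\not\cong\mathbb F_2$ and all distinct $a,b\in\mathbb{FP}^1\setminus\{\mathbf 0,\infty\}$ the following holds: $y=(\mathbf 0,a,\infty,a,b,\mathbf 0,\infty,b,a,\mathbf 0,b,\infty)$ lies in $X'_{\mathbb F}(11)$; there is $\varphi\in\mathcal M_{\mathbb F}$ over $y$, i.e. such that $\varphi(x_{ij})=0$ if and only if $y_i=y_j$, for every diagonal $ij$; and no $\varphi$ over $y$ lies in the torus of a seed in $C$. -/

import Mathlib

universe u v

open scoped TensorProduct

namespace ClusterCovering

/-! ### Ice quivers, seeds and mutation -/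

/-- An ice quiver with `n` mutable vertices `Sum.inl i` and `m` frozen vertices `Sum.inr j`,
without loops or directed 2-cycles and without arrows between frozen vertices.
It is encoded by its signed adjacency matrix:
`b u v` is the number of arrows `u → v` minus the number of arrows `v → u`. -/
@[ext]
structure IceQuiver (n m : ℕ) where
  b : Fin n ⊕ Fin m → Fin n ⊕ Fin m → ℤ
  skew : ∀ u v, b v u = -b u v
  frozen : ∀ i j : Fin m, b (Sum.inr i) (Sum.inr j) = 0

namespace IceQuiver

variable {n m : ℕ}

/-- Mutation at the mutable vertex `k`: for each path `u → k → v` add an arrow `u → v`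
(unless `u` and `v` are both frozen), reverse the arrows at `k`, cancel directed 2-cycles. -/
def mutate (Q : IceQuiver n m) (k : Fin n) : IceQuiver n m where
  b u v :=
    if u = Sum.inl k ∨ v = Sum.inl k then -Q.b u v
    else if u.isRight ∧ v.isRight then 0
    else Q.b u v + max (Q.b u (Sum.inl k)) 0 * max (Q.b (Sum.inl k) v) 0
      - max (-Q.b u (Sum.inl k)) 0 * max (-Q.b (Sum.inl k) v) 0
  skew u v := by
    by_cases h : u = Sum.inl k ∨ v = Sum.inl k
    · rw [if_pos h, if_pos h.symm, Q.skew u v]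
    · have h' : ¬(v = Sum.inl k ∨ u = Sum.inl k) := fun H => h H.symm
      rw [if_neg h, if_neg h']
      by_cases hf : (u.isRight : Prop) ∧ (v.isRight : Prop)
      · rw [if_pos hf, if_pos hf.symm, neg_zero]
      · rw [if_neg hf, if_neg (fun H => hf H.symm), Q.skew u v, Q.skew (Sum.inl k) v,
          Q.skew u (Sum.inl k)]
        simp only [neg_neg]
        ring
  frozen i j := by simp

/-- Relabelling of the mutable vertices. -/
def relabel (Q : IceQuiver n m) (σ : Equiv.Perm (Fin n)) : IceQuiver n m where
  b u v := Q.b (Sum.map σ id u) (Sum.map σ id v)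
  skew _ _ := Q.skew _ _
  frozen i j := Q.frozen i j

/-- The full subquiver on the mutable vertices is an orientation of the Dynkin diagram `A_n`,
that is, of a path through all the mutable vertices. -/
def IsDynkinA (Q : IceQuiver n m) : Prop :=
  ∃ σ : Equiv.Perm (Fin n), ∀ i j : Fin n,
    |Q.b (Sum.inl (σ i)) (Sum.inl (σ j))| =
      if i.val + 1 = j.val ∨ j.val + 1 = i.val then 1 else 0

/-- Really full rank: the rows of the extended exchange matrix, which has one row for each vertex
and one column for each mutable vertex, span `ℤ^n` over `ℤ`. -/
def ReallyFullRank (Q : IceQuiver n m) : Prop :=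
  Submodule.span ℤ (Set.range fun u : Fin n ⊕ Fin m => fun i : Fin n => Q.b u (Sum.inl i)) = ⊤

end IceQuiver

/-- A labelled seed: a labelled family of `n + m` elements of the ambient field `K`
together with an ice quiver on the labels. -/
@[ext]
structure LabeledSeed (n m : ℕ) (K : Type*) where
  x : Fin n ⊕ Fin m → K
  Q : IceQuiver n m

namespace LabeledSeed

variable {n m : ℕ} {K : Type*}

/-- Relabelling of the mutable vertices of a seed. -/
def relabel (S : LabeledSeed n m K) (σ : Equiv.Perm (Fin n)) : LabeledSeed n m K where
  x u := S.x (Sum.map σ id u)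
  Q := S.Q.relabel σ

variable [Field K]

/-- The elements of the extended cluster are algebraically independent and generate `K` as a field,
so that `K` is the field of rational functions in them. -/
def IsFree (S : LabeledSeed n m K) : Prop :=
  AlgebraicIndependent ℤ S.x ∧ Subfield.closure (Set.range S.x) = ⊤

/-- Seed mutation. The variable `x_k` is replaced by the element `x'_k` with
`x'_k x_k = ∏_{k → v} x_v + ∏_{v → k} x_v`, the products being over arrows. -/
noncomputable def mutate (S : LabeledSeed n m K) (k : Fin n) : LabeledSeed n m K where
  x := Function.update S.x (Sum.inl k)
    ((∏ v, S.x v ^ (S.Q.b (Sum.inl k) v).toNat + ∏ v, S.x v ^ (S.Q.b v (Sum.inl k)).toNat)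
      / S.x (Sum.inl k))
  Q := S.Q.mutate k

/-- `S'` is obtained from `S` by an iterated sequence of mutations. -/
def MutationEquiv (S S' : LabeledSeed n m K) : Prop :=
  Relation.ReflTransGen (fun S₁ S₂ : LabeledSeed n m K => ∃ k, S₂ = S₁.mutate k) S S'

/-- The cluster algebra of `S` is of type `A_n`: some seed that is mutation equivalent to `S` has
as mutable part of its quiver an orientation of the Dynkin diagram `A_n`. -/
def IsTypeA (S : LabeledSeed n m K) : Prop :=
  ∃ S', S.MutationEquiv S' ∧ S'.Q.IsDynkinA

end LabeledSeed

/-- Two labelled seeds give the same seed if they differ by a relabelling of mutable vertices.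
(The frozen variables are common to all seeds of a cluster algebra and keep their labels.) -/
instance seedSetoid (n m : ℕ) (K : Type*) : Setoid (LabeledSeed n m K) where
  r S S' := ∃ σ : Equiv.Perm (Fin n), S' = S.relabel σ
  iseqv :=
    { refl := fun S => ⟨1, by
        ext u v <;> simp [LabeledSeed.relabel, IceQuiver.relabel]⟩
      symm := by
        rintro S _ ⟨σ, rfl⟩
        refine ⟨σ⁻¹, ?_⟩
        ext u v <;> simp [LabeledSeed.relabel, IceQuiver.relabel, Sum.map_map]
      trans := by
        rintro S _ _ ⟨σ, rfl⟩ ⟨τ, rfl⟩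
        refine ⟨σ * τ, ?_⟩
        ext u v <;> simp [LabeledSeed.relabel, IceQuiver.relabel, Sum.map_map] }

/-- (Unlabelled) seeds. -/
def Seed (n m : ℕ) (K : Type*) : Type _ := Quotient (seedSetoid n m K)

/-- The set of mutable elements of the cluster of a seed. -/
def Seed.mutableVars {n m : ℕ} {K : Type*} (s : Seed n m K) : Set K :=
  Quotient.lift (fun S : LabeledSeed n m K => Set.range fun i : Fin n => S.x (Sum.inl i))
    (by
      rintro S _ ⟨σ, rfl⟩
      ext z
      constructor
      · rintro ⟨i, rfl⟩
        exact ⟨σ⁻¹ i, by simp [LabeledSeed.relabel]⟩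
      · rintro ⟨i, rfl⟩
        exact ⟨σ i, by simp [LabeledSeed.relabel]⟩) s

namespace LabeledSeed

variable {n m : ℕ} {K : Type*} [Field K]

/-- `Seeds(A)`: the seeds of the cluster algebra of `S`. -/
def seeds (S : LabeledSeed n m K) : Set (Seed n m K) :=
  {s | ∃ S', S.MutationEquiv S' ∧ s = Quotient.mk (seedSetoid n m K) S'}

/-- The cluster algebra `A` of `S` over `ℤ`, with invertible frozen variables. -/
def clusterAlgebra (S : LabeledSeed n m K) : Subalgebra ℤ K :=
  Algebra.adjoin ℤ
    ({z | ∃ S', S.MutationEquiv S' ∧ ∃ u, z = S'.x u} ∪ {z | ∃ j : Fin m, z = (S.x (Sum.inr j))⁻¹})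

/-! ### Cluster variety, cluster tori, coverings -/

/-- The set of `F`-points of the cluster variety: unital `F`-algebra homomorphisms `A_F → F`, where
`A_F = F ⊗ A`. -/
abbrev ClusterVariety (F : Type*) [Field F] (S : LabeledSeed n m K) : Type _ :=
  (F ⊗[ℤ] S.clusterAlgebra) →ₐ[F] F

/-- The cluster torus of a seed `s`: no element of the cluster vanishes at the point. -/
def torus (F : Type*) [Field F] (S : LabeledSeed n m K) (s : Seed n m K) :
    Set (S.ClusterVariety F) :=
  {φ | ∀ z : S.clusterAlgebra, (z : K) ∈ s.mutableVars → φ (1 ⊗ₜ[ℤ] z) ≠ 0}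

/-- The cluster manifold: the union of all cluster tori. -/
def clusterManifold (F : Type*) [Field F] (S : LabeledSeed n m K) : Set (S.ClusterVariety F) :=
  ⋃ s ∈ S.seeds, S.torus F s

/-- The set `C` of seeds is an `F`-covering. -/
def IsCovering (F : Type*) [Field F] (S : LabeledSeed n m K) (C : Set (Seed n m K)) : Prop :=
  C ⊆ S.seeds ∧ ⋃ s ∈ C, S.torus F s = S.clusterManifold F

/-- The set `C` of seeds is a minimal `F`-covering. -/
def IsMinimalCovering (F : Type*) [Field F] (S : LabeledSeed n m K) (C : Set (Seed n m K)) :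
    Prop :=
  S.IsCovering F C ∧ ∀ D, D ⊂ C → ⋃ s ∈ D, S.torus F s ⊂ S.clusterManifold F

end LabeledSeed

/-! ### Labelled polygons -/

/-- The projective line `{[a : b]}` over `F`. -/
abbrev P1 (F : Type*) [Field F] : Type _ := Projectivization F (Fin 2 → F)

/-- The point `[1 : 0]`. -/
def zeroPt (F : Type*) [Field F] : P1 F :=
  Projectivization.mk F ![1, 0] fun h => one_ne_zero (congrFun h 0)

/-- The point `[0 : 1]`. -/
def inftyPt (F : Type*) [Field F] : P1 F :=
  Projectivization.mk F ![0, 1] fun h => one_ne_zero (congrFun h 1)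

/-- `X_F(m)`: labellings `(y_0, …, y_m)` of the vertices of the `(m+1)`-gon by points of the
projective line with `y_0 = 0`, `y_m = ∞` and `y_i ≠ y_{i+1}`. -/
def X (F : Type*) [Field F] (m : ℕ) : Set (Fin (m + 1) → P1 F) :=
  {y | y 0 = zeroPt F ∧ y (Fin.last m) = inftyPt F ∧ ∀ i : Fin m, y i.castSucc ≠ y i.succ}

open Classical in
/-- `X'_F(m)`: the set `X_F(m)` without the alternating labelling `(0, ∞, 0, ∞, …, 0, ∞)`. -/
noncomputable def X' (F : Type*) [Field F] (m : ℕ) : Set (Fin (m + 1) → P1 F) :=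
  X F m \ {fun i => if Even i.val then zeroPt F else inftyPt F}

/-! ### Triangulations of the polygon with vertices `0, …, N - 1` in cyclic order -/

/-- `d = (i, j)` with `i < j` is a diagonal: `i` and `j` are not adjacent vertices. -/
def IsDiagonal {N : ℕ} (d : Fin N × Fin N) : Prop :=
  d.1.val + 1 < d.2.val ∧ ¬(d.1.val = 0 ∧ d.2.val + 1 = N)

/-- Two diagonals cross in the interior of the polygon. -/
def Cross {N : ℕ} (d e : Fin N × Fin N) : Prop :=
  (d.1 < e.1 ∧ e.1 < d.2 ∧ d.2 < e.2) ∨ (e.1 < d.1 ∧ d.1 < e.2 ∧ e.2 < d.2)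

/-- A triangulation: a maximal set of pairwise noncrossing diagonals. -/
def IsTriangulation {N : ℕ} (T : Set (Fin N × Fin N)) : Prop :=
  (∀ d ∈ T, IsDiagonal d) ∧ (∀ d ∈ T, ∀ e ∈ T, ¬Cross d e) ∧
    ∀ d, IsDiagonal d → (∀ e ∈ T, ¬Cross d e) → d ∈ T

/-- The labelling `y` is a proper coloring for the set `T` of diagonals. -/
def IsProperColoring {N : ℕ} {P : Type*} (y : Fin N → P) (T : Set (Fin N × Fin N)) : Prop :=
  ∀ d ∈ T, y d.1 ≠ y d.2

/-- The usual dictionary between the cluster algebra of `S` and the `N`-gon: `χ` sends distinct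
diagonals to distinct elements, and `τ` is a bijection from triangulations to seeds
such that the mutable cluster variables of `τ T` are the images under `χ` of the
diagonals in `T`. -/
def IsTriangulationModel {N n m : ℕ} {K : Type*} [Field K] (S : LabeledSeed n m K)
    (χ : Fin N × Fin N → K) (τ : Set (Fin N × Fin N) → Seed n m K) : Prop :=
  Set.InjOn χ {d | IsDiagonal d} ∧ Set.BijOn τ {T | IsTriangulation T} S.seeds ∧
    ∀ T, IsTriangulation T → (τ T).mutableVars = χ '' T

/-- The point `φ` of the cluster variety lies over the labelling `y`: for each diagonal `(i, j)`
the cluster variable of `(i, j)` vanishes at `φ` if and only if `y_i = y_j`. -/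
def LiesOver {N n m : ℕ} {K : Type*} [Field K] {F : Type*} [Field F] {S : LabeledSeed n m K}
    (χ : Fin N × Fin N → K) (φ : S.ClusterVariety F) (y : Fin N → P1 F) : Prop :=
  ∀ d, IsDiagonal d → ∃ h : χ d ∈ S.clusterAlgebra,
    φ (1 ⊗ₜ[ℤ] (⟨χ d, h⟩ : S.clusterAlgebra)) = 0 ↔ y d.1 = y d.2

/-! ### The algorithm that produces a triangulation from a labelling -/

section Algorithm

variable {F : Type*} [Field F] {m : ℕ}

/-- The property of `y_j` sought in step `k`: for `k` odd, `y_j ≠ 0, ∞`; for `k` even, `y_j = 0`. -/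
def Marks (k : ℕ) (p : P1 F) : Prop :=
  (Odd k ∧ p ≠ zeroPt F ∧ p ≠ inftyPt F) ∨ (Even k ∧ p = zeroPt F)

/-- `Found y k i` says that `i_k = i`. Here `i_0 = 0`, and `i_{k+1}` is the minimal
`j > i_k` such that `y_j` has the property sought in step `k + 1`, if there is one. -/
inductive Found (y : Fin (m + 1) → P1 F) : ℕ → Fin (m + 1) → Prop
  | zero : Found y 0 0
  | succ (k : ℕ) (i j : Fin (m + 1)) : Found y k i → i < j → Marks (k + 1) (y j) →
      (∀ l, i < l → l < j → ¬Marks (k + 1) (y l)) → Found y (k + 1) j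

/-- After `i_k = i` has been found, it is not possible to continue. -/
def Stops (y : Fin (m + 1) → P1 F) (k : ℕ) (i : Fin (m + 1)) : Prop :=
  ∀ j, i < j → ¬Marks (k + 1) (y j)

/-- `Drawn y p q`, for `p < q`: the segment from `p` to `q` belongs to the final drawing. Let
`s = i_k` and `i = i_{k+1}`.
* If the procedure continues after step `k + 1`, that step draws segments from `i` to `m`
  and to `s, s + 1, …, i - 1`.
* If it stops there and `k + 1` is odd, then with `l` the largest index such that
  `y_l = 0` one draws segments from `l` to `l + 1, …, m - 1` and from `m - 1` to `s, …, l` instead.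
* If it stops there and `k + 1` is even, one draws segments from `s` to `i, …, m` and
  from `i` to `s, …, i - 1` instead. -/
inductive Drawn (y : Fin (m + 1) → P1 F) : Fin (m + 1) → Fin (m + 1) → Prop
  | toLast (k : ℕ) (i : Fin (m + 1)) : Found y (k + 1) i → ¬Stops y (k + 1) i →
      Drawn y i (Fin.last m)
  | fan (k : ℕ) (s i p : Fin (m + 1)) : Found y k s → Found y (k + 1) i → ¬Stops y (k + 1) i →
      s ≤ p → p < i → Drawn y p i
  | oddRight (k : ℕ) (i l q : Fin (m + 1)) : Found y (k + 1) i → Stops y (k + 1) i →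
      Odd (k + 1) → y l = zeroPt F → (∀ j, l < j → y j ≠ zeroPt F) → l < q → q.val + 1 ≤ m →
      Drawn y l q
  | oddLeft (k : ℕ) (s i l p r : Fin (m + 1)) : Found y k s → Found y (k + 1) i →
      Stops y (k + 1) i → Odd (k + 1) → y l = zeroPt F → (∀ j, l < j → y j ≠ zeroPt F) →
      s ≤ p → p ≤ l → r.val + 1 = m → Drawn y p r
  | evenRight (k : ℕ) (s i q : Fin (m + 1)) : Found y k s → Found y (k + 1) i →
      Stops y (k + 1) i → Even (k + 1) → i ≤ q → Drawn y s q
  | evenLeft (k : ℕ) (s i p : Fin (m + 1)) : Found y k s → Found y (k + 1) i →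
      Stops y (k + 1) i → Even (k + 1) → s ≤ p → p < i → Drawn y p i

/-- The output of the algorithm: the diagonals among the segments drawn
(sides of the polygon are discarded). -/
def upsilon (y : Fin (m + 1) → P1 F) : Set (Fin (m + 1) × Fin (m + 1)) :=
  {d | IsDiagonal d ∧ Drawn y d.1 d.2}

end Algorithm

/-- The labelling `(0, a, ∞, a, b, 0, ∞, b, a, 0, b, ∞)` of the 12-gon. -/
def witness {F : Type*} [Field F] (a b : P1 F) : Fin 12 → P1 F :=
  ![zeroPt F, a, inftyPt F, a, b, zeroPt F, inftyPt F, b, a, zeroPt F, b, inftyPt F]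

end ClusterCovering

open ClusterCovering

/-! Points of the cluster variety are replaced by polygons in the projective line, and tori by
proper colourings of triangulations.

Seeds. After mutations at sinks the Dynkin quiver is a linearly oriented path, which is placed on
the fan triangulation at vertex 0. Each frozen variable `g j` receives integers `w j a b` that
satisfy the tropical Plücker relations and whose shear coordinates at the diagonals form its row of
the exchange matrix (`Coordinates.exists_realizes_fan`). Multiplying the variable of `ab` by the
monomial in `g` with exponents `w · a b` turns all exchange relations into the classical Plücker
relations (`exchRel_iff`). The tropical relation is precisely the matrix mutation rule, so mutation
is the flip of a diagonal (`Coordinates.FlipData.realizes`), and flips reach every triangulation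
from the fan.

Points. A homomorphism from the cluster algebra to a field turns the rescaled variables into Plücker
coordinates with nonzero sides, that is, into the determinants of a polygon `y` in the projective
line, where `x_ij` vanishes exactly if `y_i = y_j`. Hence a point lies in the torus of a
triangulation if and only if `y` is a proper coloring of it (`LiesOver.mem_torus_iff`). Conversely,
each labelling that properly colors some triangulation comes from a point
(`Coordinates.IsModel.exists_point`): really full rank allows all cross ratios at the diagonals to
be prescribed without extracting roots, and these cross ratios determine the polygon up to
projective maps (`IsPolygon.eq_zero_iff`). Coverings thereby become a question about families of
triangulations that serve every labelling.

Part (a). The output of the algorithm is a triangulation properly colored by its input. Like every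
triangulation it has a coloring by the three points of the line over the field with two elements,
and only one with the prescribed end values. The algorithm run on that coloring gives back the same
triangulation (`upsilon_eq_of_isProperColoring`), so the outputs do not depend on the field.
Embedding the three colors into any projective line gives, for each output, a point that lies in no
other torus of the covering; this is minimality.

Part (b). A pattern of four symbols on the vertices is fixed, and the set consists of the seeds of
the triangulations that the pattern does not properly color. Over a field with more than two
elements the four symbols become distinct points of the line, and the resulting polygon is missed by
all these tori. Over the field with two elements, each labelling is split by some diagonal with
equal pattern symbols at its ends into two polygons that both show all three colors; both have
properly colored triangulations (`exists_dissect`), and gluing these gives a triangulation in the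
set. That such a diagonal always exists is a finite search. -/

namespace ClusterCovering

section

/-! ### Polygons with vertices in `ℕ` -/

/-- The pair of `a` and `b` in increasing order. -/
def pr (a b : ℕ) : ℕ × ℕ := (min a b, max a b)

theorem pr_comm (a b : ℕ) : pr a b = pr b a := by
  simp only [pr, min_comm, max_comm]

theorem pr_of_lt {a b : ℕ} (h : a < b) : pr a b = (a, b) := by
  simp [pr, h.le]

theorem pr_eq_iff {a b c d : ℕ} : pr a b = pr c d ↔ (a = c ∧ b = d) ∨ (a = d ∧ b = c) := by
  simp only [pr, Prod.mk.injEq]; omega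

/-- `a, b, c, e` are in (strict) cyclic order. -/
def Cyc (a b c e : ℕ) : Prop :=
  (a < b ∧ b < c ∧ c < e) ∨ (b < c ∧ c < e ∧ e < a) ∨ (c < e ∧ e < a ∧ a < b) ∨
    (e < a ∧ a < b ∧ b < c)

theorem Cyc.rot {a b c e : ℕ} (h : Cyc a b c e) : Cyc b c e a := by
  unfold Cyc at *; omega

/-- A chord that crosses the diagonal `ac` leaves each of the two triangles at `ac` through a side
of the quadrilateral or through the opposite vertex. If it crosses no side, its ends are `b` and
`e`. -/
theorem cyc_aux {a b c e p q : ℕ} (h : Cyc a b c e) (hn : ¬((p = b ∧ q = e) ∨ (p = e ∧ q = b)))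
    (h1 : ¬Cyc p a q b ∧ ¬Cyc p b q a)
    (h2 : ¬Cyc p b q c ∧ ¬Cyc p c q b) (h3 : ¬Cyc p c q e ∧ ¬Cyc p e q c)
    (h4 : ¬Cyc p e q a ∧ ¬Cyc p a q e) : ¬Cyc p a q c ∧ ¬Cyc p c q a := by
  unfold Cyc at *
  rcases h with h | h | h | h <;> grind (splits := 40)

/-- `a` and `b` are neighbouring vertices of the `N`-gon. -/
def Side (N a b : ℕ) : Prop :=
  a < N ∧ b < N ∧ a ≠ b ∧ (a + 1 = b ∨ b + 1 = a ∨ (a = 0 ∧ b + 1 = N) ∨ (b = 0 ∧ a + 1 = N))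

theorem Side.symm {N a b : ℕ} (h : Side N a b) : Side N b a := by
  unfold Side at *; omega

/-- Triangulations of the `N`-gon, as sets of pairs of natural numbers. -/
structure IsTri (N : ℕ) (R : Set (ℕ × ℕ)) : Prop where
  diag : ∀ p q, (p, q) ∈ R → p + 1 < q ∧ q < N ∧ ¬(p = 0 ∧ q + 1 = N)
  nc : ∀ p q r s, (p, q) ∈ R → (r, s) ∈ R → ¬(p < r ∧ r < q ∧ q < s)
  maximal : ∀ p q, p + 1 < q → q < N → ¬(p = 0 ∧ q + 1 = N) →
    (∀ r s, (r, s) ∈ R → ¬(p < r ∧ r < q ∧ q < s) ∧ ¬(r < p ∧ p < s ∧ s < q)) → (p, q) ∈ R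

/-- Sides and diagonals of a triangulation. -/
def Edge (N : ℕ) (R : Set (ℕ × ℕ)) (a b : ℕ) : Prop := Side N a b ∨ pr a b ∈ R

theorem Edge.symm {N : ℕ} {R : Set (ℕ × ℕ)} {a b : ℕ} (h : Edge N R a b) : Edge N R b a := by
  unfold Edge at *
  rw [pr_comm b a]
  exact h.imp Side.symm id

theorem edge_succ {N : ℕ} (R : Set (ℕ × ℕ)) {a : ℕ} (h : a + 1 < N) : Edge N R a (a + 1) :=
  Or.inl ⟨by omega, h, by omega, by omega⟩

theorem edge_base {N : ℕ} (R : Set (ℕ × ℕ)) (h : 1 < N) : Edge N R 0 (N - 1) :=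
  Or.inl ⟨by omega, by omega, by omega, by omega⟩

theorem edge_iff {N : ℕ} {R : Set (ℕ × ℕ)} {a b : ℕ} (h : a < b) :
    Edge N R a b ↔ (b < N ∧ (a + 1 = b ∨ (a = 0 ∧ b + 1 = N))) ∨ (a, b) ∈ R := by
  unfold Edge Side
  rw [pr_of_lt h]
  refine or_congr_left ?_
  omega

namespace IsTri

variable {N : ℕ} {R : Set (ℕ × ℕ)}

theorem edge_lt (hR : IsTri N R) {a b : ℕ} (h : Edge N R a b) : a < N ∧ b < N ∧ a ≠ b := by
  rcases h with h | h
  · unfold Side at h; omega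
  · obtain ⟨h1, h2, -⟩ := hR.diag (min a b) (max a b) h
    omega

theorem edge_nc_aux (hR : IsTri N R) {p q r s : ℕ} (h : Edge N R p q) (h' : Edge N R r s) :
    ¬(p < r ∧ r < q ∧ q < s) := by
  rintro ⟨h1, h2, h3⟩
  have hs := hR.edge_lt h'
  rw [edge_iff (by omega)] at h h'
  rcases h with h | h
  · omega
  rcases h' with h' | h'
  · omega
  exact hR.nc _ _ _ _ h h' ⟨h1, h2, h3⟩

/-- Edges do not cross. -/
theorem edge_nc (hR : IsTri N R) {p q r s : ℕ} (h : Edge N R p q) (h' : Edge N R r s) :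
    ¬Cyc p r q s := by
  rintro (h1 | h1 | h1 | h1)
  · exact hR.edge_nc_aux h h' h1
  · exact hR.edge_nc_aux h' h.symm h1
  · exact hR.edge_nc_aux h.symm h'.symm h1
  · exact hR.edge_nc_aux h'.symm h h1

/-- Each edge is the long side of a triangle, unless its end points are consecutive. -/
theorem exists_inside (hR : IsTri N R) {a c : ℕ} (hac : a + 1 < c) (h : Edge N R a c) :
    ∃ b, a < b ∧ b < c ∧ Edge N R a b ∧ Edge N R b c := by
  classical
  have hlt := hR.edge_lt h
  -- The third vertex is the last neighbour `b` of `a` before `c`. A diagonal crossing `bc` would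
  -- cross `ac` or `ab`, or would join `a` to a later vertex; so `bc` is an edge by maximality.
  let P : ℕ → Prop := fun b => a < b ∧ Edge N R a b
  have h0 : P (a + 1) := ⟨by omega, edge_succ R (by omega)⟩
  obtain ⟨b, hb, hbc, hmax⟩ : ∃ b, P b ∧ b < c ∧ ∀ b', b < b' → b' < c → ¬P b' := by
    refine ⟨Nat.findGreatest P (c - 1), Nat.findGreatest_spec (m := a + 1) (by omega) h0, ?_, ?_⟩
    · have := Nat.findGreatest_le (P := P) (c - 1); omega
    · intro b' h1 h2
      exact Nat.findGreatest_is_greatest h1 (by omega)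
  have hab := hb.1
  refine ⟨b, hb.1, hbc, hb.2, ?_⟩
  rw [edge_iff hbc, or_iff_not_imp_left]
  intro h'
  refine hR.maximal b c (by omega) (by omega) (by omega) fun r s hrs => ?_
  have h1 := hR.diag r s hrs
  have hrs' : Edge N R r s := Or.inr (by rwa [pr_of_lt (by omega)])
  constructor
  · intro h2
    exact hR.edge_nc_aux h hrs' ⟨by omega, h2.2⟩
  · rintro ⟨h2, h3, h4⟩
    rcases lt_trichotomy r a with h5 | rfl | h5
    · exact hR.edge_nc_aux hrs' h ⟨h5, by omega, h4⟩
    · exact hmax s h3 h4 ⟨by omega, hrs'⟩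
    · exact hR.edge_nc_aux hb.2 hrs' ⟨h5, h2, h3⟩

/-- Each diagonal has a triangle on its other side. -/
theorem exists_outside (hR : IsTri N R) {a c : ℕ} (h : (a, c) ∈ R) :
    ∃ e, (e < a ∨ c < e) ∧ Edge N R a e ∧ Edge N R e c := by
  have hd := hR.diag _ _ h
  have hac : Edge N R a c := Or.inr (by rwa [pr_of_lt (by omega)])
  -- Descent through edges `pq` that enclose `ac`, starting with the long side. The inner triangle
  -- of `pq` has no apex strictly between `a` and `c`, so either `ac` is one of its sides or a
  -- smaller edge encloses `ac`.
  suffices H : ∀ k p q, q - p = k → p ≤ a → c ≤ q → (p, q) ≠ (a, c) → Edge N R p q →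
      ∃ e, (e < a ∨ c < e) ∧ Edge N R a e ∧ Edge N R e c from
    H _ 0 (N - 1) rfl (by omega) (by omega) (by rw [Ne, Prod.mk.injEq]; omega)
      (edge_base R (by omega))
  intro k
  induction k using Nat.strong_induction_on with
  | _ k ih =>
    intro p q hk hp hq hne hpq
    rw [Ne, Prod.mk.injEq] at hne
    obtain ⟨r, h1, h2, h3, h4⟩ := hR.exists_inside (by omega) hpq
    by_cases hrc : c ≤ r
    · by_cases heq : (p, r) = (a, c)
      · rw [Prod.mk.injEq] at heq
        obtain ⟨rfl, rfl⟩ := heq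
        exact ⟨q, Or.inr (by omega), hpq, h4.symm⟩
      · exact ih (r - p) (by omega) p r rfl hp hrc heq h3
    by_cases hra : r ≤ a
    · by_cases heq : (r, q) = (a, c)
      · rw [Prod.mk.injEq] at heq
        obtain ⟨rfl, rfl⟩ := heq
        exact ⟨p, Or.inl (by omega), h3.symm, hpq⟩
      · exact ih (q - r) (by omega) r q rfl hra hq heq h4
    have h5 := hR.edge_nc_aux h3 hac
    have h6 := hR.edge_nc_aux hac h4
    omega

end IsTri

/-- A quadrilateral `a, b, c, e` of a triangulation with diagonal `ac`. -/
structure Quad (N : ℕ) (R : Set (ℕ × ℕ)) (a b c e : ℕ) : Prop where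
  cyc : Cyc a b c e
  diag : pr a c ∈ R
  ab : Edge N R a b
  bc : Edge N R b c
  ce : Edge N R c e
  ea : Edge N R e a

theorem Quad.rot {N : ℕ} {R : Set (ℕ × ℕ)} {a b c e : ℕ} (h : Quad N R a b c e) :
    Quad N R c e a b :=
  ⟨h.cyc.rot.rot, pr_comm a c ▸ h.diag, h.ce, h.ea, h.ab, h.bc⟩

namespace IsTri

variable {N : ℕ} {R : Set (ℕ × ℕ)}

theorem exists_quad (hR : IsTri N R) {p q : ℕ} (h : (p, q) ∈ R) :
    ∃ b e, p < b ∧ b < q ∧ Quad N R p b q e := by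
  have hd := hR.diag _ _ h
  have hpr : pr p q ∈ R := by rwa [pr_of_lt (by omega)]
  obtain ⟨b, h1, h2, h3, h4⟩ := hR.exists_inside hd.1 (Or.inr hpr)
  obtain ⟨e, h5, h6, h7⟩ := hR.exists_outside h
  exact ⟨b, e, h1, h2, by unfold Cyc; omega, hpr, h3, h4, h7.symm, h6.symm⟩

/-- The third vertex of a triangle on a given side of a given edge is unique. -/
theorem third_unique (hR : IsTri N R) {a b c c' : ℕ} (hac : Edge N R a c) (hbc : Edge N R b c)
    (hac' : Edge N R a c') (hbc' : Edge N R b c')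
    (h : ∃ x, Cyc a x b c ∧ Cyc a x b c') : c = c' := by
  obtain ⟨x, h1, h2⟩ := h
  -- Of two different apexes on the same side of `ab`, an edge to one would cross an edge to the
  -- other. The vertex `x` only records the common side.
  by_contra hne
  have h3 := hR.edge_nc hac hbc'
  have h4 := hR.edge_nc hac' hbc
  unfold Cyc at *
  grind (splits := 30)

/-- No diagonal crosses the flipped diagonal, except the one that it replaces. -/
theorem not_cyc_flip (hR : IsTri N R) {a b c e : ℕ} (h : Quad N R a b c e) {r s : ℕ}
    (hrs' : Edge N R r s) (hne : pr r s ≠ pr a c) : ¬Cyc b r e s := by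
  intro hc
  have hcyc := h.cyc
  have h3 := hR.edge_nc h.ab hrs'
  have h4 := hR.edge_nc h.ea hrs'.symm
  have h5 := hR.edge_nc h.bc hrs'
  have h6 := hR.edge_nc h.ce hrs'
  have h8 := hR.edge_nc h.ea hrs'
  have h9 := hR.edge_nc h.ab hrs'.symm
  have h1 := hR.edge_nc (Or.inr h.diag) hrs'
  rw [Ne, pr_eq_iff] at hne
  unfold Cyc at *
  grind (splits := 30)

/-- The set of diagonals obtained by a flip. -/
theorem flip (hR : IsTri N R) {a b c e : ℕ} (h : Quad N R a b c e) :
    IsTri N (insert (pr b e) (R \ {pr a c})) := by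
  have hab := hR.edge_lt h.ab
  have hce := hR.edge_lt h.ce
  have hcyc := h.cyc
  have hac : Edge N R a c := Or.inr h.diag
  have hord : ∀ {r s}, (r, s) ∈ R → pr r s = (r, s) := fun {r s} hrs =>
    pr_of_lt (by have := hR.diag r s hrs; omega)
  have hedge : ∀ {r s}, (r, s) ∈ R → Edge N R r s := fun {r s} hrs =>
    Or.inr (by rwa [hord hrs])
  have hb : ∀ {r s}, (r, s) ∈ R → (r, s) ≠ pr a c → ¬Cyc b r e s ∧ ¬Cyc b s e r := by
    intro r s hrs hne
    refine ⟨hR.not_cyc_flip h (hedge hrs) (by rwa [hord hrs]),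
      hR.not_cyc_flip h (hedge hrs).symm (by rwa [pr_comm, hord hrs])⟩
  constructor
  · rintro p q (hpq | hpq)
    · have hd := hR.diag _ _ h.diag
      have h1 : p = min b e := congrArg Prod.fst hpq
      have h2 : q = max b e := congrArg Prod.snd hpq
      unfold Cyc at hcyc
      omega
    · exact hR.diag _ _ hpq.1
  · rintro p q r s (hpq | hpq) (hrs | hrs) hc
    · have := hpq.trans hrs.symm
      rw [Prod.mk.injEq] at this
      omega
    · obtain ⟨h1, h2⟩ := hb hrs.1 hrs.2
      have h3 : p = min b e := congrArg Prod.fst hpq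
      have h4 : q = max b e := congrArg Prod.snd hpq
      unfold Cyc at h1 h2
      omega
    · obtain ⟨h1, h2⟩ := hb hpq.1 hpq.2
      have h3 : r = min b e := congrArg Prod.fst hrs
      have h4 : s = max b e := congrArg Prod.snd hrs
      unfold Cyc at h1 h2
      omega
    · exact hR.nc _ _ _ _ hpq.1 hrs.1 hc
  · intro p q h1 h2 h3 h4
    by_contra hn
    have hn1 : (p, q) ≠ pr b e := fun H => hn (Or.inl H)
    -- Maximality after the flip: a diagonal `pq` that crosses none of the new set crosses no old
    -- edge other than possibly `ac`, hence not `ac` either by `cyc_aux`. So it belongs to `R`, and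
    -- it is not `ac`, which crosses `be`.
    have h5 : ∀ {r s}, Edge N R r s → pr r s ≠ pr a c → ¬Cyc p r q s := by
      intro r s hrs hne hc
      rcases hrs with hrs | hrs
      · unfold Side at hrs; unfold Cyc at hc; omega
      · have := h4 (min r s) (max r s) (Or.inr ⟨hrs, hne⟩)
        unfold Cyc at hc
        omega
    have h6 : ¬Cyc p b q e ∧ ¬Cyc p e q b := by
      have := h4 (min b e) (max b e) (Or.inl rfl)
      unfold Cyc
      omega
    have h7 : ∀ {r s}, Edge N R r s → pr r s ≠ pr a c → ¬Cyc p r q s ∧ ¬Cyc p s q r :=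
      fun {r s} hrs hne => ⟨h5 hrs hne, h5 hrs.symm (pr_comm r s ▸ hne)⟩
    have i1 := h7 h.ab (by rw [Ne, pr_eq_iff]; unfold Cyc at hcyc; omega)
    have i2 := h7 h.bc (by rw [Ne, pr_eq_iff]; unfold Cyc at hcyc; omega)
    have i3 := h7 h.ce (by rw [Ne, pr_eq_iff]; unfold Cyc at hcyc; omega)
    have i4 := h7 h.ea (by rw [Ne, pr_eq_iff]; unfold Cyc at hcyc; omega)
    have i5 : ¬Cyc p a q c ∧ ¬Cyc p c q a := by
      rw [← pr_of_lt (show p < q by omega), Ne, pr_eq_iff] at hn1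
      exact cyc_aux hcyc hn1 i1 i2 i3 i4
    have h8 : (p, q) ∈ R := by
      refine hR.maximal p q h1 h2 h3 fun r s hrs => ?_
      by_cases hne : (r, s) = pr a c
      · have h9 : r = min a c := congrArg Prod.fst hne
        have h10 : s = max a c := congrArg Prod.snd hne
        unfold Cyc at i5
        omega
      · exact h4 r s (Or.inr ⟨hrs, hne⟩)
    refine hn (Or.inr ⟨h8, ?_⟩)
    rintro (h9 : (p, q) = pr a c)
    rw [← pr_of_lt (show p < q by omega), pr_eq_iff] at h9
    rcases h9 with ⟨rfl, rfl⟩ | ⟨rfl, rfl⟩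
    · exact h6.1 hcyc
    · exact h6.2 hcyc.rot.rot

/-- A noncrossing set of diagonals that contains triangles on the inner sides of its elements
and of the side from the first to the last vertex is a triangulation. -/
theorem of_inside (hN : 2 ≤ N) (hd : ∀ p q, (p, q) ∈ R → p + 1 < q ∧ q < N ∧ ¬(p = 0 ∧ q + 1 = N))
    (hnc : ∀ p q r s, (p, q) ∈ R → (r, s) ∈ R → ¬(p < r ∧ r < q ∧ q < s))
    (hin : ∀ a c, a + 1 < c → Edge N R a c → ∃ b, a < b ∧ b < c ∧ Edge N R a b ∧ Edge N R b c) :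
    IsTri N R := by
  refine ⟨hd, hnc, fun p q h1 h2 h3 h4 => ?_⟩
  -- An edge `ac` enclosing `pq` is replaced by a smaller one: the apex `b` of its inner triangle
  -- cannot lie strictly between `p` and `q`, as `ab` or `bc` would then be a diagonal that crosses
  -- `pq`.
  suffices H : ∀ k a c, c - a = k → a ≤ p → q ≤ c → Edge N R a c → (p, q) ∈ R from
    H _ 0 (N - 1) rfl (by omega) (by omega) (edge_base R (by omega))
  intro k
  induction k using Nat.strong_induction_on with
  | _ k ih =>
    intro a c hk hp hq hac
    by_cases heq : p = a ∧ q = c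
    · obtain ⟨rfl, rfl⟩ := heq
      rw [edge_iff (by omega)] at hac
      rcases hac with hac | hac
      · omega
      · exact hac
    obtain ⟨b, h5, h6, h7, h8⟩ := hin a c (by omega) hac
    by_cases hqb : q ≤ b
    · exact ih (b - a) (by omega) a b rfl hp hqb h7
    by_cases hbp : b ≤ p
    · exact ih (c - b) (by omega) b c rfl hbp hq h8
    exfalso
    rw [edge_iff h5] at h7
    rw [edge_iff h6] at h8
    rcases h7 with h7 | h7
    · rcases h8 with h8 | h8
      · omega
      · have := h4 b c h8
        omega
    · have i1 := h4 a b h7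
      rcases h8 with h8 | h8
      · omega
      · have := h4 b c h8
        omega

/-- A set of vertices that contains the ends of the long side and is closed under completing
triangles contains all vertices. -/
theorem propagate (hR : IsTri N R) (G : ℕ → Prop) (h0 : G 0) (h1 : G (N - 1))
    (h : ∀ a b c, a < b → b < c → c < N → Edge N R a b → Edge N R b c → Edge N R a c →
      G a → G c → G b) {k : ℕ} (hk : k < N) : G k := by
  suffices H : ∀ l a c, c - a = l → a < c → Edge N R a c → G a → G c → ∀ k, a ≤ k → k ≤ c → G k by
    by_cases hN : N = 1
    · have : k = 0 := by omega
      exact this ▸ h0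
    exact H _ 0 (N - 1) rfl (by omega) (edge_base R (by omega)) h0 h1 k (by omega) (by omega)
  intro l
  induction l using Nat.strong_induction_on with
  | _ l ih =>
    intro a c hl hac he ha hc k hak hkc
    by_cases hs : a + 1 < c
    · obtain ⟨b, h2, h3, h4, h5⟩ := hR.exists_inside hs he
      have hb : G b := h a b c h2 h3 (hR.edge_lt he).2.1 h4 h5 he ha hc
      rcases le_total k b with hkb | hkb
      · exact ih (b - a) (by omega) a b rfl h2 h4 ha hb k hak hkb
      · exact ih (c - b) (by omega) b c rfl h3 h5 hb hc k hkb hkc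
    · obtain rfl | rfl : k = a ∨ k = c := by omega
      · exact ha
      · exact hc

/-- A set of vertices that contains the vertices of the triangle at the long side and is closed
under completing quadrilaterals contains all vertices. -/
theorem propagate_quad (hR : IsTri N R) (G : ℕ → Prop) {r : ℕ} (hr : 0 < r) (hrN : r + 1 < N)
    (hr0 : Edge N R 0 r) (hrm : Edge N R r (N - 1)) (h0 : G 0) (h1 : G (N - 1)) (h2 : G r)
    (h : ∀ a b c e, Quad N R a b c e → G a → G c → G e → G b) {k : ℕ} (hk : k < N) : G k := by
  -- The vertex `e` of the triangle beyond `ac` is carried along, so that the next apex completes a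
  -- quadrilateral whose other corners are already known.
  suffices H : ∀ l a c e, c - a = l → a < c → (e < a ∨ c < e) → Edge N R a c → Edge N R c e →
      Edge N R e a → G a → G c → G e → ∀ k, a ≤ k → k ≤ c → G k by
    rcases le_total k r with hkr | hkr
    · exact H _ 0 r (N - 1) rfl hr (by omega) hr0 hrm (edge_base R (by omega)).symm h0 h2 h1 k
        (by omega) hkr
    · exact H _ r (N - 1) 0 rfl (by omega) (by omega) hrm (edge_base R (by omega)).symm hr0 h2 h1 h0
        k hkr (by omega)
  intro l
  induction l using Nat.strong_induction_on with
  | _ l ih =>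
    intro a c e hl hac he hEac hEce hEea ha hc hge k hak hkc
    have hN := hR.edge_lt hEce
    by_cases hs : a + 1 < c
    · obtain ⟨b, h3, h4, h5, h6⟩ := hR.exists_inside hs hEac
      have hq : Quad N R a b c e := by
        refine ⟨by unfold Cyc; omega, ?_, h5, h6, hEce, hEea⟩
        rcases hEac with h | h
        · unfold Side at h; omega
        · exact h
      have hb : G b := h a b c e hq ha hc hge
      rcases le_total k b with hkb | hkb
      · exact ih (b - a) (by omega) a b c rfl h3 (by omega) h5 h6 hEac.symm ha hb hc k hak hkb
      · exact ih (c - b) (by omega) b c a rfl h4 (by omega) h6 hEac.symm h5 hb hc ha k hkb hkc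
    · obtain rfl | rfl : k = a ∨ k = c := by omega
      · exact ha
      · exact hc

end IsTri

end

section

/-! ### General facts about mutation -/

namespace IceQuiver

variable {n m : ℕ}

theorem b_self (Q : IceQuiver n m) (u : Fin n ⊕ Fin m) : Q.b u u = 0 := by
  have := Q.skew u u
  omega

theorem mutate_left (Q : IceQuiver n m) (k : Fin n) (v : Fin n ⊕ Fin m) :
    (Q.mutate k).b (Sum.inl k) v = -Q.b (Sum.inl k) v := by
  simp [mutate]

theorem mutate_right (Q : IceQuiver n m) (k : Fin n) (v : Fin n ⊕ Fin m) :
    (Q.mutate k).b v (Sum.inl k) = -Q.b v (Sum.inl k) := by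
  simp [mutate]

theorem mutate_of_ne (Q : IceQuiver n m) {k : Fin n} {u : Fin n ⊕ Fin m} {v : Fin n}
    (hu : u ≠ Sum.inl k) (hv : v ≠ k) :
    (Q.mutate k).b u (Sum.inl v) = Q.b u (Sum.inl v)
      + max (Q.b u (Sum.inl k)) 0 * max (Q.b (Sum.inl k) (Sum.inl v)) 0
      - max (-Q.b u (Sum.inl k)) 0 * max (-Q.b (Sum.inl k) (Sum.inl v)) 0 := by
  simp [mutate, hu, hv]

theorem ext_inl {Q Q' : IceQuiver n m} (h : ∀ u v, Q.b u (Sum.inl v) = Q'.b u (Sum.inl v)) :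
    Q = Q' := by
  ext u v
  rcases v with v | v
  · exact h u v
  · rcases u with u | u
    · rw [Q.skew, Q'.skew, h]
    · rw [Q.frozen, Q'.frozen]

theorem mutate_mutate (Q : IceQuiver n m) (k : Fin n) : (Q.mutate k).mutate k = Q := by
  refine ext_inl fun u v => ?_
  by_cases hv : v = k
  · subst hv
    rw [mutate_right, mutate_right, neg_neg]
  by_cases hu : u = Sum.inl k
  · subst hu
    rw [mutate_left, mutate_left, neg_neg]
  rw [mutate_of_ne _ hu hv, mutate_of_ne _ hu hv, mutate_right, mutate_left]
  simp only [neg_neg]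
  ring

/-- Mutation preserves really full rank. -/
theorem ReallyFullRank.mutate {Q : IceQuiver n m} (h : Q.ReallyFullRank) (k : Fin n) :
    (Q.mutate k).ReallyFullRank := by
  -- The column operation of matrix mutation. It is an involution, hence surjective, and it sends
  -- each old row to a new row plus a multiple of the new row `k`; so the new rows span the image of
  -- the old span.
  let f : (Fin n → ℤ) →ₗ[ℤ] (Fin n → ℤ) :=
    { toFun := fun r v => if v = k then -r k else r v + r k * max (Q.b (Sum.inl k) (Sum.inl v)) 0
      map_add' := fun r s => by ext v; by_cases hv : v = k <;> simp [hv] <;> ring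
      map_smul' := fun c r => by
        ext v
        by_cases hv : v = k
        · simp [hv]
        · simp [hv]; ring }
  have hf : Function.Surjective f := by
    intro r
    refine ⟨f r, ?_⟩
    ext v
    by_cases hv : v = k <;> simp [f, hv]
  unfold ReallyFullRank at *
  set row : Fin n ⊕ Fin m → Fin n → ℤ := fun u i => Q.b u (Sum.inl i) with hrow
  set row' : Fin n ⊕ Fin m → Fin n → ℤ := fun u i => (Q.mutate k).b u (Sum.inl i) with hrow'
  have hk : f (row (Sum.inl k)) = -row' (Sum.inl k) := by
    ext v
    by_cases hv : v = k <;> simp [f, hrow, hrow', hv, mutate_left, b_self]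
  have hu : ∀ u, u ≠ Sum.inl k →
      f (row u) = row' u + max (-Q.b u (Sum.inl k)) 0 • row' (Sum.inl k) := by
    intro u hu
    ext v
    by_cases hv : v = k
    · simp [f, hrow, hrow', hv, mutate_right, b_self]
    · simp only [f, hrow, hrow', hv, LinearMap.coe_mk, AddHom.coe_mk, if_false, Pi.add_apply,
        Pi.smul_apply, smul_eq_mul, mutate_of_ne Q hu hv, mutate_left]
      rcases le_total 0 (Q.b u (Sum.inl k)) with h1 | h1 <;>
      rcases le_total 0 (Q.b (Sum.inl k) (Sum.inl v)) with h2 | h2 <;>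
      simp [h1, h2]
  have hle : Submodule.map f (Submodule.span ℤ (Set.range row)) ≤
      Submodule.span ℤ (Set.range row') := by
    rw [Submodule.map_span, Submodule.span_le]
    rintro _ ⟨_, ⟨u, rfl⟩, rfl⟩
    have hmem : ∀ u, row' u ∈ Submodule.span ℤ (Set.range row') :=
      fun u => Submodule.subset_span ⟨u, rfl⟩
    by_cases huk : u = Sum.inl k
    · rw [huk, hk]
      exact Submodule.neg_mem _ (hmem _)
    · rw [hu u huk]
      exact Submodule.add_mem _ (hmem _) (Submodule.smul_mem _ _ (hmem _))
  rw [h, Submodule.map_top, LinearMap.range_eq_top.2 hf] at hle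
  exact top_le_iff.1 hle

/-- Integers that express the unit vectors by the rows of the extended exchange matrix. -/
theorem ReallyFullRank.exists_inverse {Q : IceQuiver n m} (h : Q.ReallyFullRank) :
    ∃ r : Fin n → Fin n ⊕ Fin m → ℤ, ∀ i j,
      ∑ u, r i u * Q.b u (Sum.inl j) = if i = j then 1 else 0 := by
  have : ∀ i : Fin n, ∃ c : Fin n ⊕ Fin m → ℤ,
      ∑ u, c u • (fun j : Fin n => Q.b u (Sum.inl j)) = Pi.single i 1 := fun i =>
    (Submodule.mem_span_range_iff_exists_fun ℤ).1 (h.symm ▸ Submodule.mem_top)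
  choose r hr using this
  refine ⟨r, fun i j => ?_⟩
  have := congrFun (hr i) j
  rw [Finset.sum_apply] at this
  simpa [Pi.single_apply, eq_comm] using this

end IceQuiver

namespace LabeledSeed

variable {n m : ℕ} {K : Type*} [Field K]

/-- The right hand side of the exchange relation. -/
noncomputable def exch (S : LabeledSeed n m K) (k : Fin n) : K :=
  ∏ v, S.x v ^ (S.Q.b (Sum.inl k) v).toNat + ∏ v, S.x v ^ (S.Q.b v (Sum.inl k)).toNat

theorem mutate_x_self (S : LabeledSeed n m K) (k : Fin n) :
    (S.mutate k).x (Sum.inl k) = S.exch k / S.x (Sum.inl k) := by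
  simp [mutate, exch]

theorem mutate_x_of_ne (S : LabeledSeed n m K) {k : Fin n} {u : Fin n ⊕ Fin m}
    (h : u ≠ Sum.inl k) : (S.mutate k).x u = S.x u := by
  simp [mutate, h]

theorem exch_mutate (S : LabeledSeed n m K) (k : Fin n) : (S.mutate k).exch k = S.exch k := by
  unfold exch
  rw [add_comm]
  congr 1 <;> refine Finset.prod_congr rfl fun v _ => ?_
  · by_cases h : v = Sum.inl k
    · subst h
      simp [IceQuiver.b_self]
    · rw [mutate_x_of_ne _ h]
      congr 2
      show (S.Q.mutate k).b _ _ = _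
      rw [IceQuiver.mutate_right, S.Q.skew, neg_neg]
  · by_cases h : v = Sum.inl k
    · subst h
      simp [IceQuiver.b_self]
    · rw [mutate_x_of_ne _ h]
      congr 2
      show (S.Q.mutate k).b _ _ = _
      rw [IceQuiver.mutate_left, S.Q.skew, neg_neg]

/-- As a polynomial in the extended cluster, the exchange binomial takes the value 2 when all
variables are 1, so it is not the zero polynomial over `ℤ`. -/
theorem exch_ne_zero {S : LabeledSeed n m K} (h : AlgebraicIndependent ℤ S.x) (k : Fin n) :
    S.exch k ≠ 0 := by
  intro h0
  let p : MvPolynomial (Fin n ⊕ Fin m) ℤ :=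
    ∏ v, MvPolynomial.X v ^ (S.Q.b (Sum.inl k) v).toNat +
      ∏ v, MvPolynomial.X v ^ (S.Q.b v (Sum.inl k)).toNat
  have hp : MvPolynomial.aeval S.x p = S.exch k := by simp [p, exch]
  have : p = 0 := h.eq_zero_of_aeval_eq_zero _ (hp.trans h0)
  have h2 : MvPolynomial.aeval (fun _ => (1 : ℤ)) p = 2 := by simp [p]
  rw [this] at h2
  simp at h2

/-- There are no loops, so the exchange binomial is a polynomial in the variables other than `x_k`.
If the new variable were algebraic over these, then so would be `x_k`, its quotient. -/
theorem algebraicIndependent_mutate {S : LabeledSeed n m K} (h : AlgebraicIndependent ℤ S.x)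
    (k : Fin n) : AlgebraicIndependent ℤ (S.mutate k).x := by
  have hne := exch_ne_zero h k
  rw [AlgebraicIndependent.iff_transcendental_adjoin_image (Sum.inl k)] at h ⊢
  have himage : (S.mutate k).x '' {Sum.inl k}ᶜ = S.x '' {Sum.inl k}ᶜ :=
    Set.image_congr fun u hu => mutate_x_of_ne S hu
  refine ⟨?_, ?_⟩
  · convert h.1 using 2 with j
    exact mutate_x_of_ne S j.2
  · rw [himage, mutate_x_self]
    intro halg
    refine h.2 ?_
    have hmem : S.exch k ∈ Algebra.adjoin ℤ (S.x '' {Sum.inl k}ᶜ) := by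
      refine Subalgebra.add_mem _ ?_ ?_ <;> refine Subalgebra.prod_mem _ fun v _ => ?_
      all_goals
        by_cases hv : v = Sum.inl k
        · subst hv
          simp [IceQuiver.b_self]
        · exact Subalgebra.pow_mem _ (Algebra.subset_adjoin (Set.mem_image_of_mem _ hv)) _
    have h1 : IsAlgebraic (Algebra.adjoin ℤ (S.x '' {Sum.inl k}ᶜ)) (S.exch k) :=
      isAlgebraic_algebraMap (⟨_, hmem⟩ : Algebra.adjoin ℤ (S.x '' {Sum.inl k}ᶜ))
    have h2 := h1.mul halg.inv
    rwa [inv_div, mul_div_cancel₀ _ hne] at h2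

theorem mutate_mutate {S : LabeledSeed n m K} (h : AlgebraicIndependent ℤ S.x) (k : Fin n) :
    (S.mutate k).mutate k = S := by
  have h0 : S.x (Sum.inl k) ≠ 0 := h.ne_zero _
  refine LabeledSeed.ext (funext fun u => ?_) (S.Q.mutate_mutate k)
  by_cases hu : u = Sum.inl k
  · subst hu
    rw [mutate_x_self, exch_mutate, mutate_x_self, div_div_cancel₀ (exch_ne_zero h k)]
  · rw [mutate_x_of_ne _ hu, mutate_x_of_ne _ hu]

theorem MutationEquiv.algebraicIndependent {S S' : LabeledSeed n m K} (h : S.MutationEquiv S')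
    (hS : AlgebraicIndependent ℤ S.x) : AlgebraicIndependent ℤ S'.x := by
  induction h with
  | refl => exact hS
  | tail _ h ih =>
    obtain ⟨k, rfl⟩ := h
    exact algebraicIndependent_mutate ih k

theorem MutationEquiv.reallyFullRank {S S' : LabeledSeed n m K} (h : S.MutationEquiv S')
    (hS : S.Q.ReallyFullRank) : S'.Q.ReallyFullRank := by
  induction h with
  | refl => exact hS
  | tail _ h ih =>
    obtain ⟨k, rfl⟩ := h
    exact ih.mutate k

theorem MutationEquiv.symm {S S' : LabeledSeed n m K} (h : S.MutationEquiv S')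
    (hS : AlgebraicIndependent ℤ S.x) : S'.MutationEquiv S := by
  induction h with
  | refl => exact Relation.ReflTransGen.refl
  | tail h1 h ih =>
    obtain ⟨k, rfl⟩ := h
    exact Relation.ReflTransGen.head
      ⟨k, (mutate_mutate (MutationEquiv.algebraicIndependent h1 hS) k).symm⟩ ih

theorem MutationEquiv.frozen {S S' : LabeledSeed n m K} (h : S.MutationEquiv S') (j : Fin m) :
    S'.x (Sum.inr j) = S.x (Sum.inr j) := by
  induction h with
  | refl => rfl
  | tail _ h ih =>
    obtain ⟨k, rfl⟩ := h
    rw [mutate_x_of_ne _ (by simp), ih]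

end LabeledSeed

/-! ### Reduction to the linear orientation of the path by mutations at sinks. -/

namespace IceQuiver

variable {n m : ℕ}

/-- The mutable vertices form a path in the order given by `σ`, oriented from each vertex to
the next one. -/
def IsLinear (Q : IceQuiver n m) (σ : Equiv.Perm (Fin n)) : Prop :=
  ∀ i j : Fin n, Q.b (Sum.inl (σ i)) (Sum.inl (σ j)) =
    if i.val + 1 = j.val then 1 else if j.val + 1 = i.val then -1 else 0

/-- The mutable vertices form a path in the order given by `σ`. -/
def IsPath (Q : IceQuiver n m) (σ : Equiv.Perm (Fin n)) : Prop :=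
  ∀ i j : Fin n, |Q.b (Sum.inl (σ i)) (Sum.inl (σ j))| =
    if i.val + 1 = j.val ∨ j.val + 1 = i.val then 1 else 0

/-- Mutation at a sink of the mutable part. -/
theorem mutate_sink (Q : IceQuiver n m) {k : Fin n}
    (hk : ∀ u : Fin n, 0 ≤ Q.b (Sum.inl u) (Sum.inl k)) (u v : Fin n) :
    (Q.mutate k).b (Sum.inl u) (Sum.inl v) = if u = k ∨ v = k then -Q.b (Sum.inl u) (Sum.inl v)
      else Q.b (Sum.inl u) (Sum.inl v) := by
  have h1 := hk u
  have h2 := hk v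
  by_cases hu : u = k
  · subst hu; rw [mutate_left]; simp
  by_cases hv : v = k
  · subst hv; rw [mutate_right]; simp
  rw [mutate_of_ne Q (by simpa using hu) hv, Q.skew (Sum.inl v) (Sum.inl k)]
  simp [hu, hv, h1, h2]

end IceQuiver

namespace LabeledSeed

variable {n m : ℕ} {K : Type*} [Field K]

/-- Among the first arrows of the path only the one between places `t` and `t + 1` points backwards,
so place `t` is a sink. Mutation there reverses both arrows at it, which moves the backward arrow
one place towards the start. -/
theorem mutate_path (σ : Equiv.Perm (Fin n)) {k : ℕ} {t : Fin n} (ht : t ≤ k)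
    (S : LabeledSeed n m K) (hS : S.Q.IsPath σ)
    (h : ∀ i j : Fin n, i.val + 1 = j.val → i.val ≤ k →
      S.Q.b (Sum.inl (σ i)) (Sum.inl (σ j)) = if i = t then -1 else 1) :
    (S.mutate (σ t)).Q.IsPath σ ∧ ∀ i j : Fin n, i.val + 1 = j.val → i.val ≤ k →
      (S.mutate (σ t)).Q.b (Sum.inl (σ i)) (Sum.inl (σ j)) = if j = t then -1 else 1 := by
  have hsink : ∀ u : Fin n, 0 ≤ S.Q.b (Sum.inl u) (Sum.inl (σ t)) := by
    intro u
    obtain ⟨i, rfl⟩ := σ.surjective u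
    by_cases h1 : i.val + 1 = t.val
    · rw [h i t h1 (by omega), if_neg (by rintro rfl; omega)]
      norm_num
    by_cases h2 : t.val + 1 = i.val
    · rw [S.Q.skew, h t i h2 ht, if_pos rfl]
      norm_num
    · have := hS i t
      rw [if_neg (by tauto)] at this
      exact (abs_eq_zero.1 this).ge
  have hb := S.Q.mutate_sink hsink
  refine ⟨fun i j => ?_, fun i j hij hi => ?_⟩
  · show |(S.Q.mutate (σ t)).b _ _| = _
    rw [hb, ← hS i j]
    split_ifs <;> simp
  · show (S.Q.mutate (σ t)).b _ _ = _
    rw [hb, h i j hij hi]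
    simp only [σ.injective.eq_iff]
    by_cases h1 : i = t
    · have h2 : j ≠ t := by rintro rfl; omega
      simp [h1, h2]
    · by_cases h2 : j = t <;> simp [h1, h2]

/-- By iteration of `mutate_path` the backward arrow is pushed past the start of the path, where it
disappears. -/
theorem exists_linear_aux (σ : Equiv.Perm (Fin n)) (k : ℕ) (hk : k + 1 < n) (t : ℕ) :
    t ≤ k → ∀ S : LabeledSeed n m K, S.Q.IsPath σ →
    (∀ i j : Fin n, i.val + 1 = j.val → i.val ≤ k →
      S.Q.b (Sum.inl (σ i)) (Sum.inl (σ j)) = if i.val = t then -1 else 1) →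
    ∃ S' : LabeledSeed n m K, S.MutationEquiv S' ∧ S'.Q.IsPath σ ∧
      ∀ i j : Fin n, i.val + 1 = j.val → i.val ≤ k →
        S'.Q.b (Sum.inl (σ i)) (Sum.inl (σ j)) = 1 := by
  induction t with
  | zero =>
    intro ht S hS h
    have := mutate_path σ (t := ⟨0, by omega⟩) ht S hS (by simpa [Fin.ext_iff] using h)
    refine ⟨_, Relation.ReflTransGen.single ⟨_, rfl⟩, this.1, fun i j hij hi => ?_⟩
    rw [this.2 i j hij hi, if_neg (by simp only [Fin.ext_iff]; omega)]
  | succ t ih =>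
    intro ht S hS h
    have := mutate_path σ (t := ⟨t + 1, by omega⟩) ht S hS (by simpa [Fin.ext_iff] using h)
    obtain ⟨S', h1, h2⟩ := ih (by omega) _ this.1 fun i j hij hi => by
      rw [this.2 i j hij hi]
      simp only [Fin.ext_iff, ← hij, Nat.add_right_cancel_iff]
    exact ⟨S', Relation.ReflTransGen.head ⟨_, rfl⟩ h1, h2⟩

theorem exists_linear (S : LabeledSeed n m K) (h : S.Q.IsDynkinA) :
    ∃ S' : LabeledSeed n m K, S.MutationEquiv S' ∧ ∃ σ, S'.Q.IsLinear σ := by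
  obtain ⟨σ, hσ⟩ := h
  have : ∀ k : ℕ, ∃ S' : LabeledSeed n m K, S.MutationEquiv S' ∧ S'.Q.IsPath σ ∧
      ∀ i j : Fin n, i.val + 1 = j.val → i.val < k →
        S'.Q.b (Sum.inl (σ i)) (Sum.inl (σ j)) = 1 := by
    intro k
    induction k with
    | zero => exact ⟨S, Relation.ReflTransGen.refl, hσ, fun i j _ h => by omega⟩
    | succ k ih =>
      obtain ⟨S', h1, h2, h3⟩ := ih
      by_cases hk : k + 1 < n
      · by_cases h4 : S'.Q.b (Sum.inl (σ ⟨k, by omega⟩)) (Sum.inl (σ ⟨k + 1, hk⟩)) = 1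
        · refine ⟨S', h1, h2, fun i j hij hi => ?_⟩
          by_cases hik : i.val = k
          · have hi' : i = ⟨k, Nat.lt_of_succ_lt hk⟩ := Fin.ext hik
            have hj' : j = ⟨k + 1, hk⟩ := Fin.ext (by simp only; omega)
            rw [hi', hj', h4]
          · exact h3 i j hij (by omega)
        · have h5 := h2 ⟨k, by omega⟩ ⟨k + 1, hk⟩
          rw [if_pos (Or.inl rfl), abs_eq (by norm_num)] at h5
          have h6 := h5.resolve_left h4
          obtain ⟨S'', h7, h8, h9⟩ := exists_linear_aux σ k hk k le_rfl S' h2 (fun i j hij hi => by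
            split_ifs with hik
            · have hi' : i = ⟨k, Nat.lt_of_succ_lt hk⟩ := Fin.ext hik
              have hj' : j = ⟨k + 1, hk⟩ := Fin.ext (by simp only; omega)
              rw [hi', hj', h6]
            · exact h3 i j hij (by omega))
          exact ⟨S'', Relation.ReflTransGen.trans h1 h7, h8, fun i j hij hi =>
            h9 i j hij (by omega)⟩
      · exact ⟨S', h1, h2, fun i j hij hi => h3 i j hij (by have := j.2; omega)⟩
  obtain ⟨S', h1, h2, h3⟩ := this n
  refine ⟨S', h1, σ, fun i j => ?_⟩
  split_ifs with hij hji
  · exact h3 i j hij i.2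
  · rw [S'.Q.skew, h3 j i hji j.2]
  · have := h2 i j
    rw [if_neg (by tauto)] at this
    exact abs_eq_zero.1 this

end LabeledSeed

end

section

/-! ### Plücker coordinates and their tropical versions -/

/-- The tropical Plücker relations on an `N`-gon. -/
def IsTropical (N : ℕ) (w : ℕ → ℕ → ℤ) : Prop :=
  ∀ a b c e, a < N → b < N → c < N → e < N → Cyc a b c e →
    w a c + w b e = min (w a b + w c e) (w b c + w e a)

/-- The Plücker relations on an `N`-gon. -/
def IsPlucker {L : Type*} [Field L] (N : ℕ) (z : ℕ → ℕ → L) : Prop :=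
  ∀ a b c e, a < N → b < N → c < N → e < N → Cyc a b c e →
    z a c * z b e = z a b * z c e + z b c * z e a

theorem isTropical_of_lt {N : ℕ} {w : ℕ → ℕ → ℤ} (hs : ∀ a b, w a b = w b a)
    (h : ∀ a b c e, a < b → b < c → c < e → e < N →
      w a c + w b e = min (w a b + w c e) (w b c + w e a)) : IsTropical N w := by
  intro a b c e ha hb hc he hcyc
  rcases hcyc with ⟨h1, h2, h3⟩ | ⟨h1, h2, h3⟩ | ⟨h1, h2, h3⟩ | ⟨h1, h2, h3⟩
  · exact h a b c e h1 h2 h3 he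
  · rw [add_comm, hs a c, h b c e a h1 h2 h3 ha, min_comm, add_comm (w c e)]
  · rw [hs a c, hs b e, h c e a b h1 h2 h3 hb, add_comm (w c e), add_comm (w e a)]
  · rw [add_comm, hs b e, h e a b c h1 h2 h3 hc, min_comm, add_comm (w e a)]

theorem isPlucker_of_lt {L : Type*} [Field L] {N : ℕ} {z : ℕ → ℕ → L}
    (hs : ∀ a b, z a b = z b a)
    (h : ∀ a b c e, a < b → b < c → c < e → e < N →
      z a c * z b e = z a b * z c e + z b c * z e a) : IsPlucker N z := by
  intro a b c e ha hb hc he hcyc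
  rcases hcyc with ⟨h1, h2, h3⟩ | ⟨h1, h2, h3⟩ | ⟨h1, h2, h3⟩ | ⟨h1, h2, h3⟩
  · exact h a b c e h1 h2 h3 he
  · rw [mul_comm, hs a c, h b c e a h1 h2 h3 ha, add_comm, mul_comm (z c e)]
  · rw [hs a c, hs b e, h c e a b h1 h2 h3 hb, mul_comm (z c e), mul_comm (z e a)]
  · rw [mul_comm, hs b e, h e a b c h1 h2 h3 hc, add_comm, mul_comm (z e a)]

/-- The Laurent monomial in `g` with exponents `v`. -/
def mon {m : ℕ} {L : Type*} [Field L] (g : Fin m → L) (v : Fin m → ℤ) : L := ∏ j, g j ^ v j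

section mon

variable {m : ℕ} {L : Type*} [Field L] {g : Fin m → L}

theorem mon_add (hg : ∀ j, g j ≠ 0) (v v' : Fin m → ℤ) :
    mon g (fun j => v j + v' j) = mon g v * mon g v' := by
  simp only [mon, zpow_add₀ (hg _), Finset.prod_mul_distrib]

theorem mon_ne_zero (hg : ∀ j, g j ≠ 0) (v : Fin m → ℤ) : mon g v ≠ 0 :=
  Finset.prod_ne_zero_iff.2 fun j _ => zpow_ne_zero _ (hg j)

theorem mon_zero : mon g (fun _ => 0) = 1 := by
  simp [mon]

theorem mon_neg (hg : ∀ j, g j ≠ 0) (v : Fin m → ℤ) : mon g (fun j => -v j) * mon g v = 1 := by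
  rw [← mon_add hg]
  simp [mon_zero]

theorem mon_toNat (v : Fin m → ℤ) :
    mon g (fun j => ((v j).toNat : ℤ)) = ∏ j, g j ^ (v j).toNat := by
  simp only [mon, zpow_natCast]

/-- The exchange relation for a quadrilateral with rescaled variables. -/
def ExchRel (g : Fin m → L) (w : Fin m → ℕ → ℕ → ℤ) (χ : ℕ → ℕ → L) (a b c e : ℕ) : Prop :=
  χ a c * χ b e =
    χ a b * χ c e * ∏ j, g j ^ (w j a b + w j c e - w j b c - w j e a).toNat +
    χ b c * χ e a * ∏ j, g j ^ (-(w j a b + w j c e - w j b c - w j e a)).toNat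

/-- The coefficient exponents are the differences between the two tropical products `w a b + w c e`
and `w b c + w e a` and their minimum. By the tropical relation this minimum is `w a c + w b e`, so
multiplication by one common monomial gives the Plücker relation. -/
theorem exchRel_iff (hg : ∀ j, g j ≠ 0) {w : Fin m → ℕ → ℕ → ℤ} (χ : ℕ → ℕ → L) {a b c e : ℕ}
    (hw : ∀ j, w j a c + w j b e = min (w j a b + w j c e) (w j b c + w j e a)) :
    ExchRel g w χ a b c e ↔
      (χ a c * mon g (w · a c)) * (χ b e * mon g (w · b e)) =
        (χ a b * mon g (w · a b)) * (χ c e * mon g (w · c e)) +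
        (χ b c * mon g (w · b c)) * (χ e a * mon g (w · e a)) := by
  have h1 : mon g (w · a b) * mon g (w · c e) = mon g (w · a c) * mon g (w · b e) *
      ∏ j, g j ^ (w j a b + w j c e - w j b c - w j e a).toNat := by
    rw [← mon_toNat, ← mon_add hg, ← mon_add hg, ← mon_add hg]
    congr 1
    ext j
    have := hw j
    omega
  have h2 : mon g (w · b c) * mon g (w · e a) = mon g (w · a c) * mon g (w · b e) *
      ∏ j, g j ^ (-(w j a b + w j c e - w j b c - w j e a)).toNat := by
    rw [← mon_toNat, ← mon_add hg, ← mon_add hg, ← mon_add hg]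
    congr 1
    ext j
    have := hw j
    omega
  have h0 : mon g (w · a c) * mon g (w · b e) ≠ 0 :=
    mul_ne_zero (mon_ne_zero hg _) (mon_ne_zero hg _)
  rw [show (χ a b * mon g (w · a b)) * (χ c e * mon g (w · c e)) =
    χ a b * χ c e * (mon g (w · a b) * mon g (w · c e)) by ring,
    show (χ b c * mon g (w · b c)) * (χ e a * mon g (w · e a)) =
    χ b c * χ e a * (mon g (w · b c) * mon g (w · e a)) by ring, h1, h2,
    show (χ a c * mon g (w · a c)) * (χ b e * mon g (w · b e)) =
    (mon g (w · a c) * mon g (w · b e)) * (χ a c * χ b e) by ring]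
  unfold ExchRel
  constructor
  · intro h
    rw [h]
    ring
  · intro h
    refine mul_left_cancel₀ h0 (h.trans ?_)
    ring

end mon

/-- Frozen variables `g`, tropical coordinates `w` for each of them, and elements `χ a b` for the
sides and diagonals of the `(n + 3)`-gon that satisfy the corresponding exchange relations. -/
structure Coordinates (n m : ℕ) (K : Type*) [Field K] where
  g : Fin m → K
  w : Fin m → ℕ → ℕ → ℤ
  χ : ℕ → ℕ → K
  g_ne : ∀ j, g j ≠ 0
  w_symm : ∀ j a b, w j a b = w j b a
  χ_symm : ∀ a b, χ a b = χ b a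
  χ_self : ∀ a, χ a a = 0
  -- The sides are normalised to 1; coefficients enter only through `g` and `w`.
  χ_side : ∀ a b, Side (n + 3) a b → χ a b = 1
  trop : ∀ j, IsTropical (n + 3) (w j)
  exch : ∀ a b c e, a < n + 3 → b < n + 3 → c < n + 3 → e < n + 3 → Cyc a b c e →
    ExchRel g w χ a b c e

/-- The minimum of `c i, …, c (i + k)`. -/
def runMin (c : ℕ → ℤ) (i : ℕ) : ℕ → ℤ
  | 0 => c i
  | k + 1 => min (runMin c i k) (c (i + k + 1))

theorem runMin_add (c : ℕ → ℤ) (i p q : ℕ) :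
    runMin c i (p + 1 + q) = min (runMin c i p) (runMin c (i + p + 1) q) := by
  induction q with
  | zero => rfl
  | succ q ih =>
    rw [← add_assoc, runMin, ih, runMin, min_assoc]
    congr 3
    omega

/-- Tropical coordinates that vanish at the diagonals from vertex `0`. -/
def fanTrop (c : ℕ → ℤ) (a b : ℕ) : ℤ :=
  if min a b = 0 then 0 else runMin c (min a b) (max a b - min a b - 1)

/-- The coordinate of `ab` with `0 < a < b` is the minimum of `c` over `[a, b)`, the tropical form
of `fanPlucker` with `x = 1`. Splitting intervals at the vertices in between reduces the relation to
one among the minima of three consecutive intervals. -/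
theorem isTropical_fanTrop (N : ℕ) (c : ℕ → ℤ) : IsTropical N (fanTrop c) := by
  refine isTropical_of_lt (fun a b => by simp only [fanTrop, min_comm, max_comm]) ?_
  intro a b d e hab hbd hde _
  have h1 : fanTrop c b e = min (fanTrop c b d) (fanTrop c d e) := by
    simp only [fanTrop, min_eq_left hbd.le, min_eq_left hde.le, min_eq_left (hbd.trans hde).le,
      max_eq_right hbd.le, max_eq_right hde.le, max_eq_right (hbd.trans hde).le]
    rw [if_neg (by omega), if_neg (by omega), if_neg (by omega),
      show e - b - 1 = (d - b - 1) + 1 + (e - d - 1) by omega, runMin_add]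
    congr 2
    omega
  have hs : fanTrop c e a = fanTrop c a e := by simp only [fanTrop, min_comm, max_comm]
  rw [hs]
  by_cases ha : a = 0
  · subst ha
    have h0 : ∀ x, fanTrop c 0 x = 0 := fun x => by simp [fanTrop]
    rw [h0, h0, h0, h1]
    simp [min_comm]
  · have key : ∀ x y, a < x → x < y → fanTrop c a y = min (fanTrop c a x) (fanTrop c x y) := by
      intro x y hx hy
      simp only [fanTrop, min_eq_left hx.le, min_eq_left hy.le, min_eq_left (hx.trans hy).le,
        max_eq_right hx.le, max_eq_right hy.le, max_eq_right (hx.trans hy).le]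
      rw [if_neg (by omega), if_neg (by omega), if_neg (by omega),
        show y - a - 1 = (x - a - 1) + 1 + (y - x - 1) by omega, runMin_add]
      congr 2
      omega
    rw [key b d hab hbd, key d e (hab.trans hbd) hde, key b d hab hbd, h1]
    omega

/-- Plücker coordinates with prescribed values `x` at the diagonals from vertex `0` and `c` at
the sides. -/
noncomputable def fanPlucker {L : Type*} [Field L] (x c : ℕ → L) (a b : ℕ) : L :=
  if a = b then 0 else if min a b = 0 then x (max a b) else
    x (min a b) * x (max a b) * ∑ k ∈ Finset.Ico (min a b) (max a b), c k / (x k * x (k + 1))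

theorem fanPlucker_symm {L : Type*} [Field L] (x c : ℕ → L) (a b : ℕ) :
    fanPlucker x c a b = fanPlucker x c b a := by
  simp only [fanPlucker, min_comm, max_comm, eq_comm]

theorem fanPlucker_zero {L : Type*} [Field L] (x c : ℕ → L) {a : ℕ} (ha : a ≠ 0) :
    fanPlucker x c 0 a = x a := by
  simp [fanPlucker, ha.symm]

theorem fanPlucker_of_lt {L : Type*} [Field L] (x c : ℕ → L) {a b : ℕ} (ha : a ≠ 0) (hab : a < b) :
    fanPlucker x c a b = x a * x b * ∑ k ∈ Finset.Ico a b, c k / (x k * x (k + 1)) := by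
  simp [fanPlucker, min_eq_left hab.le, max_eq_right hab.le, ha, hab.ne]

/-- Away from vertex `0` the coordinate has the form `x a * x b * (s b - s a)` with partial sums
`s`, a determinant of plane vectors; vertex `0` plays the part of the point at infinity. The
relation is then an identity in the sums over consecutive intervals, which needs no nonvanishing. -/
theorem isPlucker_fanPlucker {L : Type*} [Field L] (N : ℕ) (x c : ℕ → L) :
    IsPlucker N (fanPlucker x c) := by
  refine isPlucker_of_lt (fanPlucker_symm x c) ?_
  intro a b d e hab hbd hde _
  have hb : b ≠ 0 := by omega
  rw [fanPlucker_symm x c e a, fanPlucker_of_lt x c (by omega) (hbd.trans hde),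
    fanPlucker_of_lt x c (a := d) (by omega) hde, fanPlucker_of_lt x c hb hbd,
    ← Finset.sum_Ico_consecutive _ hbd.le hde.le]
  by_cases ha : a = 0
  · subst ha
    rw [fanPlucker_zero _ _ (by omega), fanPlucker_zero _ _ (by omega),
      fanPlucker_zero _ _ (by omega)]
    ring
  · rw [fanPlucker_of_lt x c ha (hab.trans hbd), fanPlucker_of_lt x c ha hab,
      fanPlucker_of_lt x c ha (hab.trans (hbd.trans hde)),
      ← Finset.sum_Ico_consecutive _ hab.le hbd.le,
      ← Finset.sum_Ico_consecutive _ hab.le (hbd.trans hde).le,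
      ← Finset.sum_Ico_consecutive _ hbd.le hde.le]
    ring

/-- Coordinates with prescribed values at the diagonals from vertex `0`. -/
noncomputable def fanCoordinates (n : ℕ) {m : ℕ} {K : Type*} [Field K] (g : Fin m → K)
    (hg : ∀ j, g j ≠ 0) (c : Fin m → ℕ → ℤ) (x : ℕ → K) (hx : ∀ k, x k ≠ 0) (h1 : x 1 = 1)
    (hN : x (n + 2) = 1) : Coordinates n m K where
  g := g
  w j := fanTrop (c j)
  -- The Plücker coordinates of the sides are the monomials with exponents `c · k`; dividing out the
  -- tropical monomials makes every side equal to 1.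
  χ a b := fanPlucker x (fun k => mon g (c · k)) a b * mon g (fun j => -fanTrop (c j) a b)
  g_ne := hg
  w_symm j a b := by simp only [fanTrop, min_comm, max_comm]
  χ_symm a b := by
    rw [fanPlucker_symm]
    simp only [fanTrop, min_comm, max_comm]
  χ_self a := by simp [fanPlucker]
  χ_side a b h := by
    wlog hab : a < b generalizing a b
    · rw [fanPlucker_symm]
      have := this b a h.symm (by unfold Side at h; omega)
      simpa only [fanTrop, min_comm, max_comm] using this
    by_cases ha : a = 0
    · subst ha
      rw [fanPlucker_zero _ _ (by omega)]
      have h0 : ∀ j, fanTrop (c j) 0 b = 0 := fun j => by simp [fanTrop]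
      simp only [h0, neg_zero, mon_zero, mul_one]
      obtain rfl | rfl : b = 1 ∨ b = n + 2 := by unfold Side at h; omega
      · exact h1
      · exact hN
    · obtain rfl : b = a + 1 := by unfold Side at h; omega
      have h0 : ∀ j, fanTrop (c j) a (a + 1) = c j a := fun j => by simp [fanTrop, ha, runMin]
      rw [fanPlucker_of_lt _ _ ha hab]
      simp only [h0, Nat.Ico_succ_singleton, Finset.sum_singleton]
      rw [mul_div_cancel₀ _ (mul_ne_zero (hx _) (hx _)), mul_comm, mon_neg hg]
  trop j := isTropical_fanTrop _ _
  exch a b d e ha hb hd he hcyc := by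
    rw [exchRel_iff hg _ fun j => isTropical_fanTrop (n + 3) (c j) a b d e ha hb hd he hcyc]
    have : ∀ a b, fanPlucker x (fun k => mon g (c · k)) a b * mon g (fun j => -fanTrop (c j) a b) *
        mon g (fun j => fanTrop (c j) a b) = fanPlucker x (fun k => mon g (c · k)) a b := by
      intro a b
      rw [mul_assoc, mon_neg hg, mul_one]
    simp only [this]
    exact isPlucker_fanPlucker (n + 3) _ _ a b d e ha hb hd he hcyc

end

section

/-! ### Seeds and triangulations -/

variable {n m : ℕ} {K : Type*} [Field K]

namespace Coordinates

/-- The weight of the segment `ab` with respect to a vertex of the quiver: the tropical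
coordinate for a frozen vertex, the indicator function of `d i` for a mutable vertex `i`. -/
def weight (P : Coordinates n m K) (d : Fin n → ℕ × ℕ) : Fin n ⊕ Fin m → ℕ → ℕ → ℤ
  | Sum.inl i => fun a b => if d i = pr a b then 1 else 0
  | Sum.inr j => P.w j

theorem weight_symm (P : Coordinates n m K) (d : Fin n → ℕ × ℕ) (u : Fin n ⊕ Fin m) (a b : ℕ) :
    P.weight d u a b = P.weight d u b a := by
  rcases u with i | j
  · simp only [weight, pr_comm]
  · exact P.w_symm j a b

/-- The seed `S` is the seed of the triangulation with diagonals `d i`. -/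
structure Realizes (P : Coordinates n m K) (S : LabeledSeed n m K) (d : Fin n → ℕ × ℕ) : Prop where
  inj : Function.Injective d
  tri : IsTri (n + 3) (Set.range d)
  x_inl : ∀ i, S.x (Sum.inl i) = P.χ (d i).1 (d i).2
  x_inr : ∀ j, S.x (Sum.inr j) = P.g j
  -- The entry at `u` and `v` is the shear coordinate of the weight of `u` across the diagonal `v`.
  b_eq : ∀ v a b c e, Quad (n + 3) (Set.range d) a b c e → d v = pr a c → ∀ u,
    S.Q.b u (Sum.inl v) =
      P.weight d u a b + P.weight d u c e - P.weight d u b c - P.weight d u e a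

theorem χ_pr (P : Coordinates n m K) (a b : ℕ) : P.χ (pr a b).1 (pr a b).2 = P.χ a b := by
  rcases le_total a b with h | h
  · simp [pr, h]
  · rw [P.χ_symm a b]
    simp [pr, h]

theorem prod_indicator (P : Coordinates n m K) {d : Fin n → ℕ × ℕ} (hd : Function.Injective d)
    {a b : ℕ} (h : Edge (n + 3) (Set.range d) a b) :
    ∏ i, P.χ (d i).1 (d i).2 ^ (if d i = pr a b then 1 else 0) = P.χ a b := by
  by_cases hab : ∃ i, d i = pr a b
  · obtain ⟨i, hi⟩ := hab
    rw [Finset.prod_eq_single i]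
    · rw [if_pos hi, pow_one, hi, χ_pr]
    · intro j _ hj
      rw [if_neg (fun h' => hj (hd (h'.trans hi.symm))), pow_zero]
    · simp
  · rw [P.χ_side a b (h.resolve_right hab)]
    refine Finset.prod_eq_one fun i _ => ?_
    rw [if_neg (fun h => hab ⟨i, h⟩), pow_zero]

/-- The four sides of a quadrilateral are distinct pairs, so for a mutable vertex the positive part
of the exponent keeps just the indicators of `ab` and `ce`. A side of the polygon has no indicator,
but its variable is 1. -/
theorem prod_weight (P : Coordinates n m K) {S : LabeledSeed n m K} {d : Fin n → ℕ × ℕ}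
    (h : P.Realizes S d) {a b c e : ℕ} (hab : Edge (n + 3) (Set.range d) a b)
    (hce : Edge (n + 3) (Set.range d) c e) (hcyc : Cyc a b c e) :
    ∏ v, S.x v ^ (P.weight d v a b + P.weight d v c e - P.weight d v b c
      - P.weight d v e a).toNat =
    P.χ a b * P.χ c e * ∏ j, P.g j ^ (P.w j a b + P.w j c e - P.w j b c - P.w j e a).toNat := by
  rw [Fintype.prod_sum_type]
  congr 1
  · rw [← P.prod_indicator h.inj hab, ← P.prod_indicator h.inj hce, ← Finset.prod_mul_distrib]
    refine Finset.prod_congr rfl fun i _ => ?_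
    rw [h.x_inl, ← pow_add]
    congr 1
    simp only [weight]
    have h1 : ∀ {p q r s : ℕ}, pr p q ≠ pr r s → d i = pr p q → d i ≠ pr r s :=
      fun hne h1 h2 => hne (h1.symm.trans h2)
    have hne1 : pr a b ≠ pr b c := by rw [Ne, pr_eq_iff]; unfold Cyc at hcyc; omega
    have hne2 : pr a b ≠ pr e a := by rw [Ne, pr_eq_iff]; unfold Cyc at hcyc; omega
    have hne3 : pr c e ≠ pr b c := by rw [Ne, pr_eq_iff]; unfold Cyc at hcyc; omega
    have hne4 : pr c e ≠ pr e a := by rw [Ne, pr_eq_iff]; unfold Cyc at hcyc; omega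
    have hne5 : pr b c ≠ pr e a := by rw [Ne, pr_eq_iff]; unfold Cyc at hcyc; omega
    by_cases i1 : d i = pr a b
    · rw [if_neg (h1 hne1 i1), if_neg (h1 hne2 i1)]
      split_ifs <;> rfl
    by_cases i2 : d i = pr c e
    · rw [if_neg (h1 hne3 i2), if_neg (h1 hne4 i2)]
      split_ifs <;> rfl
    · rw [if_neg i1, if_neg i2, if_neg i1, if_neg i2]
      split_ifs <;> rfl
  · refine Finset.prod_congr rfl fun j _ => ?_
    rw [h.x_inr]
    rfl

/-- The exchange relation of the seed of a triangulation. -/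
theorem exch_eq (P : Coordinates n m K) {S : LabeledSeed n m K} {d : Fin n → ℕ × ℕ}
    (h : P.Realizes S d) {k : Fin n} {a b c e : ℕ} (hq : Quad (n + 3) (Set.range d) a b c e)
    (hk : d k = pr a c) : S.exch k = P.χ a c * P.χ b e := by
  have hab := h.tri.edge_lt hq.ab
  have hce := h.tri.edge_lt hq.ce
  rw [P.exch a b c e hab.1 hab.2.1 hce.1 hce.2.1 hq.cyc, ← P.prod_weight h hq.ab hq.ce hq.cyc]
  have h2 : P.χ b c * P.χ e a *
      ∏ j, P.g j ^ (-(P.w j a b + P.w j c e - P.w j b c - P.w j e a)).toNat =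
      ∏ v, S.x v ^ (P.weight d v b c + P.weight d v e a - P.weight d v c e
        - P.weight d v a b).toNat := by
    rw [P.prod_weight h hq.bc hq.ea hq.cyc.rot]
    congr 1
    refine Finset.prod_congr rfl fun j _ => ?_
    congr 2
    ring
  rw [h2, LabeledSeed.exch, add_comm]
  congr 1
  · refine Finset.prod_congr rfl fun v _ => ?_
    rw [h.b_eq k a b c e hq hk]
  · refine Finset.prod_congr rfl fun v _ => ?_
    rw [S.Q.skew, h.b_eq k a b c e hq hk]
    congr 2
    ring

theorem pr_mem_flip {d : Fin n → ℕ × ℕ} (hd : Function.Injective d) {k : Fin n} {p q : ℕ × ℕ}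
    (hk : d k = p) (hq : q ∉ Set.range d) :
    Function.Injective (Function.update d k q) ∧
      Set.range (Function.update d k q) = insert q (Set.range d \ {p}) := by
  constructor
  · intro i j hij
    by_cases hi : i = k <;> by_cases hj : j = k
    · rw [hi, hj]
    · subst hi
      rw [Function.update_self, Function.update_of_ne hj] at hij
      exact absurd ⟨j, hij.symm⟩ hq
    · subst hj
      rw [Function.update_self, Function.update_of_ne hi] at hij
      exact absurd ⟨i, hij⟩ hq
    · rw [Function.update_of_ne hi, Function.update_of_ne hj] at hij
      exact hd hij
  · ext x
    constructor
    · rintro ⟨i, rfl⟩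
      by_cases hi : i = k
      · subst hi
        rw [Function.update_self]
        exact Or.inl rfl
      · rw [Function.update_of_ne hi]
        exact Or.inr ⟨⟨i, rfl⟩, fun h => hi (hd (h.trans hk.symm))⟩
    · rintro (rfl | ⟨⟨i, rfl⟩, hi⟩)
      · exact ⟨k, Function.update_self ..⟩
      · refine ⟨i, Function.update_of_ne ?_ ..⟩
        rintro rfl
        exact hi hk

end Coordinates

namespace IsTri

variable {N : ℕ} {R : Set (ℕ × ℕ)} {a b c e : ℕ}

theorem flip_notMem (hR : IsTri N R) (h : Quad N R a b c e) : pr b e ∉ R := fun hbe =>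
  hR.edge_nc (Or.inr h.diag) (Or.inr hbe) h.cyc

theorem edge_of_flip (hR : IsTri N R) (h : Quad N R a b c e) {p q : ℕ}
    (hpq : Edge N (insert (pr b e) (R \ {pr a c})) p q) :
    pr p q = pr b e ∨ (Edge N R p q ∧ pr p q ≠ pr a c) := by
  rcases hpq with h1 | h1 | h1
  · refine Or.inr ⟨Or.inl h1, fun h2 => ?_⟩
    have := hR.diag (min a c) (max a c) h.diag
    rw [pr_eq_iff] at h2
    unfold Side at h1
    omega
  · exact Or.inl h1
  · exact Or.inr ⟨Or.inr h1.1, h1.2⟩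

theorem edge_flip {p q : ℕ} (hpq : Edge N R p q)
    (hne : pr p q ≠ pr a c) : Edge N (insert (pr b e) (R \ {pr a c})) p q :=
  hpq.imp id fun h1 => Or.inr ⟨h1, hne⟩

/-- The quadrilateral of the new diagonal after a flip. -/
theorem quad_flip (h : Quad N R a b c e) :
    Quad N (insert (pr b e) (R \ {pr a c})) b c e a := by
  have hcyc := h.cyc
  refine ⟨h.cyc.rot, Or.inl rfl, edge_flip h.bc ?_, edge_flip h.ce ?_,
    edge_flip h.ea ?_, edge_flip h.ab ?_⟩ <;>
  · rw [Ne, pr_eq_iff]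
    unfold Cyc at hcyc
    omega

end IsTri

/-! ### Mutations are flips. -/

namespace Coordinates

/-- The data of a seed of a triangulation together with a mutation and the corresponding flip. -/
structure FlipData (P : Coordinates n m K) (S : LabeledSeed n m K) (d d' : Fin n → ℕ × ℕ)
    (k : Fin n) (a b c e : ℕ) : Prop where
  real : P.Realizes S d
  quad : Quad (n + 3) (Set.range d) a b c e
  hk : d k = pr a c
  hd' : d' = Function.update d k (pr b e)

namespace FlipData

variable {P : Coordinates n m K} {S : LabeledSeed n m K} {d d' : Fin n → ℕ × ℕ} {k : Fin n}
  {a b c e : ℕ}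

theorem rot (h : P.FlipData S d d' k a b c e) : P.FlipData S d d' k c e a b :=
  ⟨h.real, h.quad.rot, h.hk.trans (pr_comm a c), h.hd'.trans (by rw [pr_comm])⟩

theorem inj_range (h : P.FlipData S d d' k a b c e) : Function.Injective d' ∧
    Set.range d' = insert (pr b e) (Set.range d \ {pr a c}) := by
  rw [h.hd']
  exact pr_mem_flip h.real.inj h.hk (h.real.tri.flip_notMem h.quad)

theorem tri (h : P.FlipData S d d' k a b c e) : IsTri (n + 3) (Set.range d') := by
  rw [h.inj_range.2]
  exact h.real.tri.flip h.quad

theorem quad' (h : P.FlipData S d d' k a b c e) : Quad (n + 3) (Set.range d') b c e a := by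
  rw [h.inj_range.2]
  exact IsTri.quad_flip h.quad

theorem edge_of (h : P.FlipData S d d' k a b c e) {p q : ℕ}
    (hpq : Edge (n + 3) (Set.range d') p q) :
    pr p q = pr b e ∨ (Edge (n + 3) (Set.range d) p q ∧ pr p q ≠ pr a c) := by
  rw [h.inj_range.2] at hpq
  exact h.real.tri.edge_of_flip h.quad hpq

theorem d'_self (h : P.FlipData S d d' k a b c e) : d' k = pr b e := by
  rw [h.hd', Function.update_self]

theorem d'_of_ne (h : P.FlipData S d d' k a b c e) {v : Fin n} (hv : v ≠ k) : d' v = d v := by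
  rw [h.hd', Function.update_of_ne hv]

theorem weight_of_ne (h : P.FlipData S d d' k a b c e) {u : Fin n ⊕ Fin m} (hu : u ≠ Sum.inl k) :
    P.weight d' u = P.weight d u := by
  rcases u with u | u
  · have : d' u = d u := h.d'_of_ne (by rintro rfl; exact hu rfl)
    simp only [weight, this]
  · rfl

theorem weight_self (h : P.FlipData S d d' k a b c e) (x y : ℕ) :
    P.weight d' (Sum.inl k) x y = if pr x y = pr b e then 1 else 0 := by
  simp only [weight, h.d'_self, eq_comm]

theorem weight_old (h : P.FlipData S d d' k a b c e) (x y : ℕ) :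
    P.weight d (Sum.inl k) x y = if pr x y = pr a c then 1 else 0 := by
  simp only [weight, h.hk, eq_comm]

/-- Mutable vertices other than `k` obey the tropical relation too: their diagonal is neither `ac`
nor `be` and is at most one of the four sides, so both members vanish. This lets mutable and frozen
rows be treated alike below. -/
theorem trop (h : P.FlipData S d d' k a b c e) {u : Fin n ⊕ Fin m} (hu : u ≠ Sum.inl k) :
    P.weight d u a c + P.weight d u b e =
      min (P.weight d u a b + P.weight d u c e) (P.weight d u b c + P.weight d u e a) := by
  have hab := h.real.tri.edge_lt h.quad.ab
  have hce := h.real.tri.edge_lt h.quad.ce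
  have hcyc := h.quad.cyc
  rcases u with u | u
  · have hne : d u ≠ pr a c := fun h1 => hu (by rw [h.real.inj (h1.trans h.hk.symm)])
    have hne' : d u ≠ pr b e := fun h1 => h.real.tri.flip_notMem h.quad ⟨u, h1⟩
    simp only [weight, if_neg hne, if_neg hne']
    have h1 : ∀ {p q r s : ℕ}, pr p q ≠ pr r s → d u = pr p q → d u ≠ pr r s :=
      fun hne h1 h2 => hne (h1.symm.trans h2)
    have hne1 : pr a b ≠ pr b c := by rw [Ne, pr_eq_iff]; unfold Cyc at hcyc; omega
    have hne2 : pr a b ≠ pr e a := by rw [Ne, pr_eq_iff]; unfold Cyc at hcyc; omega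
    have hne3 : pr c e ≠ pr b c := by rw [Ne, pr_eq_iff]; unfold Cyc at hcyc; omega
    have hne4 : pr c e ≠ pr e a := by rw [Ne, pr_eq_iff]; unfold Cyc at hcyc; omega
    by_cases i1 : d u = pr a b
    · rw [if_neg (h1 hne1 i1), if_neg (h1 hne2 i1)]
      split_ifs <;> rfl
    by_cases i2 : d u = pr c e
    · rw [if_neg (h1 hne3 i2), if_neg (h1 hne4 i2)]
      split_ifs <;> rfl
    · rw [if_neg i1, if_neg i2]
      split_ifs <;> rfl
  · exact P.trop u a b c e hab.1 hab.2.1 hce.1 hce.2.1 hcyc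

/-- The exchange matrix after a flip, for the flipped diagonal. -/
theorem b_self (h : P.FlipData S d d' k a b c e) {p q r s : ℕ}
    (hq : Quad (n + 3) (Set.range d') p q r s) (hp : p = b) (hr : r = e) (u : Fin n ⊕ Fin m) :
    (S.mutate k).Q.b u (Sum.inl k) = P.weight d' u p q + P.weight d' u r s - P.weight d' u q r
      - P.weight d' u s p := by
  subst hp hr
  have hcyc := h.quad.cyc
  have hcyc' := hq.cyc
  obtain rfl : q = c := h.tri.third_unique hq.bc.symm hq.ab h.quad'.bc.symm h.quad'.ab
    ⟨a, by unfold Cyc at *; omega, by unfold Cyc at *; omega⟩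
  obtain rfl : s = a := h.tri.third_unique hq.ea.symm hq.ce h.quad'.ea.symm h.quad'.ce
    ⟨q, by unfold Cyc at *; omega, by unfold Cyc at *; omega⟩
  show (S.Q.mutate k).b _ _ = _
  rw [IceQuiver.mutate_right, h.real.b_eq k _ _ _ _ h.quad h.hk]
  by_cases hu : u = Sum.inl k
  · subst hu
    simp only [h.weight_self, h.weight_old, pr_eq_iff]
    unfold Cyc at hcyc
    repeat rw [if_neg (by omega)]
    rfl
  · rw [h.weight_of_ne hu]
    ring

/-- The exchange matrix after a flip, for a diagonal with a triangle at the flipped diagonal. -/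
theorem b_first (h : P.FlipData S d d' k a b c e) {p q r s : ℕ} {v : Fin n} (hv : v ≠ k)
    (hq : Quad (n + 3) (Set.range d') p q r s) (hdv : d' v = pr p r) (hp : p = b) (hq' : q = e)
    (u : Fin n ⊕ Fin m) :
    (S.mutate k).Q.b u (Sum.inl v) = P.weight d' u p q + P.weight d' u r s - P.weight d' u q r
      - P.weight d' u s p := by
  subst hp hq'
  have hcyc := h.quad.cyc
  have hcyc' := hq.cyc
  obtain rfl : r = a := h.tri.third_unique (Or.inr hq.diag) hq.bc h.quad'.ea.symm h.quad'.ce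
    ⟨c, by unfold Cyc at *; omega, by unfold Cyc at *; omega⟩
  have hne : pr r s ≠ pr p q ∧ pr s p ≠ pr p q := by
    simp only [Ne, pr_eq_iff]
    unfold Cyc at hcyc'
    omega
  have hrs := (h.edge_of hq.ce).resolve_left hne.1
  have hsp := (h.edge_of hq.ea).resolve_left hne.2
  rw [h.d'_of_ne hv] at hdv
  -- Before the flip the triangle at `v` on this side had apex `c` instead of `q`, while the other
  -- triangle was the same. Replacing one apex by the other changes the shear coordinate as the
  -- mutation rule demands, by the tropical relation `ht` for the flipped quadrilateral.
  have hQ : Quad (n + 3) (Set.range d) p c r s :=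
    ⟨by unfold Cyc at *; omega, hdv ▸ ⟨v, rfl⟩, h.quad.bc, Or.inr (pr_comm r c ▸ h.quad.diag),
      hrs.1, hsp.1⟩
  have hb := h.real.b_eq v _ _ _ _ hQ hdv
  have hbk : S.Q.b (Sum.inl k) (Sum.inl v) = -1 := by
    rw [hb]
    simp only [h.weight_old]
    rw [if_neg hrs.2, if_neg hsp.2, if_neg (by rw [pr_eq_iff]; unfold Cyc at hcyc; omega),
      if_pos (pr_comm c r)]
    rfl
  show (S.Q.mutate k).b _ _ = _
  by_cases hu : u = Sum.inl k
  · subst hu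
    rw [IceQuiver.mutate_left, hbk]
    simp only [h.weight_self]
    rw [if_pos trivial, if_neg hne.1, if_neg hne.2,
      if_neg (by rw [pr_eq_iff]; unfold Cyc at hcyc'; omega)]
    rfl
  · have ht := h.trop hu
    rw [IceQuiver.mutate_of_ne _ hu hv, hbk, hb, h.real.b_eq k _ _ _ _ h.quad h.hk,
      h.weight_of_ne hu, P.weight_symm d u c r]
    rw [show max (-1 : ℤ) 0 = 0 from rfl, show max (-(-1) : ℤ) 0 = 1 from rfl]
    omega

/-- The companion of `b_first` in which the new diagonal is the next side `qr` of the quadrilateral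
of `v`. Half turns of either quadrilateral reduce all other positions to these two. -/
theorem b_second (h : P.FlipData S d d' k a b c e) {p q r s : ℕ} {v : Fin n} (hv : v ≠ k)
    (hq : Quad (n + 3) (Set.range d') p q r s) (hdv : d' v = pr p r) (hq' : q = b) (hr : r = e)
    (u : Fin n ⊕ Fin m) :
    (S.mutate k).Q.b u (Sum.inl v) = P.weight d' u p q + P.weight d' u r s - P.weight d' u q r
      - P.weight d' u s p := by
  subst hq' hr
  have hcyc := h.quad.cyc
  have hcyc' := hq.cyc
  obtain rfl : p = a := h.tri.third_unique hq.ab.symm (Or.inr (pr_comm p r ▸ hq.diag))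
    h.quad'.ea.symm h.quad'.ce ⟨c, by unfold Cyc at *; omega, by unfold Cyc at *; omega⟩
  have hne : pr r s ≠ pr q r ∧ pr s p ≠ pr q r := by
    simp only [Ne, pr_eq_iff]
    unfold Cyc at hcyc'
    omega
  have hrs := (h.edge_of hq.ce).resolve_left hne.1
  have hsp := (h.edge_of hq.ea).resolve_left hne.2
  rw [h.d'_of_ne hv] at hdv
  have hQ : Quad (n + 3) (Set.range d) p c r s :=
    ⟨by unfold Cyc at *; omega, hdv ▸ ⟨v, rfl⟩, Or.inr h.quad.diag, h.quad.ce, hrs.1, hsp.1⟩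
  have hb := h.real.b_eq v _ _ _ _ hQ hdv
  have hbk : S.Q.b (Sum.inl k) (Sum.inl v) = 1 := by
    rw [hb]
    simp only [h.weight_old]
    rw [if_neg hrs.2, if_neg hsp.2, if_pos trivial,
      if_neg (by rw [pr_eq_iff]; unfold Cyc at hcyc; omega)]
    rfl
  show (S.Q.mutate k).b _ _ = _
  by_cases hu : u = Sum.inl k
  · subst hu
    rw [IceQuiver.mutate_left, hbk]
    simp only [h.weight_self]
    rw [if_pos trivial, if_neg hne.1, if_neg hne.2,
      if_neg (by rw [pr_eq_iff]; unfold Cyc at hcyc'; omega)]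
    rfl
  · have ht := h.trop hu
    rw [IceQuiver.mutate_of_ne _ hu hv, hbk, hb, h.real.b_eq k _ _ _ _ h.quad h.hk,
      h.weight_of_ne hu, P.weight_symm d u r p] at *
    rw [show max (1 : ℤ) 0 = 1 from rfl, show max (-1 : ℤ) 0 = 0 from rfl]
    omega

/-- Mutation of the seed of a triangulation is the flip of the triangulation. -/
theorem realizes (h : P.FlipData S d d' k a b c e) (hS : AlgebraicIndependent ℤ S.x) :
    P.Realizes (S.mutate k) d' := by
  refine ⟨h.inj_range.1, h.tri, fun i => ?_, fun j => ?_, fun v p q r s hq hdv u => ?_⟩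
  · by_cases hi : i = k
    · subst hi
      have h0 : P.χ a c ≠ 0 := by
        rw [← P.χ_pr, ← h.hk, ← h.real.x_inl]
        exact hS.ne_zero _
      rw [LabeledSeed.mutate_x_self, P.exch_eq h.real h.quad h.hk, h.real.x_inl, h.hk, h.d'_self,
        P.χ_pr, P.χ_pr, mul_div_cancel_left₀ _ h0]
    · rw [LabeledSeed.mutate_x_of_ne _ (by simpa using hi), h.real.x_inl, h.d'_of_ne hi]
  · rw [LabeledSeed.mutate_x_of_ne _ (by simp), h.real.x_inr]
  · by_cases hv : v = k
    · subst hv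
      rw [h.d'_self, pr_eq_iff] at hdv
      rcases hdv with ⟨h1, h2⟩ | ⟨h1, h2⟩
      · exact h.b_self hq h1.symm h2.symm u
      · rw [h.b_self hq.rot h1.symm h2.symm u]
        ring
    have hrot : ∀ {x y}, pr x y = pr b e → (x = b ∧ y = e) ∨ (x = e ∧ y = b) := pr_eq_iff.1
    rcases h.edge_of hq.ab with h1 | h1
    · rcases hrot h1 with ⟨h1, h2⟩ | ⟨h1, h2⟩
      · exact h.b_first hv hq hdv h1 h2 u
      · exact h.rot.b_first hv hq hdv h1 h2 u
    have hdv' : d' v = pr r p := hdv.trans (pr_comm p r)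
    rcases h.edge_of hq.ce with h2 | h2
    · rcases hrot h2 with ⟨h3, h4⟩ | ⟨h3, h4⟩
      · rw [h.b_first hv hq.rot hdv' h3 h4 u]
        ring
      · rw [h.rot.b_first hv hq.rot hdv' h3 h4 u]
        ring
    rcases h.edge_of hq.bc with h3 | h3
    · rcases hrot h3 with ⟨h4, h5⟩ | ⟨h4, h5⟩
      · exact h.b_second hv hq hdv h4 h5 u
      · exact h.rot.b_second hv hq hdv h4 h5 u
    rcases h.edge_of hq.ea with h4 | h4
    · rcases hrot h4 with ⟨h5, h6⟩ | ⟨h5, h6⟩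
      · rw [h.b_second hv hq.rot hdv' h5 h6 u]
        ring
      · rw [h.rot.b_second hv hq.rot hdv' h5 h6 u]
        ring
    -- No side of the quadrilateral of `v` is the new diagonal, so it was a quadrilateral before the
    -- flip. None of its sides is `ac` either, so no arrow joins `k` and `v`, and the column of `v`
    -- stays the same.
    have hdv2 := hdv
    rw [h.d'_of_ne hv] at hdv2
    have hb := h.real.b_eq v p q r s ⟨hq.cyc, hdv2 ▸ ⟨v, rfl⟩, h1.1, h3.1, h2.1, h4.1⟩ hdv2
    have hbk : S.Q.b (Sum.inl k) (Sum.inl v) = 0 := by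
      rw [hb]
      simp only [h.weight_old]
      rw [if_neg h1.2, if_neg h2.2, if_neg h3.2, if_neg h4.2]
      rfl
    show (S.Q.mutate k).b _ _ = _
    by_cases hu : u = Sum.inl k
    · subst hu
      rw [IceQuiver.mutate_left, hbk]
      have hbe := h.real.tri.flip_notMem h.quad
      have hne : ∀ {x y}, Edge (n + 3) (Set.range d) x y → pr x y ≠ pr b e := by
        intro x y hxy heq
        rcases hxy with hxy | hxy
        · have := h.quad.cyc
          have h5 := h.tri.diag (min b e) (max b e) h.quad'.diag
          rw [pr_eq_iff] at heq
          unfold Side at hxy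
          omega
        · exact hbe (heq ▸ hxy)
      simp only [h.weight_self]
      rw [if_neg (hne h1.1), if_neg (hne h2.1), if_neg (hne h3.1), if_neg (hne h4.1)]
      rfl
    · rw [IceQuiver.mutate_of_ne _ hu hv, hbk, hb, h.weight_of_ne hu]
      simp

end FlipData

/-- Each diagonal of the triangulation of a seed can be flipped by a mutation. -/
theorem Realizes.exists_flipData {P : Coordinates n m K} {S : LabeledSeed n m K}
    {d : Fin n → ℕ × ℕ} (h : P.Realizes S d) (k : Fin n) :
    ∃ d' a b c e, P.FlipData S d d' k a b c e := by
  obtain ⟨b, e, -, -, hq⟩ := h.tri.exists_quad (p := (d k).1) (q := (d k).2) ⟨k, rfl⟩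
  have := h.tri.diag (d k).1 (d k).2 ⟨k, rfl⟩
  exact ⟨_, _, _, _, _, h, hq, (pr_of_lt (by omega)).symm, rfl⟩

theorem Realizes.exists_of_mutationEquiv {P : Coordinates n m K} {S S' : LabeledSeed n m K}
    {d : Fin n → ℕ × ℕ} (h : P.Realizes S d) (hS : AlgebraicIndependent ℤ S.x)
    (hSS' : S.MutationEquiv S') : ∃ d', P.Realizes S' d' := by
  induction hSS' with
  | refl => exact ⟨d, h⟩
  | tail h1 h2 ih =>
    obtain ⟨k, rfl⟩ := h2
    obtain ⟨d', h3⟩ := ih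
    obtain ⟨d'', a, b, c, e, h4⟩ := h3.exists_flipData k
    exact ⟨d'', h4.realizes (LabeledSeed.MutationEquiv.algebraicIndependent h1 hS)⟩

/-- The seed of a triangulation is unique. -/
theorem Realizes.equiv {P : Coordinates n m K} {S S' : LabeledSeed n m K} {d d' : Fin n → ℕ × ℕ}
    (h : P.Realizes S d) (h' : P.Realizes S' d') (hr : Set.range d = Set.range d') :
    ∃ σ : Equiv.Perm (Fin n), S' = S.relabel σ := by
  have hex : ∀ i, ∃ j, d j = d' i := fun i => by
    have : d' i ∈ Set.range d := hr ▸ ⟨i, rfl⟩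
    exact this
  choose f hf using hex
  have hinj : Function.Injective f := fun i j hij => h'.inj (by rw [← hf, ← hf, hij])
  let σ : Equiv.Perm (Fin n) := Equiv.ofBijective f (Finite.injective_iff_bijective.1 hinj)
  have hσ : ∀ i, d (σ i) = d' i := hf
  refine ⟨σ, LabeledSeed.ext (funext fun u => ?_) (IceQuiver.ext_inl fun u v => ?_)⟩
  · rcases u with u | u
    · simp [LabeledSeed.relabel, h.x_inl, h'.x_inl, hσ]
    · simp [LabeledSeed.relabel, h.x_inr, h'.x_inr]
  · obtain ⟨b, e, -, -, hq⟩ := h'.tri.exists_quad (p := (d' v).1) (q := (d' v).2) ⟨v, rfl⟩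
    have hlt := h'.tri.diag (d' v).1 (d' v).2 ⟨v, rfl⟩
    have hv : d' v = pr (d' v).1 (d' v).2 := (pr_of_lt (by omega)).symm
    have hw : P.weight d (Sum.map σ id u) = P.weight d' u := by
      rcases u with u | u
      · simp [weight, hσ]
      · rfl
    rw [h'.b_eq v _ _ _ _ hq hv]
    show _ = S.Q.b (Sum.map σ id u) (Sum.inl (σ v))
    rw [h.b_eq (σ v) _ _ _ _ (hr ▸ hq) ((hσ v).trans hv), hw]

end Coordinates

end

/-! ### Existence of coordinates -/

section

variable {n m : ℕ} {K : Type*} [Field K]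

/-- The triangulation by the diagonals from vertex `0`. -/
def fan (n : ℕ) : Set (ℕ × ℕ) := {x | x.1 = 0 ∧ 2 ≤ x.2 ∧ x.2 < n + 2}

theorem mem_fan {p q : ℕ} : (p, q) ∈ fan n ↔ p = 0 ∧ 2 ≤ q ∧ q < n + 2 := Iff.rfl

theorem isTri_fan (n : ℕ) : IsTri (n + 3) (fan n) := by
  refine IsTri.of_inside (by omega) ?_ ?_ ?_
  · intro p q h
    rw [mem_fan] at h
    omega
  · intro p q r s h h'
    rw [mem_fan] at h h'
    omega
  · intro a c hac h
    rw [edge_iff (by omega), mem_fan] at h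
    refine ⟨c - 1, by omega, by omega, ?_, ?_⟩
    · rw [edge_iff (by omega), mem_fan]
      omega
    · rw [edge_iff (by omega), mem_fan]
      omega

/-- A triangulation different from the fan can be flipped so that more diagonals start at `0`. -/
theorem IsTri.exists_flip {R : Set (ℕ × ℕ)} (hR : IsTri (n + 3) R) {j : ℕ} (hj : 2 ≤ j)
    (hjn : j < n + 2) (hjR : (0, j) ∉ R) :
    ∃ p r q, 0 < p ∧ p < r ∧ r < q ∧ Quad (n + 3) R p r q 0 := by
  classical
  -- Let `j` be the least vertex not joined to `0`, and `q` the first neighbour of `0` after `j -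
  -- 1`. Then `0`, `j - 1`, `q` is a triangle, and flipping its side from `j - 1` to `q` creates a
  -- new diagonal at `0`.
  have hex : ∃ j, 2 ≤ j ∧ j < n + 2 ∧ (0, j) ∉ R := ⟨j, hj, hjn, hjR⟩
  obtain ⟨hj2, hjn, hjR⟩ := Nat.find_spec hex
  have hmin : ∀ i, i < Nat.find hex → ¬(2 ≤ i ∧ i < n + 2 ∧ (0, i) ∉ R) :=
    fun i hi => Nat.find_min hex hi
  generalize Nat.find hex = j at hj2 hjn hjR hmin
  have hp : Edge (n + 3) R 0 (j - 1) := by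
    rw [edge_iff (by omega)]
    by_cases h : j = 2
    · left; omega
    · have := hmin (j - 1) (by omega)
      right
      by_contra h'
      exact this ⟨by omega, by omega, h'⟩
  have hexq : ∃ q, j - 1 < q ∧ Edge (n + 3) R 0 q :=
    ⟨n + 2, by omega, edge_base R (by omega)⟩
  obtain ⟨hq1, hq2⟩ := Nat.find_spec hexq
  have hqmin : ∀ i, i < Nat.find hexq → ¬(j - 1 < i ∧ Edge (n + 3) R 0 i) :=
    fun i hi => Nat.find_min hexq hi
  generalize Nat.find hexq = q at hq1 hq2 hqmin
  have hqN := hR.edge_lt hq2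
  have hqj : q ≠ j := by
    rintro rfl
    rw [edge_iff (by omega)] at hq2
    rcases hq2 with h | h
    · omega
    · exact hjR h
  obtain ⟨b, hb1, hb2, hb3, hb4⟩ := hR.exists_inside (by omega) hq2
  have hbp : b = j - 1 := by
    by_contra hne
    by_cases hbj : j - 1 < b
    · exact hqmin b hb2 ⟨hbj, hb3⟩
    · exact hR.edge_nc_aux hp hb4 ⟨hb1, by omega, hq1⟩
  subst hbp
  obtain ⟨r, hr1, hr2, hr3, hr4⟩ := hR.exists_inside (by omega) hb4
  refine ⟨j - 1, r, q, hb1, hr1, hr2, ?_, ?_, hr3, hr4, hq2.symm, hp⟩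
  · unfold Cyc; omega
  · rcases hb4 with h | h
    · unfold Side at h; omega
    · exact h

namespace Coordinates

/-- `P` describes the seeds that are mutation equivalent to `S` by all triangulations. -/
structure IsModel (P : Coordinates n m K) (S : LabeledSeed n m K) : Prop where
  indep : AlgebraicIndependent ℤ S.x
  g_eq : ∀ j, P.g j = S.x (Sum.inr j)
  realizes : ∀ S', S.MutationEquiv S' → ∃ d, P.Realizes S' d
  exists_seed : ∀ R, IsTri (n + 3) R →
    ∃ S' d, S.MutationEquiv S' ∧ P.Realizes S' d ∧ Set.range d = R

/-- Induction on the number of vertices `j` for which `(0, j)` is not in the triangulation: a flip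
from `IsTri.exists_flip` lowers it, the flipped triangulation has a seed by induction, and the
reverse flip is a mutation of this seed. -/
theorem Realizes.exists_seed {P : Coordinates n m K} {S : LabeledSeed n m K} {d : Fin n → ℕ × ℕ}
    (h : P.Realizes S d) (hS : AlgebraicIndependent ℤ S.x) (hd : Set.range d = fan n)
    (R : Set (ℕ × ℕ)) (hR : IsTri (n + 3) R) :
    ∃ S' d', S.MutationEquiv S' ∧ P.Realizes S' d' ∧ Set.range d' = R := by
  classical
  suffices H : ∀ k R, IsTri (n + 3) R →
      ((Finset.range (n + 3)).filter (fun j => (0, j) ∉ R)).card = k →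
      ∃ S' d', S.MutationEquiv S' ∧ P.Realizes S' d' ∧ Set.range d' = R from H _ R hR rfl
  intro k
  induction k using Nat.strong_induction_on with
  | _ k ih =>
    intro R hR hk
    by_cases hfan : ∀ j, 2 ≤ j → j < n + 2 → (0, j) ∈ R
    · refine ⟨S, d, Relation.ReflTransGen.refl, h, ?_⟩
      rw [hd]
      ext ⟨p, q⟩
      rw [mem_fan]
      constructor
      · rintro ⟨rfl, h1, h2⟩
        exact hfan q h1 h2
      · intro hpq
        have h1 := hR.diag p q hpq
        by_cases hp : p = 0
        · omega
        · exact absurd ⟨by omega, by omega, by omega⟩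
            (hR.nc 0 (p + 1) p q (hfan (p + 1) (by omega) (by omega)) hpq)
    · push Not at hfan
      obtain ⟨j, hj, hjn, hjR⟩ := hfan
      obtain ⟨p, r, q, hp, hpr, hrq, hq⟩ := hR.exists_flip hj hjn hjR
      have h0r : pr r 0 = (0, r) := by rw [pr_comm, pr_of_lt (by omega)]
      have hnot := hR.flip_notMem hq
      have hR' := hR.flip hq
      have hq' := IsTri.quad_flip hq
      have hlt : ((Finset.range (n + 3)).filter
          (fun j => (0, j) ∉ insert (pr r 0) (R \ {pr p q}))).card < k := by
        rw [← hk]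
        refine Finset.card_lt_card ((Finset.ssubset_iff_of_subset ?_).2 ⟨r, ?_, ?_⟩)
        · intro i hi
          rw [Finset.mem_filter] at hi ⊢
          refine ⟨hi.1, fun h1 => hi.2 (Or.inr ⟨h1, fun h2 => ?_⟩)⟩
          have : (0 : ℕ) = min p q := congrArg Prod.fst h2
          omega
        · rw [Finset.mem_filter, ← h0r]
          exact ⟨Finset.mem_range.2 (hR.edge_lt hq.ab).2.1, hnot⟩
        · rw [Finset.mem_filter, h0r]
          exact fun h1 => h1.2 (Or.inl rfl)
      obtain ⟨S', d', h1, h2, h3⟩ := ih _ hlt _ hR' (by congr!)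
      rw [← h3] at hq'
      obtain ⟨k, hk⟩ := hq'.diag
      have hF : P.FlipData S' d' (Function.update d' k (pr q p)) k r q 0 p := ⟨h2, hq', hk, rfl⟩
      refine ⟨S'.mutate k, _, Relation.ReflTransGen.tail h1 ⟨k, rfl⟩,
        hF.realizes (LabeledSeed.MutationEquiv.algebraicIndependent h1 hS), ?_⟩
      rw [hF.inj_range.2, h3, pr_comm q p]
      ext x
      simp only [Set.mem_insert_iff, Set.mem_sdiff, Set.mem_singleton_iff]
      constructor
      · rintro (rfl | ⟨rfl | h1, h2⟩)
        · exact hq.diag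
        · exact absurd rfl h2
        · exact h1.1
      · intro hx
        by_cases hxp : x = pr p q
        · exact Or.inl hxp
        · exact Or.inr ⟨Or.inr ⟨hx, hxp⟩, fun h => hnot (h ▸ hx)⟩

/-- The coordinates defined by a seed with linear quiver. -/
theorem exists_realizes_fan (S : LabeledSeed n m K) (hS : AlgebraicIndependent ℤ S.x)
    (σ : Equiv.Perm (Fin n)) (hσ : S.Q.IsLinear σ) :
    ∃ (P : Coordinates n m K) (d : Fin n → ℕ × ℕ), P.Realizes S d ∧ Set.range d = fan n ∧
      ∀ j, P.g j = S.x (Sum.inr j) := by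
  -- At the diagonal from `0` to `i + 2` the shear coordinate of `fanTrop` is `c (i + 2) - c (i +
  -- 1)`, so partial sums of the frozen row reproduce its entries. The variable at place `i` of the
  -- path belongs to this diagonal.
  let c : Fin m → ℕ → ℤ := fun f k => ∑ t ∈ Finset.range (k - 1),
    if h : t < n then S.Q.b (Sum.inr f) (Sum.inl (σ ⟨t, h⟩)) else 0
  let x : ℕ → K := fun j => if h : 2 ≤ j ∧ j < n + 2 then
    S.x (Sum.inl (σ ⟨j - 2, by omega⟩)) else 1
  let P : Coordinates n m K := fanCoordinates n (fun j => S.x (Sum.inr j))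
    (fun j => hS.ne_zero _) c x (fun k => by
      simp only [x]
      split_ifs
      · exact hS.ne_zero _
      · exact one_ne_zero) (by simp [x]) (by simp [x])
  let d : Fin n → ℕ × ℕ := fun v => (0, (σ.symm v).val + 2)
  have hrange : Set.range d = fan n := by
    ext ⟨p, q⟩
    rw [mem_fan]
    constructor
    · rintro ⟨v, hv⟩
      have h1 : 0 = p := congrArg Prod.fst hv
      have h2 : (σ.symm v).val + 2 = q := congrArg Prod.snd hv
      have := (σ.symm v).2
      omega
    · rintro ⟨rfl, h1, h2⟩
      refine ⟨σ ⟨q - 2, by omega⟩, ?_⟩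
      simp only [d, Equiv.symm_apply_apply, Prod.mk.injEq, true_and]
      omega
  refine ⟨P, d, ⟨?_, hrange ▸ isTri_fan n, ?_, fun j => rfl, ?_⟩, hrange, fun j => rfl⟩
  · intro v v' h
    have h2 : (σ.symm v).val + 2 = (σ.symm v').val + 2 := congrArg Prod.snd h
    exact σ.symm.injective (Fin.ext (by omega))
  · intro v
    have h1 : ∀ j, fanTrop (c j) 0 ((σ.symm v).val + 2) = 0 := fun j => by simp [fanTrop]
    have h2 := (σ.symm v).2
    show _ = fanPlucker x _ 0 ((σ.symm v).val + 2) * 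
      mon _ (fun j => -fanTrop (c j) 0 ((σ.symm v).val + 2))
    rw [fanPlucker_zero _ _ (by omega)]
    simp only [h1, neg_zero, mon_zero, mul_one, x]
    rw [dif_pos ⟨by omega, by omega⟩]
    simp
  · have key : ∀ v b e, Quad (n + 3) (fan n) 0 b ((σ.symm v).val + 2) e → ∀ u,
        S.Q.b u (Sum.inl v) = P.weight d u 0 b + P.weight d u ((σ.symm v).val + 2) e
          - P.weight d u b ((σ.symm v).val + 2) - P.weight d u e 0 := by
      intro v b e hq u
      have hv := (σ.symm v).2
      have hcyc := hq.cyc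
      have hb : b = (σ.symm v).val + 1 := by
        have := hq.bc
        rw [edge_iff (by unfold Cyc at hcyc; omega), mem_fan] at this
        unfold Cyc at hcyc
        omega
      have he : e = (σ.symm v).val + 3 := by
        have := hq.ce
        rw [edge_iff (by unfold Cyc at hcyc; omega), mem_fan] at this
        unfold Cyc at hcyc
        omega
      subst hb he
      rcases u with u | u
      · have h1 := hσ (σ.symm u) (σ.symm v)
        rw [Equiv.apply_symm_apply, Equiv.apply_symm_apply] at h1
        rw [h1]
        simp only [weight, d, pr, Prod.mk.injEq]
        split_ifs <;> omega
      · have h0 : ∀ x, P.w u 0 x = 0 := fun x => by simp [P, fanCoordinates, fanTrop]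
        have h1 : ∀ x, x ≠ 0 → P.w u x (x + 1) = c u x := fun x hx => by
          simp [P, fanCoordinates, fanTrop, hx, runMin]
        simp only [weight]
        rw [h0, P.w_symm u _ 0, h0, h1 _ (by omega), h1 _ (by omega)]
        simp only [c]
        rw [show (σ.symm v).val + 2 - 1 = (σ.symm v).val + 1 by omega,
          show (σ.symm v).val + 1 - 1 = (σ.symm v).val by omega, Finset.sum_range_succ,
          dif_pos hv]
        simp
    rw [hrange]
    intro v p q r s hq hv u
    have h2 : pr 0 ((σ.symm v).val + 2) = pr p r := by
      rw [← hv, pr_of_lt (by omega)]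
    rw [pr_eq_iff] at h2
    rcases h2 with ⟨rfl, rfl⟩ | ⟨rfl, rfl⟩
    · exact key v q s hq u
    · rw [key v s q hq.rot u]
      ring

/-- A cluster algebra of type `A_n` has coordinates on the `(n + 3)`-gon. -/
theorem exists_isModel (S : LabeledSeed n m K) (hS : AlgebraicIndependent ℤ S.x)
    (hA : S.IsTypeA) : ∃ P : Coordinates n m K, P.IsModel S := by
  obtain ⟨S₁, h1, hD⟩ := hA
  obtain ⟨S₂, h2, σ, hσ⟩ := S₁.exists_linear hD
  have h12 : S.MutationEquiv S₂ := Relation.ReflTransGen.trans h1 h2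
  have hS2 := h12.algebraicIndependent hS
  obtain ⟨P, d, hr, hd, hg⟩ := exists_realizes_fan S₂ hS2 σ hσ
  refine ⟨P, hS, fun j => (hg j).trans (h12.frozen j), fun S' hS' => ?_, fun R hR => ?_⟩
  · exact hr.exists_of_mutationEquiv hS2 (Relation.ReflTransGen.trans (h12.symm hS) hS')
  · obtain ⟨S', d', h3, h4⟩ := hr.exists_seed hS2 hd R hR
    exact ⟨S', d', Relation.ReflTransGen.trans h12 h3, h4⟩

end Coordinates

end

section

/-! ### Points of the projective line -/

section P1

variable {F : Type*} [Field F]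

theorem mk_eq_mk_iff_mul {a b c d : F} (h : ![a, b] ≠ 0) (h' : ![c, d] ≠ 0) :
    Projectivization.mk F ![a, b] h = Projectivization.mk F ![c, d] h' ↔ a * d = b * c := by
  rw [Projectivization.mk_eq_mk_iff']
  constructor
  · rintro ⟨t, ht⟩
    have h0 : t * c = a := by simpa using congrFun ht 0
    have h1 : t * d = b := by simpa using congrFun ht 1
    rw [← h0, ← h1]
    ring
  · intro hab
    by_cases hc : c = 0
    · have hd : d ≠ 0 := by
        rintro rfl
        exact h' (by simp [hc])
      have ha : a = 0 := by simpa [hc, hd] using hab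
      exact ⟨b / d, by ext i; fin_cases i <;> simp [hc, ha, hd]⟩
    · refine ⟨a / c, ?_⟩
      ext i
      fin_cases i
      · simp [hc]
      · simp only [Fin.mk_one, Pi.smul_apply, Matrix.cons_val_one, smul_eq_mul,
          Matrix.cons_val_fin_one]
        field_simp
        rw [hab, mul_comm]

theorem exists_eq_mk (p : P1 F) : ∃ (a b : F) (h : ![a, b] ≠ 0), p = Projectivization.mk F ![a, b] h := by
  have hp : ![p.rep 0, p.rep 1] = p.rep := by ext i; fin_cases i <;> rfl
  refine ⟨p.rep 0, p.rep 1, hp ▸ p.rep_nonzero, ?_⟩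
  conv_lhs => rw [← p.mk_rep]
  congr 1
  exact hp.symm

theorem zeroPt_ne_inftyPt : zeroPt F ≠ inftyPt F := by
  rw [zeroPt, inftyPt, Ne, mk_eq_mk_iff_mul]
  simp

theorem vec_ne_zero {a b : F} : ![a, b] ≠ 0 ↔ a ≠ 0 ∨ b ≠ 0 := by
  rw [Ne, ← not_and_or, not_iff_not]
  constructor
  · intro h
    exact ⟨congrFun h 0, congrFun h 1⟩
  · rintro ⟨rfl, rfl⟩
    ext i
    fin_cases i <;> rfl

end P1

/-! ### Plücker coordinates over a field -/

section plucker

variable {L : Type*} [Field L] {N : ℕ} {z : ℕ → ℕ → L}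

/-- Symmetric nonzero Plücker coordinates on the `N`-gon whose values at the sides do not vanish. -/
structure IsPolygon (N : ℕ) (z : ℕ → ℕ → L) : Prop where
  plucker : IsPlucker N z
  symm : ∀ a b, z a b = z b a
  self : ∀ a, z a a = 0
  side : ∀ a b, Side N a b → z a b ≠ 0

/-- Stated for bare functions because it serves both in the ambient field and for the values of the
variables under a homomorphism to another field. -/
theorem isPolygon_of_exchRel {m : ℕ} {g : Fin m → L} (hg : ∀ j, g j ≠ 0)
    {w : Fin m → ℕ → ℕ → ℤ} {χ : ℕ → ℕ → L} (hw : ∀ j a b, w j a b = w j b a)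
    (hχ : ∀ a b, χ a b = χ b a) (h0 : ∀ a, χ a a = 0) (h1 : ∀ a b, Side N a b → χ a b = 1)
    (ht : ∀ j, IsTropical N (w j))
    (he : ∀ a b c e, a < N → b < N → c < N → e < N → Cyc a b c e → ExchRel g w χ a b c e) :
    IsPolygon N fun a b => χ a b * mon g (w · a b) where
  plucker a b c e ha hb hc he' hcyc :=
    (exchRel_iff hg χ fun j => ht j a b c e ha hb hc he' hcyc).1 (he a b c e ha hb hc he' hcyc)
  symm a b := by rw [hχ]; simp only [hw _ a b]
  self a := by rw [h0, zero_mul]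
  side a b h := by
    rw [h1 a b h, one_mul]
    exact mon_ne_zero hg _

namespace IsPolygon

theorem base_ne (h : IsPolygon N z) (hN : 2 ≤ N) : z 0 (N - 1) ≠ 0 :=
  h.side _ _ ⟨by omega, by omega, by omega, by omega⟩

/-- The coordinates are determinants. -/
theorem det_eq (h : IsPolygon N z) (hN : 2 ≤ N) {i j : ℕ} (hij : i < j) (hj : j < N) :
    z i (N - 1) * z 0 j - z j (N - 1) * z 0 i = z i j * z 0 (N - 1) := by
  by_cases hi : i = 0
  · subst hi
    rw [h.self 0]
    ring
  by_cases hjN : j = N - 1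
  · subst hjN
    rw [h.self (N - 1)]
    ring
  have := h.plucker 0 i j (N - 1) (by omega) (by omega) hj (by omega) (by unfold Cyc; omega)
  rw [h.symm (N - 1) 0] at this
  linear_combination this

theorem det_eq_zero_iff (h : IsPolygon N z) (hN : 2 ≤ N) {i j : ℕ} (hi : i < N) (hj : j < N) :
    z i (N - 1) * z 0 j = z 0 i * z j (N - 1) ↔ z i j = 0 := by
  have h0 := h.base_ne hN
  rcases lt_trichotomy i j with hij | rfl | hij
  · have := h.det_eq hN hij hj
    rw [mul_comm (z 0 i), ← sub_eq_zero, this, mul_eq_zero, or_iff_left h0]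
  · simp [h.self, mul_comm]
  · have := h.det_eq hN hij hi
    rw [h.symm i j, ← sub_eq_zero, ← neg_eq_zero,
      show -(z i (N - 1) * z 0 j - z 0 i * z j (N - 1)) =
        z j (N - 1) * z 0 i - z i (N - 1) * z 0 j by ring, this, mul_eq_zero, or_iff_left h0]

/-- If the vector of vertex `i` were zero, its determinant with the vector of vertex `i + 1` would
vanish, and with it a side of the polygon. For the last vertex the long side itself would vanish. -/
theorem vec_ne (h : IsPolygon N z) (hN : 2 ≤ N) {i : ℕ} (hi : i < N) :
    z i (N - 1) ≠ 0 ∨ z 0 i ≠ 0 := by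
  by_contra hc
  push Not at hc
  by_cases hiN : i = N - 1
  · exact h.base_ne hN (hiN ▸ hc.2)
  · refine h.side i (i + 1) ⟨hi, by omega, by omega, by omega⟩
      ((h.det_eq_zero_iff hN hi (by omega)).1 ?_)
    rw [hc.1, hc.2, zero_mul, zero_mul]

/-- The labelling of the vertices of the polygon by points of the projective line. -/
theorem exists_labelling (h : IsPolygon (N + 1) z) (hN : 1 ≤ N) :
    ∃ y ∈ X L N, ∀ i j : Fin (N + 1), z i j = 0 ↔ y i = y j := by
  -- Vertex `i` is sent to `[z i N : z 0 i]`; since `z 0 0` and `z N N` are zero, the end vertices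
  -- get the prescribed values.
  have hv : ∀ i : Fin (N + 1), ![z i N, z 0 i] ≠ 0 := fun i =>
    vec_ne_zero.2 (h.vec_ne (by omega) i.2)
  have hy : ∀ i j : Fin (N + 1), z i j = 0 ↔
      Projectivization.mk L _ (hv i) = Projectivization.mk L _ (hv j) := fun i j => by
    rw [mk_eq_mk_iff_mul]
    exact (h.det_eq_zero_iff (by omega) i.2 j.2).symm
  refine ⟨fun i => Projectivization.mk L _ (hv i), ⟨?_, ?_, fun i => ?_⟩, hy⟩
  · show Projectivization.mk L _ _ = Projectivization.mk L _ _
    rw [mk_eq_mk_iff_mul]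
    simp [h.self]
  · show Projectivization.mk L _ _ = Projectivization.mk L _ _
    rw [mk_eq_mk_iff_mul]
    simp [h.self]
  · rw [Ne, ← hy]
    exact h.side _ _ ⟨by simp, by simp, by simp, by simp⟩

/-- A subring that contains the coordinates of the edges of a triangulation and their inverses
contains all coordinates. -/
theorem mem_subring (h : IsPolygon N z) (hN : 2 ≤ N) {R : Set (ℕ × ℕ)} (hR : IsTri N R)
    (O : Subring L) (hO : ∀ a b, Edge N R a b → z a b ∈ O ∧ (z a b)⁻¹ ∈ O ∧ z a b ≠ 0) {a b : ℕ}
    (ha : a < N) (hb : b < N) : z a b ∈ O := by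
  have key : ∀ {x y t : L}, t ≠ 0 → t⁻¹ ∈ O → x * t = y → y ∈ O → x ∈ O := by
    intro x y t ht hi hxy hy
    rw [← mul_inv_cancel_right₀ ht x, hxy]
    exact O.mul_mem hy hi
  have hbase := hO _ _ (edge_base R (by omega : 1 < N))
  -- In a triangle `p, q, r` of the triangulation, the Plücker relations with `0` and with `N - 1`
  -- can be solved for the coordinates of `q` after division by the edge `pr`. All other coordinates
  -- are then determinants divided by the long side.
  have hG : ∀ k, k < N → z 0 k ∈ O ∧ z k (N - 1) ∈ O := by
    intro k hk
    refine hR.propagate (fun k => z 0 k ∈ O ∧ z k (N - 1) ∈ O) ?_ ?_ ?_ hk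
    · exact ⟨h.self 0 ▸ O.zero_mem, hbase.1⟩
    · exact ⟨hbase.1, h.self (N - 1) ▸ O.zero_mem⟩
    · rintro p q r hpq hqr hr epq eqr epr ⟨hp1, hp2⟩ ⟨hr1, hr2⟩
      have i1 := hO _ _ epq
      have i2 := hO _ _ eqr
      have i3 := hO _ _ epr
      constructor
      · by_cases hp : p = 0
        · exact hp ▸ i1.1
        · refine key i3.2.2 i3.2.1 (h.plucker 0 p q r (by omega) (by omega) (by omega) hr
            (by unfold Cyc; omega)) ?_
          rw [h.symm r 0]
          exact O.add_mem (O.mul_mem hp1 i2.1) (O.mul_mem i1.1 hr1)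
      · by_cases hrN : r = N - 1
        · exact hrN ▸ i2.1
        · refine key i3.2.2 i3.2.1 ((mul_comm _ _).trans (h.plucker p q r (N - 1) (by omega)
            (by omega) (by omega) (by omega) (by unfold Cyc; omega))) ?_
          rw [h.symm (N - 1) p]
          exact O.add_mem (O.mul_mem i1.1 hr2) (O.mul_mem i2.1 hp2)
  have hlt : ∀ a b, a < b → b < N → z a b ∈ O := by
    intro a b hab hb
    refine key hbase.2.2 hbase.2.1 (h.det_eq hN hab hb).symm ?_
    exact O.sub_mem (O.mul_mem (hG a (by omega)).2 (hG b hb).1)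
      (O.mul_mem (hG b hb).2 (hG a (by omega)).1)
  rcases lt_trichotomy a b with hab | rfl | hab
  · exact hlt a b hab hb
  · exact h.self a ▸ O.zero_mem
  · exact h.symm b a ▸ hlt b a hab ha

/-- Proportionality of a pair of vectors in the plane is determined by cross ratios. -/
theorem proportional_of_cross {a1 a2 b1 b2 c1 c2 x1 x2 a1' a2' b1' b2' c1' c2' x1' x2' : L}
    (ha : a1 * a2' = a2 * a1') (hb : b1 * b2' = b2 * b1') (hc : c1 * c2' = c2 * c1')
    (ha0 : a1 ≠ 0 ∨ a2 ≠ 0) (hb0 : b1 ≠ 0 ∨ b2 ≠ 0) (hc0 : c1 ≠ 0 ∨ c2 ≠ 0)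
    (ha0' : a1' ≠ 0 ∨ a2' ≠ 0) (hb0' : b1' ≠ 0 ∨ b2' ≠ 0) (hc0' : c1' ≠ 0 ∨ c2' ≠ 0)
    (hab : a1 * b2 - b1 * a2 ≠ 0) (hbc : b1 * c2 - c1 * b2 ≠ 0) (hca : c1 * a2 - a1 * c2 ≠ 0)
    (h : (a1' * x2' - x1' * a2') * (b1' * c2' - c1' * b2') *
        ((x1 * b2 - b1 * x2) * (c1 * a2 - a1 * c2)) =
      (a1 * x2 - x1 * a2) * (b1 * c2 - c1 * b2) *
        ((x1' * b2' - b1' * x2') * (c1' * a2' - a1' * c2'))) :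
    x1 * x2' = x2 * x1' := by
  have par : ∀ {p1 p2 p1' p2' : L}, p1 * p2' = p2 * p1' → (p1 ≠ 0 ∨ p2 ≠ 0) →
      (p1' ≠ 0 ∨ p2' ≠ 0) → ∃ t : L, t ≠ 0 ∧ p1' = t * p1 ∧ p2' = t * p2 := by
    intro p1 p2 p1' p2' h h0 h0'
    by_cases hp : p1 = 0
    · have hp2 : p2 ≠ 0 := h0.resolve_left (not_not.2 hp)
      have hp1' : p1' = 0 := by simpa [hp, hp2] using h.symm
      have hp2' : p2' ≠ 0 := h0'.resolve_left (not_not.2 hp1')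
      exact ⟨p2' / p2, div_ne_zero hp2' hp2, by simp [hp, hp1'], by field_simp⟩
    · have hp1' : p1' ≠ 0 := by
        intro h1
        have : p2' = 0 := by simpa [h1, hp] using h
        rcases h0' with h2 | h2
        · exact h2 h1
        · exact h2 this
      refine ⟨p1' / p1, div_ne_zero hp1' hp, by field_simp, ?_⟩
      field_simp
      linear_combination h
  obtain ⟨s, hs, rfl, rfl⟩ := par ha ha0 ha0'
  obtain ⟨t, ht, rfl, rfl⟩ := par hb hb0 hb0'
  obtain ⟨u, hu, rfl, rfl⟩ := par hc hc0 hc0'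
  -- With `a'`, `b'`, `c'` replaced by multiples of `a`, `b`, `c`, the equality of cross ratios is
  -- this product, by the Plücker relation for `a`, `b`, `x`, `x'`. Every factor other than the
  -- determinant of `x` and `x'` is nonzero.
  have h1 : (s * t * u * (b1 * c2 - c1 * b2) * (c1 * a2 - a1 * c2)) *
      ((a1 * b2 - b1 * a2) * (x1 * x2' - x2 * x1')) = 0 := by
    linear_combination h
  have h2 : s * t * u * (b1 * c2 - c1 * b2) * (c1 * a2 - a1 * c2) ≠ 0 :=
    mul_ne_zero (mul_ne_zero (mul_ne_zero (mul_ne_zero hs ht) hu) hbc) hca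
  have h3 := (mul_eq_zero.1 h1).resolve_left h2
  exact sub_eq_zero.1 ((mul_eq_zero.1 h3).resolve_left hab)

end IsPolygon

end plucker

end

/-! ### Labellings and cross ratios -/

section

namespace IsPolygon

variable {L : Type*} [Field L] {N : ℕ} {z D : ℕ → ℕ → L}

theorem det_eq_sign (h : IsPolygon N z) (hN : 2 ≤ N) {i j : ℕ} (hi : i < N) (hj : j < N) :
    z i (N - 1) * z 0 j - z j (N - 1) * z 0 i =
      (if i < j then 1 else -1) * (z i j * z 0 (N - 1)) := by
  split_ifs with hij
  · rw [h.det_eq hN hij hj, one_mul]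
  · by_cases heq : i = j
    · subst heq
      rw [h.self]
      ring
    · have := h.det_eq hN (i := j) (j := i) (by omega) hi
      rw [h.symm i j]
      linear_combination -this

/-- Two polygons with the same cross ratios at the diagonals of a triangulation have the
same pairs of equal vertices. -/
theorem eq_zero_iff (h : IsPolygon N z) (hD : IsPolygon N D) (hN : 3 ≤ N) {R : Set (ℕ × ℕ)}
    (hR : IsTri N R) (hz0 : ∀ a b, pr a b ∈ R → z a b ≠ 0) (hD0 : ∀ a b, pr a b ∈ R → D a b ≠ 0)
    (hcross : ∀ a b c e, Quad N R a b c e →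
      D a b * D c e * (z b c * z e a) = z a b * z c e * (D b c * D e a))
    {i j : ℕ} (hi : i < N) (hj : j < N) : z i j = 0 ↔ D i j = 0 := by
  have hz : ∀ {a b}, Edge N R a b → z a b ≠ 0 := fun {a b} he =>
    he.elim (h.side a b) (hz0 a b)
  have hD' : ∀ {a b}, Edge N R a b → D a b ≠ 0 := fun {a b} he =>
    he.elim (hD.side a b) (hD0 a b)
  obtain ⟨r, hr0, hrN, h0r, hrm⟩ := hR.exists_inside (by omega) (edge_base R (by omega))
  -- The vectors of the two polygons are proportional at `0` and `N - 1` in any case. Scaling one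
  -- coordinate by `t` makes them proportional also at the apex `r` of the triangle on the long
  -- side; the cross ratios carry this to all vertices.
  set t : L := z r (N - 1) * D 0 r / (z 0 r * D r (N - 1)) with ht
  have ht0 : t ≠ 0 :=
    div_ne_zero (mul_ne_zero (hz hrm) (hD' h0r)) (mul_ne_zero (hz h0r) (hD' hrm))
  have hN2 : 2 ≤ N := by omega
  have hG : ∀ {k}, k < N → z k (N - 1) * D 0 k = z 0 k * (t * D k (N - 1)) := by
    intro k hk
    refine hR.propagate_quad (fun k => z k (N - 1) * D 0 k = z 0 k * (t * D k (N - 1))) hr0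
      (by omega) h0r hrm ?_ ?_ ?_ ?_ hk
    · simp [h.self, hD.self]
    · simp [h.self, hD.self]
    · have h1 := hz h0r
      have h2 := hD' hrm
      simp only [ht]
      field_simp
    · intro a b c e hq hGa hGc hGe
      have la := hR.edge_lt hq.ab
      have lc := hR.edge_lt hq.ce
      have v' : ∀ {k}, k < N → t * D k (N - 1) ≠ 0 ∨ D 0 k ≠ 0 := fun {k} hk =>
        (hD.vec_ne hN2 hk).imp (mul_ne_zero ht0) id
      have dz : ∀ {p q}, p < N → q < N → z p q ≠ 0 →
          z p (N - 1) * z 0 q - z q (N - 1) * z 0 p ≠ 0 := fun hp hq h0 => by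
        rw [h.det_eq_sign hN2 hp hq]
        refine mul_ne_zero ?_ (mul_ne_zero h0 (h.base_ne hN2))
        split_ifs <;> simp
      refine IsPolygon.proportional_of_cross hGa hGc hGe (h.vec_ne hN2 la.1) (h.vec_ne hN2 lc.1)
        (h.vec_ne hN2 lc.2.1) (v' la.1) (v' lc.1) (v' lc.2.1) (dz la.1 lc.1 (hz0 _ _ hq.diag))
        (dz lc.1 lc.2.1 (hz hq.ce)) (dz lc.2.1 la.1 (hz hq.ea)) ?_
      have e' : ∀ {p q}, p < N → q < N → t * D p (N - 1) * D 0 q - t * D q (N - 1) * D 0 p =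
          t * ((if p < q then 1 else -1) * (D p q * D 0 (N - 1))) := fun hp hq => by
        rw [← hD.det_eq_sign hN2 hp hq]
        ring
      rw [e' la.1 la.2.1, e' lc.1 lc.2.1, e' la.2.1 lc.1, e' lc.2.1 la.1,
        h.det_eq_sign hN2 la.1 la.2.1, h.det_eq_sign hN2 lc.1 lc.2.1,
        h.det_eq_sign hN2 la.2.1 lc.1, h.det_eq_sign hN2 lc.2.1 la.1]
      have := hcross a b c e hq
      -- The signs depend only on the order of the vertices and occur equally on both sides, so
      -- their values play no role.
      generalize (if a < b then (1 : L) else -1) = s1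
      generalize (if c < e then (1 : L) else -1) = s2
      generalize (if b < c then (1 : L) else -1) = s3
      generalize (if e < a then (1 : L) else -1) = s4
      linear_combination (t ^ 2 * s1 * s2 * s3 * s4 * D 0 (N - 1) ^ 2 * z 0 (N - 1) ^ 2) * this
  have v : ∀ {k}, k < N → ![z k (N - 1), z 0 k] ≠ 0 := fun hk => vec_ne_zero.2 (h.vec_ne hN2 hk)
  have v' : ∀ {k}, k < N → ![t * D k (N - 1), D 0 k] ≠ 0 := fun hk =>
    vec_ne_zero.2 ((hD.vec_ne hN2 hk).imp (mul_ne_zero ht0) id)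
  have hv : ∀ {k} (hk : k < N),
      Projectivization.mk L _ (v hk) = Projectivization.mk L _ (v' hk) := fun hk => by
    rw [mk_eq_mk_iff_mul]
    exact hG hk
  rw [← h.det_eq_zero_iff hN2 hi hj, ← hD.det_eq_zero_iff hN2 hi hj, ← mk_eq_mk_iff_mul (v hi) (v hj),
    hv hi, hv hj, mk_eq_mk_iff_mul]
  constructor
  · intro h1
    refine mul_left_cancel₀ ht0 ?_
    linear_combination h1
  · intro h1
    linear_combination t * h1

end IsPolygon

/-- Quadrilaterals of a triangulation are determined by their diagonals. -/
theorem Quad.unique {N : ℕ} {R : Set (ℕ × ℕ)} (hR : IsTri N R) {a b c e b' e' : ℕ}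
    (h : Quad N R a b c e) (h' : Quad N R a b' c e') : b = b' ∧ e = e' := by
  have h1 := h.cyc
  have h2 := h'.cyc
  constructor
  · exact hR.third_unique h.bc.symm h.ab h'.bc.symm h'.ab
      ⟨e, by unfold Cyc at *; omega, by unfold Cyc at *; omega⟩
  · exact hR.third_unique h.ea.symm h.ce h'.ea.symm h'.ce
      ⟨b, by unfold Cyc at *; omega, by unfold Cyc at *; omega⟩

/-- The polygon with given vertices in the projective line. -/
theorem exists_isPolygon {F : Type*} [Field F] {N : ℕ} {y : Fin (N + 1) → P1 F} (hN : 1 ≤ N)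
    (hy : y ∈ X F N) :
    ∃ D : ℕ → ℕ → F, IsPolygon (N + 1) D ∧ ∀ i j : Fin (N + 1), D i j = 0 ↔ y i = y j := by
  choose p q hpq hy' using fun i => exists_eq_mk (y i)
  let p' : ℕ → F := fun i => if h : i < N + 1 then p ⟨i, h⟩ else 0
  let q' : ℕ → F := fun i => if h : i < N + 1 then q ⟨i, h⟩ else 0
  let D : ℕ → ℕ → F := fun a b => p' (min a b) * q' (max a b) - p' (max a b) * q' (min a b)
  have hlt : ∀ {a b}, a < b → D a b = p' a * q' b - p' b * q' a := fun h => by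
    simp only [D, min_eq_left h.le, max_eq_right h.le]
  have hs : ∀ a b, D a b = D b a := fun a b => by simp only [D, min_comm, max_comm]
  have hself : ∀ a, D a a = 0 := fun a => by simp [D, mul_comm]
  have h0 : ∀ i j : Fin (N + 1), D i j = 0 ↔ y i = y j := by
    intro i j
    have hle : ∀ i j : Fin (N + 1), i.val < j.val → (D i j = 0 ↔ y i = y j) := by
      intro i j hij
      rw [hlt hij, hy' i, hy' j, mk_eq_mk_iff_mul, sub_eq_zero]
      simp only [p', q', dif_pos i.2, dif_pos j.2, Fin.eta]
      rw [mul_comm (p j)]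
    rcases lt_trichotomy i.val j.val with hij | hij | hij
    · exact hle i j hij
    · obtain rfl := Fin.ext hij
      simp [hself]
    · rw [hs, hle j i hij, eq_comm]
  refine ⟨D, ⟨isPlucker_of_lt hs ?_, hs, hself, ?_⟩, h0⟩
  · intro a b c e hab hbc hce _
    rw [hs e a, hlt (hab.trans hbc), hlt (hbc.trans hce), hlt hab, hlt hce, hlt hbc,
      hlt (hab.trans (hbc.trans hce))]
    ring
  · intro a b hab
    wlog h : a < b generalizing a b
    · rw [hs]
      exact this b a hab.symm (by unfold Side at hab; omega)
    have h1 := (h0 ⟨a, hab.1⟩ ⟨b, hab.2.1⟩).not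
    simp only at h1
    rw [Ne, h1]
    obtain ⟨ha, hb, -, h2 | h2 | h2 | h2⟩ := hab
    · subst h2
      exact hy.2.2 ⟨a, by omega⟩
    · omega
    · obtain ⟨rfl, h3⟩ := h2
      have e1 : (⟨0, ha⟩ : Fin (N + 1)) = 0 := rfl
      have e2 : (⟨b, hb⟩ : Fin (N + 1)) = Fin.last N := Fin.ext (by simp; omega)
      rw [e1, e2, hy.1, hy.2.1]
      exact zeroPt_ne_inftyPt
    · omega

/-- Values of algebraically independent elements extend to a subalgebra that contains the inverses
of all its elements with nonzero value. -/
theorem exists_specialization {ι K F : Type*} [Field K] [Field F] {x : ι → K}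
    (hx : AlgebraicIndependent ℤ x) (ρ : ι → F) :
    ∃ (O : Subring K) (ψ : O →+* F), (∀ u, ∃ h : x u ∈ O, ψ ⟨x u, h⟩ = ρ u) ∧
      ∀ z : O, ψ z ≠ 0 → (z : K)⁻¹ ∈ O := by
  let f : MvPolynomial ι ℤ →+* K := (MvPolynomial.aeval x).toRingHom
  let g : MvPolynomial ι ℤ →+* F := (MvPolynomial.aeval ρ).toRingHom
  have hf : Function.Injective f := algebraicIndependent_iff_injective_aeval.1 hx
  -- The polynomial ring is localized at the polynomials with nonzero value at `ρ`. By algebraic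
  -- independence the localization embeds into `K`, and its image is the required subring.
  let M : Submonoid (MvPolynomial ι ℤ) :=
    { carrier := {p | g p ≠ 0}
      one_mem' := by simp
      mul_mem' := fun {p q} hp hq => by
        show g (p * q) ≠ 0
        rw [map_mul]
        exact mul_ne_zero hp hq }
  have hM : ∀ s : M, IsUnit (g s) := fun s => isUnit_iff_ne_zero.2 s.2
  have hMf : ∀ s : M, IsUnit (f s) := fun s => isUnit_iff_ne_zero.2 fun h0 => by
    have : (s : MvPolynomial ι ℤ) = 0 := hf (h0.trans (map_zero f).symm)
    exact s.2 (by rw [this, map_zero])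
  let f' : Localization M →+* K := IsLocalization.lift hMf
  let g' : Localization M →+* F := IsLocalization.lift hM
  have hf' : Function.Injective f' := by
    refine (IsLocalization.lift_injective_iff hMf).2 fun a b => ⟨fun h => ?_, fun h => ?_⟩
    · have := congrArg f' h
      simpa only [f', IsLocalization.lift_eq] using this
    · rw [hf h]
  let e := RingEquiv.ofLeftInverse (Function.leftInverse_invFun hf')
  refine ⟨f'.range, g'.comp e.symm.toRingHom, fun u => ?_, ?_⟩
  · have h1 : f' (algebraMap _ (Localization M) (MvPolynomial.X u : MvPolynomial ι ℤ)) = x u := by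
      simp [f', IsLocalization.lift_eq, f]
    refine ⟨⟨_, h1⟩, ?_⟩
    have h2 : e.symm ⟨x u, ⟨_, h1⟩⟩ = algebraMap _ (Localization M) (MvPolynomial.X u : MvPolynomial ι ℤ) := by
      rw [RingEquiv.symm_apply_eq]
      exact Subtype.ext h1.symm
    show g' (e.symm _) = _
    rw [h2]
    simp [g', IsLocalization.lift_eq, g]
  · intro z hz
    obtain ⟨w, rfl⟩ := e.surjective z
    have hz' : g' w ≠ 0 := by simpa using hz
    obtain ⟨a, s, rfl⟩ := IsLocalization.exists_mk'_eq M w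
    have ha : a ∈ M := by
      intro h0
      have h1 := congrArg g' (IsLocalization.mk'_spec (Localization M) a s)
      rw [map_mul, IsLocalization.lift_eq hM, IsLocalization.lift_eq hM, h0] at h1
      exact hz' ((mul_eq_zero.1 h1).resolve_right s.2)
    refine ⟨IsLocalization.mk' _ (s : MvPolynomial ι ℤ) (⟨a, ha⟩ : M), ?_⟩
    show _ = (f' _)⁻¹
    refine eq_inv_of_mul_eq_one_right ?_
    rw [← map_mul, IsLocalization.mk'_mul_mk'_eq_one', map_one]

end

/-! ### The cluster algebra -/

section

variable {n m : ℕ} {K : Type*} [Field K]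

/-- The diagonals from a vertex `v` form a triangulation. -/
theorem exists_isTri_mem {N p q : ℕ} (hpq : p + 1 < q) (hq : q < N) (hd : ¬(p = 0 ∧ q + 1 = N)) :
    ∃ R, IsTri N R ∧ (p, q) ∈ R := by
  let R : Set (ℕ × ℕ) := {x | (x.1 = p ∨ x.2 = p) ∧ x.1 + 1 < x.2 ∧ x.2 < N ∧
    ¬(x.1 = 0 ∧ x.2 + 1 = N)}
  have hmem : ∀ a b, (a, b) ∈ R ↔ (a = p ∨ b = p) ∧ a + 1 < b ∧ b < N ∧ ¬(a = 0 ∧ b + 1 = N) :=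
    fun a b => Iff.rfl
  refine ⟨R, IsTri.of_inside (by omega) (fun a b h => ((hmem a b).1 h).2) ?_ ?_,
    (hmem p q).2 ⟨Or.inl rfl, hpq, hq, hd⟩⟩
  · intro a b c e h h'
    rw [hmem] at h h'
    omega
  · intro a c hac h
    rw [edge_iff (by omega), hmem] at h
    by_cases ha : a = p
    · refine ⟨c - 1, by omega, by omega, ?_, ?_⟩ <;> rw [edge_iff (by omega), hmem] <;> omega
    by_cases hc : c = p
    · refine ⟨a + 1, by omega, by omega, ?_, ?_⟩ <;> rw [edge_iff (by omega), hmem] <;> omega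
    · refine ⟨p, by omega, by omega, ?_, ?_⟩ <;> rw [edge_iff (by omega), hmem] <;> omega

/-- The set of pairs of natural numbers that corresponds to a set of pairs of vertices. -/
def natSet {N : ℕ} (T : Set (Fin N × Fin N)) : Set (ℕ × ℕ) :=
  (fun d => (d.1.val, d.2.val)) '' T

theorem mem_natSet {N : ℕ} {T : Set (Fin N × Fin N)} (i j : Fin N) :
    (i.val, j.val) ∈ natSet T ↔ (i, j) ∈ T := by
  constructor
  · rintro ⟨⟨i', j'⟩, h, h'⟩
    rw [Prod.mk.injEq] at h'
    rwa [← Fin.ext h'.1, ← Fin.ext h'.2]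
  · intro h
    exact ⟨_, h, rfl⟩

theorem exists_of_mem_natSet {N : ℕ} {T : Set (Fin N × Fin N)} {p q : ℕ} (h : (p, q) ∈ natSet T) :
    ∃ (hp : p < N) (hq : q < N), (⟨p, hp⟩, ⟨q, hq⟩) ∈ T := by
  obtain ⟨⟨i, j⟩, h, h'⟩ := h
  rw [Prod.mk.injEq] at h'
  obtain ⟨rfl, rfl⟩ := h'
  exact ⟨i.2, j.2, h⟩

theorem isTri_natSet_iff {N : ℕ} {T : Set (Fin N × Fin N)} :
    IsTri N (natSet T) ↔ IsTriangulation T := by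
  constructor
  · intro h
    refine ⟨fun d hd => ?_, fun d hd e he hc => ?_, fun d hd hc => ?_⟩
    · have := h.diag d.1 d.2 ((mem_natSet _ _).2 hd)
      exact ⟨this.1, this.2.2⟩
    · rcases hc with hc | hc
      · exact h.nc d.1 d.2 e.1 e.2 ((mem_natSet _ _).2 hd) ((mem_natSet _ _).2 he) hc
      · exact h.nc e.1 e.2 d.1 d.2 ((mem_natSet _ _).2 he) ((mem_natSet _ _).2 hd) hc
    · refine (mem_natSet _ _).1 (h.maximal d.1 d.2 hd.1 d.2.2 hd.2 fun r s hrs => ?_)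
      obtain ⟨hr, hs, hrs⟩ := exists_of_mem_natSet hrs
      have := hc _ hrs
      exact ⟨fun h => this (Or.inl h), fun h => this (Or.inr h)⟩
  · intro h
    refine ⟨fun p q hpq => ?_, fun p q r s hpq hrs hc => ?_, fun p q h1 h2 h3 h4 => ?_⟩
    · obtain ⟨hp, hq, hpq⟩ := exists_of_mem_natSet hpq
      exact ⟨(h.1 _ hpq).1, hq, (h.1 _ hpq).2⟩
    · obtain ⟨hp, hq, hpq⟩ := exists_of_mem_natSet hpq
      obtain ⟨hr, hs, hrs⟩ := exists_of_mem_natSet hrs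
      exact h.2.1 _ hpq _ hrs (Or.inl hc)
    · refine (mem_natSet (N := N) ⟨p, by omega⟩ ⟨q, h2⟩).2 (h.2.2 _ ⟨h1, h3⟩ fun e he hc => ?_)
      have := h4 e.1 e.2 ((mem_natSet _ _).2 he)
      exact hc.elim this.1 this.2

theorem exists_natSet_eq {N : ℕ} {R : Set (ℕ × ℕ)} (h : IsTri N R) :
    ∃ T : Set (Fin N × Fin N), natSet T = R := by
  refine ⟨{d | (d.1.val, d.2.val) ∈ R}, ?_⟩
  ext ⟨p, q⟩
  constructor
  · rintro ⟨d, hd, hd'⟩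
    exact hd' ▸ hd
  · intro hpq
    have := h.diag p q hpq
    exact ⟨(⟨p, by omega⟩, ⟨q, this.2.1⟩), hpq, rfl⟩

namespace Coordinates

/-- The cluster variable of a diagonal. -/
def var (P : Coordinates n m K) (d : Fin (n + 3) × Fin (n + 3)) : K := P.χ d.1 d.2

/-- The rescaled variables satisfy the Plücker relations. -/
theorem isPolygon (P : Coordinates n m K) :
    IsPolygon (n + 3) fun a b => P.χ a b * mon P.g (P.w · a b) :=
  isPolygon_of_exchRel P.g_ne P.w_symm P.χ_symm P.χ_self P.χ_side P.trop P.exch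

namespace IsModel

variable {P : Coordinates n m K} {S : LabeledSeed n m K}

theorem g_mem (h : P.IsModel S) (j : Fin m) :
    P.g j ∈ S.clusterAlgebra ∧ (P.g j)⁻¹ ∈ S.clusterAlgebra := by
  rw [h.g_eq]
  exact ⟨Algebra.subset_adjoin (Or.inl ⟨S, Relation.ReflTransGen.refl, _, rfl⟩),
    Algebra.subset_adjoin (Or.inr ⟨j, rfl⟩)⟩

theorem χ_mem (h : P.IsModel S) {a b : ℕ} (ha : a < n + 3) (hb : b < n + 3) :
    P.χ a b ∈ S.clusterAlgebra := by
  wlog hab : a < b generalizing a b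
  · rcases (not_lt.1 hab).lt_or_eq with h1 | h1
    · rw [P.χ_symm]
      exact this hb ha h1
    · rw [h1, P.χ_self]
      exact Subalgebra.zero_mem _
  by_cases hs : Side (n + 3) a b
  · rw [P.χ_side a b hs]
    exact Subalgebra.one_mem _
  · unfold Side at hs
    obtain ⟨R, hR, hmem⟩ := exists_isTri_mem (N := n + 3) (p := a) (q := b) (by omega) hb (by omega)
    obtain ⟨S', d, h1, h2, rfl⟩ := h.exists_seed R hR
    obtain ⟨i, hi⟩ := hmem
    refine Algebra.subset_adjoin (Or.inl ⟨S', h1, Sum.inl i, ?_⟩)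
    rw [h2.x_inl, hi]

theorem clusterAlgebra_le (h : P.IsModel S) (O : Subring K) (hg : ∀ j, P.g j ∈ O ∧ (P.g j)⁻¹ ∈ O)
    (hχ : ∀ a b, a < n + 3 → b < n + 3 → P.χ a b ∈ O) {z : K} (hz : z ∈ S.clusterAlgebra) :
    z ∈ O := by
  let O' : Subalgebra ℤ K := subalgebraOfSubring O
  suffices H : S.clusterAlgebra ≤ O' from H hz
  refine Algebra.adjoin_le ?_
  rintro _ (⟨S', hS', u, rfl⟩ | ⟨j, rfl⟩)
  · show _ ∈ O
    obtain ⟨d, hd⟩ := h.realizes S' hS'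
    rcases u with i | j
    · rw [hd.x_inl]
      have := hd.tri.diag (d i).1 (d i).2 ⟨i, rfl⟩
      exact hχ _ _ (by omega) this.2.1
    · rw [hd.x_inr]
      exact (hg j).1
  · show _ ∈ O
    rw [← h.g_eq]
    exact (hg j).2

/-- The polygon defined by a ring homomorphism from the cluster algebra to a field. -/
theorem isPolygon_map (h : P.IsModel S) {F : Type*} [Field F] (ψ : S.clusterAlgebra →+* F) :
    ∃ (g : Fin m → F) (χ : ℕ → ℕ → F), (∀ j, g j = ψ ⟨P.g j, (h.g_mem j).1⟩) ∧ (∀ j, g j ≠ 0) ∧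
      (∀ a b (ha : a < n + 3) (hb : b < n + 3), χ a b = ψ ⟨P.χ a b, h.χ_mem ha hb⟩) ∧
      IsPolygon (n + 3) fun a b => χ a b * mon g (P.w · a b) := by
  let g : Fin m → F := fun j => ψ ⟨P.g j, (h.g_mem j).1⟩
  let χ : ℕ → ℕ → F := fun a b => if hab : a < n + 3 ∧ b < n + 3 then
    ψ ⟨P.χ a b, h.χ_mem hab.1 hab.2⟩ else 0
  have hχ : ∀ a b (ha : a < n + 3) (hb : b < n + 3), χ a b = ψ ⟨P.χ a b, h.χ_mem ha hb⟩ :=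
    fun a b ha hb => dif_pos ⟨ha, hb⟩
  have hg : ∀ j, g j ≠ 0 := by
    intro j h0
    have h1 : (⟨P.g j, (h.g_mem j).1⟩ * ⟨(P.g j)⁻¹, (h.g_mem j).2⟩ : S.clusterAlgebra) = 1 :=
      Subtype.ext (mul_inv_cancel₀ (P.g_ne j))
    have h2 := congrArg ψ h1
    rw [map_mul, map_one, show ψ ⟨P.g j, (h.g_mem j).1⟩ = 0 from h0, zero_mul] at h2
    exact zero_ne_one h2
  refine ⟨g, χ, fun _ => rfl, hg, hχ, isPolygon_of_exchRel hg P.w_symm ?_ ?_ ?_ P.trop ?_⟩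
  · intro a b
    simp only [χ, P.χ_symm a b, and_comm]
  · intro a
    simp only [χ]
    split_ifs with ha
    · have : (⟨P.χ a a, h.χ_mem ha.1 ha.2⟩ : S.clusterAlgebra) = 0 := Subtype.ext (P.χ_self a)
      rw [this, map_zero]
    · rfl
  · intro a b hab
    rw [hχ a b hab.1 hab.2.1]
    have : (⟨P.χ a b, h.χ_mem hab.1 hab.2.1⟩ : S.clusterAlgebra) = 1 :=
      Subtype.ext (P.χ_side a b hab)
    rw [this, map_one]
  · intro a b c e ha hb hc he hcyc
    unfold ExchRel
    rw [hχ a c ha hc, hχ b e hb he, hχ a b ha hb, hχ c e hc he, hχ b c hb hc, hχ e a he ha]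
    simp only [g]
    simp only [← map_mul, ← map_pow, ← map_prod, ← map_add]
    congr 1
    refine Subtype.ext ?_
    push_cast
    exact P.exch a b c e ha hb hc he hcyc

end IsModel

end Coordinates

end

/-! ### Points of the cluster variety -/

section

variable {n m : ℕ} {K : Type*} [Field K]

theorem mon_mem {m : ℕ} {g : Fin m → K} (O : Subring K) (hg : ∀ j, g j ∈ O ∧ (g j)⁻¹ ∈ O)
    (v : Fin m → ℤ) : mon g v ∈ O := by
  refine Subring.prod_mem _ fun j _ => ?_
  rcases Int.eq_nat_or_neg (v j) with ⟨k, hk | hk⟩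
  · rw [hk, zpow_natCast]
    exact O.pow_mem (hg j).1 k
  · rw [hk, zpow_neg, zpow_natCast, ← inv_pow]
    exact O.pow_mem (hg j).2 k

namespace Coordinates.IsModel

variable {P : Coordinates n m K} {S : LabeledSeed n m K}

/-- Each assignment of nonzero values to the variables of a seed extends to the cluster algebra. -/
theorem exists_hom (h : P.IsModel S) {S' : LabeledSeed n m K} {d : Fin n → ℕ × ℕ}
    (hS' : S.MutationEquiv S') (hd : P.Realizes S' d) {F : Type*} [Field F]
    (ρ : Fin n ⊕ Fin m → F) (hρ : ∀ u, ρ u ≠ 0) :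
    ∃ ψ : S.clusterAlgebra →+* F, (∀ j, ψ ⟨P.g j, (h.g_mem j).1⟩ = ρ (Sum.inr j)) ∧
      ∀ i (hi : P.χ (d i).1 (d i).2 ∈ S.clusterAlgebra), ψ ⟨_, hi⟩ = ρ (Sum.inl i) := by
  have hindep := hS'.algebraicIndependent h.indep
  obtain ⟨O, ψ, hψ, hO⟩ := exists_specialization hindep ρ
  have hx : ∀ u, S'.x u ∈ O ∧ (S'.x u)⁻¹ ∈ O := by
    intro u
    obtain ⟨h1, h2⟩ := hψ u
    exact ⟨h1, hO ⟨_, h1⟩ (h2 ▸ hρ u)⟩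
  have hg : ∀ j, P.g j ∈ O ∧ (P.g j)⁻¹ ∈ O := fun j => by
    rw [← hd.x_inr]
    exact hx _
  have hmon := mon_mem O hg
  -- The Laurent phenomenon in the form needed: a subring with the extended cluster and its inverses
  -- contains all rescaled variables, hence the whole cluster algebra.
  have hZ : ∀ a b, a < n + 3 → b < n + 3 → P.χ a b * mon P.g (P.w · a b) ∈ O := by
    intro a b ha hb
    refine P.isPolygon.mem_subring (by omega) hd.tri O (fun a b hab => ?_) ha hb
    have h1 : P.χ a b ∈ O ∧ (P.χ a b)⁻¹ ∈ O ∧ P.χ a b ≠ 0 := by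
      rcases hab with hs | ⟨i, hi⟩
      · rw [P.χ_side a b hs]
        simp [O.one_mem]
      · have h2 := hx (Sum.inl i)
        have h3 := hindep.ne_zero (Sum.inl i)
        rw [hd.x_inl, hi, P.χ_pr] at h2 h3
        exact ⟨h2.1, h2.2, h3⟩
    refine ⟨O.mul_mem h1.1 (hmon _), ?_, mul_ne_zero h1.2.2 (mon_ne_zero P.g_ne _)⟩
    rw [mul_inv, ← eq_inv_of_mul_eq_one_left (mon_neg P.g_ne (P.w · a b))]
    exact O.mul_mem h1.2.1 (hmon _)
  have hχ : ∀ a b, a < n + 3 → b < n + 3 → P.χ a b ∈ O := by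
    intro a b ha hb
    have h1 := O.mul_mem (hZ a b ha hb) (hmon fun j => -P.w j a b)
    rwa [mul_assoc, mul_comm (mon _ _), mon_neg P.g_ne, mul_one] at h1
  let ι : S.clusterAlgebra →+* O :=
    { toFun := fun z => ⟨z, h.clusterAlgebra_le O hg hχ z.2⟩
      map_one' := rfl
      map_mul' := fun _ _ => rfl
      map_zero' := rfl
      map_add' := fun _ _ => rfl }
  have hval : ∀ u (z : S.clusterAlgebra), (z : K) = S'.x u → ψ (ι z) = ρ u := by
    intro u z hz
    obtain ⟨h1, h2⟩ := hψ u
    rw [← h2]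
    exact congrArg ψ (Subtype.ext hz)
  exact ⟨ψ.comp ι, fun j => hval _ _ (hd.x_inr j).symm, fun i hi => hval _ _ (hd.x_inl i).symm⟩

theorem zpow_sum_of_ne_zero {F ι : Type*} [Field F] [Fintype ι] {a : F} (ha : a ≠ 0)
    (f : ι → ℤ) : a ^ (∑ i, f i) = ∏ i, a ^ f i := by
  have key : ∀ s : Finset ι, a ^ (∑ i ∈ s, f i) = ∏ i ∈ s, a ^ f i := by
    classical
    intro s
    induction s using Finset.induction_on with
    | empty => simp
    | insert i s hi ih => rw [Finset.sum_insert hi, Finset.prod_insert hi, zpow_add₀ ha, ih]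
  exact key _

/-- Points of the cluster variety over a labelling with a properly coloured triangulation. -/
theorem exists_point (h : P.IsModel S) (hrank : S.Q.ReallyFullRank) {F : Type*} [Field F]
    {y : Fin (n + 2 + 1) → P1 F} (hy : y ∈ X F (n + 2)) {R : Set (ℕ × ℕ)} (hR : IsTri (n + 3) R)
    (hyR : ∀ i j : Fin (n + 3), (i.val, j.val) ∈ R → y i ≠ y j) :
    ∃ ψ : S.clusterAlgebra →+* F, ∀ i j : Fin (n + 3),
      ψ ⟨P.χ i j, h.χ_mem i.2 j.2⟩ = 0 ↔ y i = y j := by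
  obtain ⟨D, hD, hDy⟩ := exists_isPolygon (by omega) hy
  obtain ⟨S', d, hS', hd, rfl⟩ := h.exists_seed R hR
  obtain ⟨r, hr⟩ := (hS'.reallyFullRank hrank).exists_inverse
  have hD0 : ∀ a b, pr a b ∈ Set.range d → D a b ≠ 0 := by
    intro a b hab
    wlog hlt : a < b generalizing a b
    · rw [hD.symm]
      have hN := hR.edge_lt (Or.inr hab)
      exact this b a (pr_comm a b ▸ hab) (by omega)
    have hN := hR.edge_lt (Or.inr hab)
    have h1 := hDy ⟨a, hN.1⟩ ⟨b, hN.2.1⟩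
    simp only at h1
    rw [Ne, h1]
    rw [pr_of_lt hlt] at hab
    exact hyR _ _ hab
  have hDe : ∀ {a b}, Edge (n + 3) (Set.range d) a b → D a b ≠ 0 := fun {a b} hab =>
    hab.elim (hD.side a b) (hD0 a b)
  have hex : ∀ v : Fin n, ∃ b e, Quad (n + 3) (Set.range d) (d v).1 b (d v).2 e := fun v => by
    obtain ⟨b, e, -, -, hq⟩ := hR.exists_quad (p := (d v).1) (q := (d v).2) ⟨v, rfl⟩
    exact ⟨b, e, hq⟩
  choose b e hquad using hex
  -- The point is built from the cross ratios `η v` of the given polygon at the diagonals of the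
  -- triangulation. These are nonzero because the coloring is proper.
  let cr : ℕ → ℕ → ℕ → ℕ → F := fun a b c e => D a b * D c e / (D b c * D e a)
  let η : Fin n → F := fun v => cr (d v).1 (b v) (d v).2 (e v)
  have hη0 : ∀ v, η v ≠ 0 := fun v =>
    div_ne_zero (mul_ne_zero (hDe (hquad v).ab) (hDe (hquad v).ce))
      (mul_ne_zero (hDe (hquad v).bc) (hDe (hquad v).ea))
  have hη : ∀ v p q s t, Quad (n + 3) (Set.range d) p q s t → d v = pr p s →
      η v = cr p q s t := by
    intro v p q s t hq hv
    have hlt := hR.diag (d v).1 (d v).2 ⟨v, rfl⟩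
    have h1 : pr (d v).1 (d v).2 = pr p s := by rw [← hv, pr_of_lt (by omega)]
    have hqv := hquad v
    simp only [η]
    rw [pr_eq_iff] at h1
    rcases h1 with ⟨h1, h2⟩ | ⟨h1, h2⟩
    · rw [h1, h2] at hqv ⊢
      obtain ⟨h3, h4⟩ := hqv.unique hR hq
      rw [h3, h4]
    · rw [h1, h2] at hqv ⊢
      obtain ⟨h3, h4⟩ := hqv.unique hR hq.rot
      rw [h3, h4]
      simp only [cr]
      rw [mul_comm (D s t), mul_comm (D t p)]
  -- Here really full rank enters: `r` is an integral left inverse of the exchange matrix, so these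
  -- monomials solve the system that prescribes the value `η v` for the product of `ρ u ^ b u v`
  -- over all `u`.
  let ρ : Fin n ⊕ Fin m → F := fun u => ∏ v, η v ^ r v u
  have hρ0 : ∀ u, ρ u ≠ 0 := fun u => Finset.prod_ne_zero_iff.2 fun v _ => zpow_ne_zero _ (hη0 v)
  have hρ : ∀ v, ∏ u, ρ u ^ S'.Q.b u (Sum.inl v) = η v := by
    intro v
    simp only [ρ, ← Finset.prod_zpow]
    rw [Finset.prod_comm]
    simp only [← zpow_mul]
    have : ∀ v', ∏ u, η v' ^ (r v' u * S'.Q.b u (Sum.inl v)) = if v' = v then η v' else 1 := by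
      intro v'
      rw [← zpow_sum_of_ne_zero (hη0 v'), hr]
      split_ifs <;> simp
    simp only [this]
    simp
  obtain ⟨ψ, hψg, hψd⟩ := h.exists_hom hS' hd ρ hρ0
  obtain ⟨g, χ, hg, hg0, hχ, hz⟩ := h.isPolygon_map ψ
  refine ⟨ψ, fun i j => ?_⟩
  have hχd : ∀ i, χ (d i).1 (d i).2 = ρ (Sum.inl i) := by
    intro i
    have := hR.diag (d i).1 (d i).2 ⟨i, rfl⟩
    rw [hχ _ _ (by omega) this.2.1]
    exact hψd i _
  have hχs : ∀ a b, a < n + 3 → b < n + 3 → χ a b = χ b a := by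
    intro a b ha hb
    rw [hχ a b ha hb, hχ b a hb ha]
    congr 1
    exact Subtype.ext (P.χ_symm a b)
  have hχpr : ∀ a b, a < n + 3 → b < n + 3 → χ (pr a b).1 (pr a b).2 = χ a b := by
    intro a b ha hb
    rcases le_total a b with hab | hab
    · simp [pr, hab]
    · rw [hχs a b ha hb]
      simp [pr, hab]
  have hprod : ∀ {a b}, Edge (n + 3) (Set.range d) a b →
      ∏ u, ρ u ^ P.weight d u a b = χ a b * mon g (P.w · a b) := by
    intro a b hab
    have hlt := hR.edge_lt hab
    rw [Fintype.prod_sum_type]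
    congr 1
    · simp only [weight]
      by_cases hi : ∃ i, d i = pr a b
      · obtain ⟨i, hi⟩ := hi
        rw [Finset.prod_eq_single i]
        · rw [if_pos hi, zpow_one, ← hχd, hi, hχpr _ _ hlt.1 hlt.2.1]
        · intro j _ hj
          rw [if_neg (fun h' => hj (hd.inj (h'.trans hi.symm))), zpow_zero]
        · simp
      · rw [hχ a b hlt.1 hlt.2.1]
        have h1 : (⟨P.χ a b, h.χ_mem hlt.1 hlt.2.1⟩ : S.clusterAlgebra) = 1 :=
          Subtype.ext (P.χ_side a b (hab.resolve_right hi))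
        rw [h1, map_one]
        refine Finset.prod_eq_one fun i _ => ?_
        rw [if_neg (fun h => hi ⟨i, h⟩), zpow_zero]
    · refine Finset.prod_congr rfl fun j _ => ?_
      rw [hg, hψg]
      rfl
  have hz0 : ∀ {a b}, Edge (n + 3) (Set.range d) a b → χ a b * mon g (P.w · a b) ≠ 0 := by
    intro a b hab
    rw [← hprod hab]
    exact Finset.prod_ne_zero_iff.2 fun u _ => zpow_ne_zero _ (hρ0 u)
  have hmain := hz.eq_zero_iff hD (by omega) hR (fun a b hab => hz0 (Or.inr hab)) hD0 ?_ i.2 j.2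
  · rw [← hDy, ← hmain, hχ i j i.2 j.2, mul_eq_zero, or_iff_left (mon_ne_zero hg0 _)]
  -- By `b_eq` the monomial of column `v` is the cross ratio of the polygon of `ψ`; by the choice of
  -- `ρ` it equals that of `D`.
  · intro p q s t hq
    obtain ⟨v, hv⟩ := hq.diag
    have h1 := hρ v
    rw [hη v p q s t hq hv] at h1
    have h2 : ∏ u, ρ u ^ S'.Q.b u (Sum.inl v) =
        (χ p q * mon g (P.w · p q)) * (χ s t * mon g (P.w · s t)) /
          ((χ q s * mon g (P.w · q s)) * (χ t p * mon g (P.w · t p))) := by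
      rw [← hprod hq.ab, ← hprod hq.bc, ← hprod hq.ce, ← hprod hq.ea,
        ← Finset.prod_mul_distrib, ← Finset.prod_mul_distrib, ← Finset.prod_div_distrib]
      refine Finset.prod_congr rfl fun u _ => ?_
      rw [hd.b_eq v p q s t hq hv, sub_sub, zpow_sub₀ (hρ0 u), zpow_add₀ (hρ0 u),
        zpow_add₀ (hρ0 u)]
    rw [h2, div_eq_div_iff (mul_ne_zero (hz0 hq.bc) (hz0 hq.ea))
      (mul_ne_zero (hDe hq.bc) (hDe hq.ea))] at h1
    exact h1.symm

end Coordinates.IsModel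

end

/-! ### The bijection between seeds and triangulations -/

section

variable {n m : ℕ} {K : Type*} [Field K]

/-- The point `[1 : k]` of the rational projective line. -/
def ratPt (k : ℕ) : P1 ℚ :=
  Projectivization.mk ℚ ![1, (k : ℚ)] (vec_ne_zero.2 (Or.inl one_ne_zero))

theorem ratPt_injective : Function.Injective ratPt := by
  intro k l h
  rw [ratPt, ratPt, mk_eq_mk_iff_mul] at h
  simpa using h.symm

theorem ratPt_zero : ratPt 0 = zeroPt ℚ := by
  rw [ratPt, zeroPt, mk_eq_mk_iff_mul]
  simp

theorem ratPt_ne_inftyPt (k : ℕ) : ratPt k ≠ inftyPt ℚ := by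
  rw [ratPt, inftyPt, Ne, mk_eq_mk_iff_mul]
  simp

/-- A labelling that takes the same value at the ends of one diagonal, and nowhere else. -/
theorem exists_labelling_collapsing {N i j : ℕ} (hij : i + 1 < j) (hj : j < N + 1)
    (hd : ¬(i = 0 ∧ j = N)) :
    ∃ y ∈ X ℚ N, ∀ a b : Fin (N + 1),
      y a = y b ↔ a.val = b.val ∨ (a.val = i ∧ b.val = j) ∨ (a.val = j ∧ b.val = i) := by
  classical
  -- The vertices `i` and `j` get a common label. If `j` is the last vertex, this has to be the
  -- label of `j`, which must remain `∞`; otherwise it is that of `i`, which may be the vertex `0`.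
  let c : ℕ → ℕ := fun t => if j = N then (if t = i then N else t) else if t = j then i else t
  let p : ℕ → P1 ℚ := fun t => if t = N then inftyPt ℚ else ratPt t
  have hp : Function.Injective p := by
    intro a b hab
    simp only [p] at hab
    split_ifs at hab with h1 h2 h2
    · omega
    · exact absurd hab.symm (ratPt_ne_inftyPt b)
    · exact absurd hab (ratPt_ne_inftyPt a)
    · exact ratPt_injective hab
  have hy : ∀ a b : Fin (N + 1), p (c a) = p (c b) ↔
      a.val = b.val ∨ (a.val = i ∧ b.val = j) ∨ (a.val = j ∧ b.val = i) := by
    intro a b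
    rw [hp.eq_iff]
    simp only [c]
    split_ifs <;> omega
  refine ⟨fun t => p (c t), ⟨?_, ?_, ?_⟩, hy⟩
  · have h0 : c 0 = 0 := by simp only [c]; split_ifs <;> omega
    have hN : (0 : ℕ) ≠ N := by omega
    show p (c 0) = _
    rw [h0]
    simp only [p]
    rw [if_neg hN, ratPt_zero]
  · have h0 : c N = N := by simp only [c]; split_ifs <;> omega
    show p (c N) = _
    rw [h0]
    simp [p]
  · intro t
    show p (c t) ≠ p (c (t + 1))
    rw [hp.ne_iff]
    simp only [c]
    have := t.2
    split_ifs <;> omega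

/-- Every diagonal is missing in some triangulation. -/
theorem exists_isTri_notMem {N i j : ℕ} (hij : i + 1 < j) (hj : j < N) (hd : ¬(i = 0 ∧ j + 1 = N)) :
    ∃ R, IsTri N R ∧ (i, j) ∉ R := by
  by_cases hjN : j + 1 = N
  · obtain ⟨R, hR, hmem⟩ := exists_isTri_mem (N := N) (p := 0) (q := i + 1) (by omega) (by omega)
      (by omega)
    exact ⟨R, hR, fun h => hR.nc _ _ _ _ hmem h (by omega)⟩
  · obtain ⟨R, hR, hmem⟩ := exists_isTri_mem (N := N) (p := i + 1) (q := j + 1) (by omega)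
      (by omega) (by omega)
    exact ⟨R, hR, fun h => hR.nc _ _ _ _ h hmem (by omega)⟩

theorem IsProperColoring.ne_of_edge {F : Type*} [Field F] {N : ℕ} {y : Fin (N + 1) → P1 F}
    (hy : y ∈ X F N) {T : Set (Fin (N + 1) × Fin (N + 1))} (hp : IsProperColoring y T) {a b : ℕ}
    (hab : a < b) (hb : b < N + 1) (h : Edge (N + 1) (natSet T) a b) :
    y ⟨a, by omega⟩ ≠ y ⟨b, hb⟩ := by
  rw [edge_iff hab] at h
  rcases h with ⟨-, rfl | ⟨rfl, h1⟩⟩ | h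
  · exact hy.2.2 ⟨a, by omega⟩
  · have h2 := hy.1
    have h3 := hy.2.1
    obtain rfl : b = N := by omega
    intro h4
    exact zeroPt_ne_inftyPt (h2.symm.trans (h4.trans h3))
  · exact hp _ ((mem_natSet (⟨a, by omega⟩ : Fin (N + 1)) ⟨b, hb⟩).1 h)

/-- A labelling with a properly coloured triangulation takes at least three values. -/
theorem mem_X'_of_isProperColoring {F : Type*} [Field F] {N : ℕ} (hN : 2 ≤ N)
    {y : Fin (N + 1) → P1 F} (hy : y ∈ X F N) {T : Set (Fin (N + 1) × Fin (N + 1))}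
    (hT : IsTriangulation T) (hp : IsProperColoring y T) : y ∈ X' F N := by
  classical
  refine ⟨hy, fun h => ?_⟩
  obtain ⟨b, h1, h2, h3, h4⟩ := (isTri_natSet_iff.2 hT).exists_inside (a := 0) (c := N) (by omega)
    (edge_base _ (by omega))
  have h5 := hp.ne_of_edge hy h1 (by omega) h3
  have h6 := hp.ne_of_edge hy h2 (by omega) h4
  have h7 : y ⟨0, by omega⟩ = zeroPt F := hy.1
  have h8 : y ⟨N, by omega⟩ = inftyPt F := hy.2.1
  have h9 := congrFun h ⟨b, by omega⟩
  rw [h7] at h5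
  rw [h8] at h6
  split_ifs at h9
  · exact h5 h9.symm
  · exact h6 h9

namespace Coordinates

open Classical in
/-- The seed of a triangulation. -/
noncomputable def seedOf (P : Coordinates n m K) (S : LabeledSeed n m K)
    (T : Set (Fin (n + 3) × Fin (n + 3))) : Seed n m K :=
  if h : ∃ S' d, S.MutationEquiv S' ∧ P.Realizes S' d ∧ Set.range d = natSet T then
    Quotient.mk _ h.choose
  -- An arbitrary value, not used for triangulations when `P.IsModel S` holds.
  else Quotient.mk _ S

namespace IsModel

variable {P : Coordinates n m K} {S : LabeledSeed n m K}

theorem exists_seedOf (h : P.IsModel S) {T : Set (Fin (n + 3) × Fin (n + 3))}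
    (hT : IsTriangulation T) :
    ∃ S' d, S.MutationEquiv S' ∧ P.Realizes S' d ∧ Set.range d = natSet T ∧
      P.seedOf S T = Quotient.mk _ S' := by
  have hex := h.exists_seed _ (isTri_natSet_iff.2 hT)
  obtain ⟨d, h1, h2, h3⟩ := hex.choose_spec
  exact ⟨_, d, h1, h2, h3, dif_pos hex⟩

theorem var_mem (h : P.IsModel S) (d : Fin (n + 3) × Fin (n + 3)) : P.var d ∈ S.clusterAlgebra :=
  h.χ_mem d.1.2 d.2.2

theorem mutableVars_seedOf (h : P.IsModel S) {T : Set (Fin (n + 3) × Fin (n + 3))}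
    (hT : IsTriangulation T) : (P.seedOf S T).mutableVars = P.var '' T := by
  obtain ⟨S', d, -, h2, h3, h4⟩ := h.exists_seedOf hT
  rw [h4]
  show Set.range (fun i => S'.x (Sum.inl i)) = _
  ext z
  constructor
  · rintro ⟨i, rfl⟩
    have hi : ((d i).1, (d i).2) ∈ natSet T := h3 ▸ ⟨i, rfl⟩
    obtain ⟨h5, h6, h7⟩ := exists_of_mem_natSet hi
    exact ⟨_, h7, (h2.x_inl i).symm⟩
  · rintro ⟨⟨a, b⟩, hab, rfl⟩
    rw [← mem_natSet, ← h3] at hab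
    obtain ⟨i, hi⟩ := hab
    exact ⟨i, by simp only [h2.x_inl, hi, var]⟩

/-- A rational point over a labelling whose only coincidence is `y i = y j` kills the variable of
`ij` and that of no other diagonal. It exists because a triangulation without `ij` is properly
colored; the rationals supply enough labels. -/
theorem injOn_var (h : P.IsModel S) (hrank : S.Q.ReallyFullRank) :
    Set.InjOn P.var {d | IsDiagonal d} := by
  rintro ⟨i, j⟩ ⟨h1, h2⟩ ⟨k, l⟩ ⟨h3, -⟩ heq
  simp only at h1 h2 h3
  have hj : j.val < n + 2 + 1 := j.2
  have hd : ¬(i.val = 0 ∧ j.val = n + 2) := by omega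
  obtain ⟨y, hy, hyy⟩ := exists_labelling_collapsing h1 hj hd
  obtain ⟨R, hR, hmem⟩ := exists_isTri_notMem h1 j.2 h2
  obtain ⟨ψ, hψ⟩ := h.exists_point hrank hy hR fun a b hab => by
    have := hR.diag _ _ hab
    rw [Ne, hyy]
    rintro (h5 | ⟨h5, h6⟩ | ⟨h5, h6⟩)
    · omega
    · exact hmem (h5 ▸ h6 ▸ hab)
    · omega
  have h4 : P.χ i j = P.χ k l := heq
  have h5 := (hψ i j).2 ((hyy i j).2 (Or.inr (Or.inl ⟨rfl, rfl⟩)))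
  have h6 : ψ ⟨P.χ k l, h.χ_mem k.2 l.2⟩ = 0 := by
    rw [← h5]
    congr 1
    exact Subtype.ext h4.symm
  rw [hψ k l, hyy] at h6
  rw [Prod.mk.injEq, Fin.ext_iff, Fin.ext_iff]
  omega

theorem isTriangulationModel (h : P.IsModel S) (hrank : S.Q.ReallyFullRank) :
    IsTriangulationModel S P.var (P.seedOf S) := by
  refine ⟨h.injOn_var hrank, ⟨fun T hT => ?_, fun T hT T' hT' heq => ?_, ?_⟩,
    fun T hT => h.mutableVars_seedOf hT⟩
  · obtain ⟨S', d, h1, -, -, h4⟩ := h.exists_seedOf hT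
    exact ⟨S', h1, h4⟩
  · have h1 := h.mutableVars_seedOf hT
    rw [heq, h.mutableVars_seedOf hT'] at h1
    exact ((h.injOn_var hrank).image_eq_image_iff hT'.1 hT.1).1 h1 |>.symm
  · rintro _ ⟨S', hS', rfl⟩
    obtain ⟨d, hd⟩ := h.realizes S' hS'
    obtain ⟨T, hT⟩ := exists_natSet_eq hd.tri
    have hT' : IsTriangulation T := isTri_natSet_iff.1 (hT ▸ hd.tri)
    obtain ⟨S'', d', -, h2, h3, h4⟩ := h.exists_seedOf hT'
    refine ⟨T, hT', ?_⟩
    rw [h4]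
    obtain ⟨σ, hσ⟩ := h2.equiv hd (h3.trans hT)
    exact Quotient.sound ⟨σ, hσ⟩

/-- Points of the cluster variety over a labelling with a properly coloured triangulation. -/
theorem exists_liesOver (h : P.IsModel S) (hrank : S.Q.ReallyFullRank) {F : Type*} [Field F]
    {y : Fin (n + 3) → P1 F} (hy : y ∈ X F (n + 2)) {T : Set (Fin (n + 3) × Fin (n + 3))}
    (hT : IsTriangulation T) (hp : IsProperColoring y T) :
    ∃ φ : S.ClusterVariety F, LiesOver P.var φ y := by
  obtain ⟨ψ, hψ⟩ := h.exists_point hrank hy (isTri_natSet_iff.2 hT)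
    fun i j hij => hp _ ((mem_natSet i j).1 hij)
  refine ⟨Algebra.TensorProduct.lift (Algebra.ofId F F) (RingHom.toIntAlgHom ψ)
    (fun _ _ => Commute.all _ _), fun d _ => ⟨h.var_mem d, ?_⟩⟩
  rw [Algebra.TensorProduct.lift_tmul, map_one, one_mul]
  exact hψ d.1 d.2

/-- Every point of the cluster manifold lies over some labelling. -/
theorem exists_labelling (h : P.IsModel S) {F : Type*} [Field F]
    {φ : S.ClusterVariety F} (hφ : φ ∈ S.clusterManifold F) :
    ∃ y ∈ X' F (n + 2), LiesOver P.var φ y := by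
  let ψ : S.clusterAlgebra →+* F := φ.toRingHom.comp Algebra.TensorProduct.includeRight.toRingHom
  obtain ⟨g, χ, -, hg0, hχ, hz⟩ := h.isPolygon_map ψ
  obtain ⟨y, hy, hyz⟩ := hz.exists_labelling (N := n + 2) (by omega)
  have hy' : ∀ d : Fin (n + 3) × Fin (n + 3),
      φ (1 ⊗ₜ[ℤ] (⟨P.var d, h.var_mem d⟩ : S.clusterAlgebra)) = 0 ↔ y d.1 = y d.2 := by
    intro d
    rw [← hyz, mul_eq_zero, or_iff_left (mon_ne_zero hg0 _), hχ _ _ d.1.2 d.2.2]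
    rfl
  refine ⟨y, ?_, fun d _ => ⟨h.var_mem d, hy' d⟩⟩
  -- Some torus contains the point, so some triangulation is properly colored by `y`; this excludes
  -- the alternating labelling.
  simp only [LabeledSeed.clusterManifold, Set.mem_iUnion] at hφ
  obtain ⟨s, ⟨S', hS', rfl⟩, hφs⟩ := hφ
  obtain ⟨d, hd⟩ := h.realizes S' hS'
  obtain ⟨T, hT⟩ := exists_natSet_eq hd.tri
  refine mem_X'_of_isProperColoring (by omega) hy (isTri_natSet_iff.1 (hT ▸ hd.tri)) ?_
  rintro ⟨i, j⟩ hij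
  rw [Ne, ← hy']
  refine hφs _ ?_
  rw [← mem_natSet, hT] at hij
  obtain ⟨k, hk⟩ := hij
  exact ⟨k, by simp only [hd.x_inl, hk, var]⟩

end IsModel

end Coordinates

/-- The bridge to combinatorics: membership in a torus depends only on the labelling below the
point. -/
theorem LiesOver.mem_torus_iff {N : ℕ} {S : LabeledSeed n m K} {χ : Fin N × Fin N → K}
    {τ : Set (Fin N × Fin N) → Seed n m K} (h : IsTriangulationModel S χ τ) {F : Type*} [Field F]
    {φ : S.ClusterVariety F} {y : Fin N → P1 F} (hφ : LiesOver χ φ y) {T : Set (Fin N × Fin N)}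
    (hT : IsTriangulation T) : φ ∈ S.torus F (τ T) ↔ IsProperColoring y T := by
  constructor
  · intro hφT d hd
    obtain ⟨hmem, h1⟩ := hφ d (hT.1 d hd)
    rw [Ne, ← h1]
    refine hφT _ ?_
    rw [h.2.2 T hT]
    exact ⟨d, hd, rfl⟩
  · rintro hp ⟨z, hz⟩ hzT
    rw [h.2.2 T hT] at hzT
    obtain ⟨d, hd, rfl⟩ := hzT
    obtain ⟨hmem, h1⟩ := hφ d (hT.1 d hd)
    exact fun h0 => hp d hd (h1.1 h0)

end

/-! ### Dissections into triangles -/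

section

/-- `R` is the set of all edges, including sides, of a triangulation of the polygon with vertices
`a, a + 1, …, c`. -/
inductive Dissect : ℕ → ℕ → Set (ℕ × ℕ) → Prop
  | side (a : ℕ) : Dissect a (a + 1) {(a, a + 1)}
  | node {a b c : ℕ} {R R' : Set (ℕ × ℕ)} : Dissect a b R → Dissect b c R' →
      Dissect a c (insert (a, c) (R ∪ R'))

namespace Dissect

variable {a c : ℕ} {R : Set (ℕ × ℕ)}

theorem lt (h : Dissect a c R) : a < c := by
  induction h with
  | side a => omega
  | node _ _ ih ih' => omega

theorem bounds (h : Dissect a c R) {p q : ℕ} (hpq : (p, q) ∈ R) : a ≤ p ∧ p < q ∧ q ≤ c := by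
  induction h with
  | side a =>
    simp only [Set.mem_singleton_iff, Prod.mk.injEq] at hpq
    omega
  | node h h' ih ih' =>
    have := h.lt
    have := h'.lt
    rcases hpq with hpq | hpq | hpq
    · simp only [Prod.mk.injEq] at hpq
      omega
    · have := ih hpq
      omega
    · have := ih' hpq
      omega

theorem top_mem (h : Dissect a c R) : (a, c) ∈ R := by
  cases h with
  | side => rfl
  | node => exact Or.inl rfl

theorem side_mem (h : Dissect a c R) {p : ℕ} (hp : a ≤ p) (hpc : p < c) : (p, p + 1) ∈ R := by
  induction h with
  | side a =>
    obtain rfl : p = a := by omega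
    rfl
  | @node a b c R R' h h' ih ih' =>
    by_cases hpb : p < b
    · exact Or.inr (Or.inl (ih hp hpb))
    · exact Or.inr (Or.inr (ih' (by omega) hpc))

theorem nc (h : Dissect a c R) {p q r s : ℕ} (hpq : (p, q) ∈ R) (hrs : (r, s) ∈ R) :
    ¬(p < r ∧ r < q ∧ q < s) := by
  induction h with
  | side a =>
    simp only [Set.mem_singleton_iff, Prod.mk.injEq] at hpq hrs
    omega
  | node h h' ih ih' =>
    have h1 := (h.node h').bounds hpq
    have h2 := (h.node h').bounds hrs
    rcases hpq with hpq | hpq | hpq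
    · simp only [Prod.mk.injEq] at hpq
      omega
    · rcases hrs with hrs | hrs | hrs
      · simp only [Prod.mk.injEq] at hrs
        omega
      · exact ih hpq hrs
      · have := h.bounds hpq
        have := h'.bounds hrs
        omega
    · rcases hrs with hrs | hrs | hrs
      · simp only [Prod.mk.injEq] at hrs
        omega
      · have := h'.bounds hpq
        have := h.bounds hrs
        omega
      · exact ih' hpq hrs

theorem exists_inside (h : Dissect a c R) {p q : ℕ} (hpq : (p, q) ∈ R) (hlt : p + 1 < q) :
    ∃ b, p < b ∧ b < q ∧ (p, b) ∈ R ∧ (b, q) ∈ R := by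
  induction h with
  | side a =>
    simp only [Set.mem_singleton_iff, Prod.mk.injEq] at hpq
    omega
  | @node a b c R R' h h' ih ih' =>
    rcases hpq with hpq | hpq | hpq
    · simp only [Prod.mk.injEq] at hpq
      obtain ⟨rfl, rfl⟩ := hpq
      exact ⟨b, h.lt, h'.lt, Or.inr (Or.inl h.top_mem), Or.inr (Or.inr h'.top_mem)⟩
    · obtain ⟨b, h1, h2, h3, h4⟩ := ih hpq
      exact ⟨b, h1, h2, Or.inr (Or.inl h3), Or.inr (Or.inl h4)⟩
    · obtain ⟨b, h1, h2, h3, h4⟩ := ih' hpq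
      exact ⟨b, h1, h2, Or.inr (Or.inr h3), Or.inr (Or.inr h4)⟩

/-- The diagonals of a dissection into triangles form a triangulation. -/
theorem isTri {N : ℕ} (h : Dissect 0 N R) :
    IsTri (N + 1) {d ∈ R | d.1 + 1 < d.2 ∧ ¬(d.1 = 0 ∧ d.2 = N)} := by
  have hN := h.lt
  have hE : ∀ {p q}, p < q → (Edge (N + 1) {d ∈ R | d.1 + 1 < d.2 ∧ ¬(d.1 = 0 ∧ d.2 = N)} p q ↔
      (p, q) ∈ R) := by
    intro p q hpq
    rw [edge_iff hpq]
    constructor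
    · rintro (⟨h1, rfl | ⟨rfl, h2⟩⟩ | h1)
      · exact h.side_mem (by omega) (by omega)
      · obtain rfl : q = N := by omega
        exact h.top_mem
      · exact h1.1
    · intro h1
      have h2 := h.bounds h1
      by_cases h3 : p + 1 < q ∧ ¬(p = 0 ∧ q = N)
      · exact Or.inr ⟨h1, h3⟩
      · left
        omega
  refine IsTri.of_inside (by omega) ?_ ?_ ?_
  · rintro p q ⟨h1, h2⟩
    have h3 := h.bounds h1
    simp only at h2
    omega
  · rintro p q r s ⟨h1, -⟩ ⟨h2, -⟩
    exact h.nc h1 h2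
  · intro p q hpq hpq'
    obtain ⟨b, h1, h2, h3, h4⟩ := h.exists_inside ((hE (by omega)).1 hpq') hpq
    exact ⟨b, h1, h2, (hE h1).2 h3, (hE h2).2 h4⟩

theorem fan_right {a c : ℕ} (h : a < c) :
    Dissect a c {d | a ≤ d.1 ∧ d.1 < d.2 ∧ d.2 ≤ c ∧ (d.2 = c ∨ d.1 + 1 = d.2)} := by
  obtain ⟨k, rfl⟩ : ∃ k, c = a + 1 + k := ⟨c - a - 1, by omega⟩
  clear h
  induction k generalizing a with
  | zero =>
    show Dissect a (a + 1) _
    convert side a using 1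
    ext ⟨p, q⟩
    simp only [Set.mem_ofPred_eq, Set.mem_singleton_iff, Prod.mk.injEq]
    omega
  | succ k ih =>
    have h := ih (a := a + 1)
    rw [show a + 1 + 1 + k = a + 1 + (k + 1) by omega] at h
    convert (side a).node h using 1
    ext ⟨p, q⟩
    simp only [Set.mem_ofPred_eq, Set.mem_insert_iff, Set.mem_union, Set.mem_singleton_iff,
      Prod.mk.injEq]
    omega

theorem fan_left {a c : ℕ} (h : a < c) :
    Dissect a c {d | a ≤ d.1 ∧ d.1 < d.2 ∧ d.2 ≤ c ∧ (d.1 = a ∨ d.1 + 1 = d.2)} := by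
  obtain ⟨k, rfl⟩ : ∃ k, c = a + 1 + k := ⟨c - a - 1, by omega⟩
  clear h
  induction k with
  | zero =>
    show Dissect a (a + 1) _
    convert side a using 1
    ext ⟨p, q⟩
    simp only [Set.mem_ofPred_eq, Set.mem_singleton_iff, Prod.mk.injEq]
    omega
  | succ k ih =>
    show Dissect a (a + 1 + k + 1) _
    convert ih.node (side (a + 1 + k)) using 1
    ext ⟨p, q⟩
    simp only [Set.mem_ofPred_eq, Set.mem_insert_iff, Set.mem_union, Set.mem_singleton_iff,
      Prod.mk.injEq]
    omega

/-- A triangulation has a proper coloring by three colors. -/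
theorem exists_coloring {α : Type*} (h3 : ∀ x y : α, x ≠ y → ∃ z, z ≠ x ∧ z ≠ y)
    (h : Dissect a c R) {x y : α} (hxy : x ≠ y) :
    ∃ f : ℕ → α, f a = x ∧ f c = y ∧ ∀ p q, (p, q) ∈ R → f p ≠ f q := by
  induction h generalizing x y with
  | side a =>
    refine ⟨fun t => if t = a then x else y, by simp, by simp, fun p q hpq => ?_⟩
    simp only [Set.mem_singleton_iff, Prod.mk.injEq] at hpq
    obtain ⟨rfl, rfl⟩ := hpq
    simpa using hxy
  | @node a b c R R' h h' ih ih' =>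
    obtain ⟨z, hzx, hzy⟩ := h3 x y hxy
    obtain ⟨f, hfa, hfb, hf⟩ := ih hzx.symm
    obtain ⟨g, hgb, hgc, hg⟩ := ih' hzy
    have hab := h.lt
    have hbc := h'.lt
    obtain ⟨F, hle, hge⟩ : ∃ F : ℕ → α, (∀ t, t ≤ b → F t = f t) ∧ ∀ t, b ≤ t → F t = g t := by
      refine ⟨fun t => if t ≤ b then f t else g t, fun t ht => if_pos ht, fun t ht => ?_⟩
      simp only
      split_ifs with h1
      · rw [show t = b by omega, hfb, hgb]
      · rfl
    refine ⟨F, by rw [hle a hab.le, hfa], by rw [hge c hbc.le, hgc], fun p q hpq => ?_⟩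
    rcases hpq with hpq | hpq | hpq
    · rw [Prod.mk.injEq] at hpq
      obtain ⟨rfl, rfl⟩ := hpq
      rw [hle _ hab.le, hge _ hbc.le, hfa, hgc]
      exact hxy
    · have := h.bounds hpq
      rw [hle p (by omega), hle q (by omega)]
      exact hf p q hpq
    · have := h'.bounds hpq
      rw [hge p (by omega), hge q (by omega)]
      exact hg p q hpq

theorem shift (h : Dissect a c R) (d : ℕ) :
    Dissect (a + d) (c + d) ((fun x => (x.1 + d, x.2 + d)) '' R) := by
  induction h with
  | side a =>
    rw [Set.image_singleton]
    rw [show a + 1 + d = a + d + 1 by omega]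
    exact side (a + d)
  | node h h' ih ih' =>
    rw [Set.image_insert_eq, Set.image_union]
    exact ih.node ih'

/-- Gluing a dissection to a side of another one. -/
theorem glue {i d : ℕ} {R₁ : Set (ℕ × ℕ)} (h : Dissect a c R) (h₁ : Dissect i (i + 1 + d) R₁)
    (hi : a ≤ i) (hic : i < c) :
    ∃ R', Dissect a (c + d) R' ∧ R₁ ⊆ R' ∧ ∀ p q, (p, q) ∈ R' → (p, q) ∈ R₁ ∨
      ∃ p' q', (p', q') ∈ R ∧ p = (if p' ≤ i then p' else p' + d) ∧
        q = (if q' ≤ i then q' else q' + d) := by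
  induction h with
  | side a =>
    obtain rfl : i = a := by omega
    exact ⟨R₁, h₁, subset_rfl, fun p q h => Or.inl h⟩
  | @node a b c R R' h h' ih ih' =>
    have hab := h.lt
    have hbc := h'.lt
    by_cases hib : i < b
    · obtain ⟨R₂, h2, h3, h4⟩ := ih hi hib
      refine ⟨_, h2.node (h'.shift d), fun x hx => Or.inr (Or.inl (h3 hx)), fun p q hpq => ?_⟩
      rcases hpq with hpq | hpq | ⟨⟨p', q'⟩, hpq, heq⟩
      · rw [Prod.mk.injEq] at hpq
        refine Or.inr ⟨a, c, Or.inl rfl, ?_, ?_⟩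
        · rw [if_pos hi]; exact hpq.1
        · rw [if_neg (by omega)]; exact hpq.2
      · rcases h4 p q hpq with h5 | ⟨p', q', h5, h6, h7⟩
        · exact Or.inl h5
        · exact Or.inr ⟨p', q', Or.inr (Or.inl h5), h6, h7⟩
      · have := h'.bounds hpq
        rw [Prod.mk.injEq] at heq
        refine Or.inr ⟨p', q', Or.inr (Or.inr hpq), ?_, ?_⟩
        · rw [if_neg (by omega)]; exact heq.1.symm
        · rw [if_neg (by omega)]; exact heq.2.symm
    · obtain ⟨R₂, h2, h3, h4⟩ := ih' (by omega) hic
      refine ⟨_, h.node h2, fun x hx => Or.inr (Or.inr (h3 hx)), fun p q hpq => ?_⟩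
      rcases hpq with hpq | hpq | hpq
      · rw [Prod.mk.injEq] at hpq
        refine Or.inr ⟨a, c, Or.inl rfl, ?_, ?_⟩
        · rw [if_pos hi]; exact hpq.1
        · rw [if_neg (by omega)]; exact hpq.2
      · have := h.bounds hpq
        refine Or.inr ⟨p, q, Or.inr (Or.inl hpq), ?_, ?_⟩
        · rw [if_pos (by omega)]
        · rw [if_pos (by omega)]
      · rcases h4 p q hpq with h5 | ⟨p', q', h5, h6, h7⟩
        · exact Or.inl h5
        · exact Or.inr ⟨p', q', Or.inr (Or.inr h5), h6, h7⟩

end Dissect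

/-- A polygon that is properly colored by at least three colors has a properly colored
triangulation. -/
theorem exists_dissect {α : Type*} (f : ℕ → α) {a c : ℕ} (hs : ∀ p, a ≤ p → p < c → f p ≠ f (p + 1)) (hac : f a ≠ f c)
    (hb : ∃ b, a < b ∧ b < c ∧ f b ≠ f a ∧ f b ≠ f c) :
    ∃ R, Dissect a c R ∧ ∀ p q, (p, q) ∈ R → f p ≠ f q := by
  classical
  obtain ⟨k, hk⟩ : ∃ k, c - a = k := ⟨_, rfl⟩
  induction k using Nat.strong_induction_on generalizing a c with
  | _ k ih =>
  have key : ∀ b, a < b → b < c → f b ≠ f a → f b ≠ f c →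
      (a + 1 < b → ∃ t, a < t ∧ t < b ∧ f t ≠ f a ∧ f t ≠ f b) →
      (b + 1 < c → ∃ t, b < t ∧ t < c ∧ f t ≠ f b ∧ f t ≠ f c) →
      ∃ R, Dissect a c R ∧ ∀ p q, (p, q) ∈ R → f p ≠ f q := by
    intro b hab hbc hba hbc' hl hr
    have sub : ∀ a' c', a ≤ a' → c' ≤ c → c' - a' < k → a' < c' → f a' ≠ f c' →
        (a' + 1 < c' → ∃ t, a' < t ∧ t < c' ∧ f t ≠ f a' ∧ f t ≠ f c') →
        ∃ R, Dissect a' c' R ∧ ∀ p q, (p, q) ∈ R → f p ≠ f q := by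
      intro a' c' h1 h2 h3 h4 h5 h6
      by_cases h7 : a' + 1 < c'
      · exact ih _ h3 (fun p hp hp' => hs p (by omega) (by omega)) h5 (h6 h7) rfl
      · obtain rfl : c' = a' + 1 := by omega
        refine ⟨_, Dissect.side a', fun p q hpq => ?_⟩
        simp only [Set.mem_singleton_iff, Prod.mk.injEq] at hpq
        obtain ⟨rfl, rfl⟩ := hpq
        exact h5
    have hk1 : b - a < k := by clear hl hr hb sub; omega
    have hk2 : c - b < k := by clear hl hr hb sub; omega
    obtain ⟨R, hR, hR'⟩ := sub a b le_rfl hbc.le hk1 hab hba.symm hl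
    obtain ⟨Q, hQ, hQ'⟩ := sub b c hab.le le_rfl hk2 hbc hbc' hr
    refine ⟨_, hR.node hQ, ?_⟩
    rintro p q (hpq | hpq | hpq)
    · rw [Prod.mk.injEq] at hpq
      rw [hpq.1, hpq.2]
      exact hac
    · exact hR' p q hpq
    · exact hQ' p q hpq
  -- The first vertex `b` with a color other than those of `a` and `c` is tried as apex over `ac`.
  -- If `ab` is not a side, minimality gives `a + 1` the color of `c`, so the left part has a third
  -- color.
  obtain ⟨b, ⟨h1, h2, h4, h5⟩, hmin⟩ : ∃ b, (a < b ∧ b < c ∧ f b ≠ f a ∧ f b ≠ f c) ∧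
      ∀ t, t < b → ¬(a < t ∧ t < c ∧ f t ≠ f a ∧ f t ≠ f c) :=
    ⟨Nat.find hb, Nat.find_spec hb, fun t ht => Nat.find_min hb ht⟩
  have hleft : a + 1 < b → ∃ t, a < t ∧ t < b ∧ f t ≠ f a ∧ f t ≠ f b := by
    intro h6
    refine ⟨a + 1, by omega, h6, (hs a le_rfl (by omega)).symm, fun h7 => ?_⟩
    exact hmin _ h6 ⟨by omega, by omega, h7 ▸ h4, h7 ▸ h5⟩
  by_cases hA : b + 1 < c → ∃ t, b < t ∧ t < c ∧ f t ≠ f b ∧ f t ≠ f c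
  · exact key b h1 h2 h4 h5 hleft hA
  -- Otherwise only the colors of `b` and `c` occur from `b` to `c`, so `c - 1` has the color of
  -- `b`. With `c - 1` as apex the right part is a side, and the left part has the color of `c` at
  -- `b + 1`.
  · push Not at hA
    obtain ⟨h6, h7⟩ := hA
    have hc1 : f (c - 1) ≠ f c := by
      have := hs (c - 1) (by omega) (by omega)
      rwa [Nat.sub_add_cancel (by omega)] at this
    have h8 : f (c - 1) = f b := by
      by_contra h9
      exact hc1 (h7 _ (by omega) (by omega) h9)
    have h9 : f (b + 1) = f c := h7 _ (by omega) h6 (hs b h1.le h2).symm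
    refine key (c - 1) (by omega) (by omega) (h8 ▸ h4) hc1 (fun _ => ?_) (fun h => by omega)
    by_cases hbc : b + 1 < c - 1
    · exact ⟨b + 1, by omega, hbc, by rw [h9]; exact hac.symm, by rw [h9]; exact hc1.symm⟩
    · exfalso
      have h10 : b + 1 = c - 1 := by omega
      rw [← h10, h9] at hc1
      exact hc1 rfl

end

/-! ### Runs of the algorithm -/

section

namespace Dissect

variable {a b c : ℕ} {R : Set (ℕ × ℕ)}

theorem extend_left (h : Dissect b c R) (hab : a ≤ b) :
    Dissect a c (R ∪ {d | a ≤ d.1 ∧ (d.2 = c ∧ d.1 ≤ b ∨ d.2 = d.1 + 1 ∧ d.2 ≤ b)}) := by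
  have hbc := h.lt
  obtain ⟨k, rfl⟩ : ∃ k, b = a + k := ⟨b - a, by omega⟩
  clear hab
  induction k generalizing a with
  | zero =>
    show Dissect a c _
    rw [Set.union_eq_left.2]
    · exact h
    rintro ⟨p, q⟩ ⟨h1, h2⟩
    simp only at h1 h2
    obtain ⟨rfl, rfl⟩ : p = a ∧ q = c := by omega
    exact h.top_mem
  | succ k ih =>
    have h' : Dissect (a + 1 + k) c R := by rwa [show a + 1 + k = a + (k + 1) by omega]
    convert (side a).node (ih h' h'.lt) using 1
    ext ⟨p, q⟩
    simp only [Set.mem_ofPred_eq, Set.mem_insert_iff, Set.mem_union, Set.mem_singleton_iff,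
      Prod.mk.injEq]
    by_cases hR : (p, q) ∈ R
    · simp [hR]
    · simp only [hR, false_or]
      omega

theorem extend_right (h : Dissect a b R) (hbc : b ≤ c) :
    Dissect a c (R ∪ {d | d.2 ≤ c ∧ (d.1 = a ∧ b ≤ d.2 ∨ d.2 = d.1 + 1 ∧ b ≤ d.1)}) := by
  have hab := h.lt
  obtain ⟨k, rfl⟩ : ∃ k, c = b + k := ⟨c - b, by omega⟩
  clear hbc
  induction k with
  | zero =>
    show Dissect a b _
    rw [Set.union_eq_left.2]
    · exact h
    rintro ⟨p, q⟩ ⟨h1, h2⟩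
    simp only at h1 h2
    obtain ⟨rfl, rfl⟩ : p = a ∧ q = b := by omega
    exact h.top_mem
  | succ k ih =>
    show Dissect a (b + k + 1) _
    convert ih.node (side (b + k)) using 1
    ext ⟨p, q⟩
    simp only [Set.mem_ofPred_eq, Set.mem_insert_iff, Set.mem_union, Set.mem_singleton_iff,
      Prod.mk.injEq]
    by_cases hR : (p, q) ∈ R
    · simp [hR]
    · simp only [hR, false_or]
      omega

/-- This is the drawing made before the last step: over each interval from `I a` to `I (a + 1)` a
fan with apex `I (a + 1)`, joined to the rest by the triangle `I a`, `I (a + 1)`, `m`. -/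
theorem chain {m k : ℕ} {I : ℕ → ℕ} (hI : ∀ a, a < k → I a < I (a + 1)) (h : Dissect (I k) m R) :
    Dissect (I 0) m {d | d ∈ R ∨ ∃ a, a < k ∧ (d = (I a, m) ∨ I a ≤ d.1 ∧ d.1 < d.2 ∧
      d.2 ≤ I (a + 1) ∧ (d.2 = I (a + 1) ∨ d.1 + 1 = d.2))} := by
  suffices H : ∀ l a, a + l = k → Dissect (I a) m {d | d ∈ R ∨ ∃ a', a ≤ a' ∧ a' < k ∧
      (d = (I a', m) ∨ I a' ≤ d.1 ∧ d.1 < d.2 ∧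
        d.2 ≤ I (a' + 1) ∧ (d.2 = I (a' + 1) ∨ d.1 + 1 = d.2))} by
    simpa using H k 0 (by omega)
  intro l
  induction l with
  | zero =>
    rintro a rfl
    show Dissect (I a) m _
    have h' : Dissect (I a) m R := h
    convert h' using 1
    ext d
    constructor
    · rintro (hd | ⟨a', h1, h2, -⟩)
      · exact hd
      · omega
    · exact Or.inl
  | succ l ih =>
    intro a hal
    convert (fan_right (hI a (by omega))).node (ih (a + 1) (by omega)) using 1
    ext d
    constructor
    · rintro (hd | ⟨a', h1, h2, h3⟩)
      · exact Or.inr (Or.inr (Or.inl hd))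
      · rcases h1.eq_or_lt with rfl | h1
        · exact h3.elim Or.inl fun h3 => Or.inr (Or.inl h3)
        · exact Or.inr (Or.inr (Or.inr ⟨a', h1, h2, h3⟩))
    · rintro (hd | hd | hd | ⟨a', h1, h2, h3⟩)
      · exact Or.inr ⟨a, le_rfl, by omega, Or.inl hd⟩
      · exact Or.inr ⟨a, le_rfl, by omega, Or.inr hd⟩
      · exact Or.inl hd
      · exact Or.inr ⟨a', by omega, h2, h3⟩

end Dissect

section Run

variable {F : Type*} [Field F] {m : ℕ} {y : Fin (m + 1) → P1 F}

theorem Found.exists_pred {k : ℕ} {j : Fin (m + 1)} (h : Found y (k + 1) j) :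
    ∃ i, Found y k i ∧ i < j ∧ Marks (k + 1) (y j) ∧
      ∀ l, i < l → l < j → ¬Marks (k + 1) (y l) := by
  cases h with
  | succ _ i _ h1 h2 h3 h4 => exact ⟨i, h1, h2, h3, h4⟩

theorem Found.unique {k : ℕ} {i j : Fin (m + 1)} (h : Found y k i) (h' : Found y k j) : i = j := by
  induction k generalizing i j with
  | zero => cases h; cases h'; rfl
  | succ k ih =>
    obtain ⟨a, ha, h1, h2, h3⟩ := h.exists_pred
    obtain ⟨b, hb, h4, h5, h6⟩ := h'.exists_pred
    obtain rfl := ih ha hb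
    rcases lt_trichotomy i j with hij | hij | hij
    · exact absurd h2 (h6 _ h1 hij)
    · exact hij
    · exact absurd h5 (h3 _ h4 hij)

theorem Found.le_val {k : ℕ} {i : Fin (m + 1)} (h : Found y k i) : k ≤ i.val := by
  induction h with
  | zero => exact Nat.zero_le _
  | succ k i j _ hij _ _ ih =>
    rw [Fin.lt_def] at hij
    omega

theorem Found.not_stops {k : ℕ} {i j : Fin (m + 1)} (h : Found y k i) (h' : Found y (k + 1) j) :
    ¬Stops y k i := by
  obtain ⟨a, ha, h1, h2, -⟩ := h'.exists_pred
  obtain rfl := h.unique ha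
  exact fun hs => hs j h1 h2

theorem Found.exists_succ {k : ℕ} {i j : Fin (m + 1)} (h : Found y k i) (hij : i < j)
    (hj : Marks (k + 1) (y j)) : ∃ j', Found y (k + 1) j' := by
  classical
  let s := Finset.univ.filter fun j => i < j ∧ Marks (k + 1) (y j)
  have hs : s.Nonempty := ⟨j, by simp [s, hij, hj]⟩
  have hmem := s.min'_mem hs
  simp only [s, Finset.mem_filter, Finset.mem_univ, true_and] at hmem
  refine ⟨_, Found.succ k i _ h hmem.1 hmem.2 fun l h1 h2 h3 => ?_⟩
  exact absurd (s.min'_le l (by simp [s, h1, h3])) (not_le.2 h2)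

/-- The whole run of the procedure: `I 0, …, I (k + 1)` are the indices found. -/
structure IsRun (y : Fin (m + 1) → P1 F) (k : ℕ) (I : ℕ → Fin (m + 1)) : Prop where
  found : ∀ a, a ≤ k + 1 → Found y a (I a)
  stops : Stops y (k + 1) (I (k + 1))

theorem exists_isRun {j : Fin (m + 1)} (hj : 0 < j) (h0 : y j ≠ zeroPt F) (h1 : y j ≠ inftyPt F) :
    ∃ k I, IsRun y k I := by
  classical
  -- The index found in step `k` is at least `k`, so the procedure stops; the vertex `j` guarantees
  -- a first step.
  have hex : ∃ k, ¬∃ i, Found y (k + 1) i := ⟨m, fun ⟨i, hi⟩ => by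
    have := hi.le_val
    omega⟩
  have hf : ∀ a, a ≤ Nat.find hex → ∃ i, Found y a i := by
    intro a ha
    cases a with
    | zero => exact ⟨0, Found.zero⟩
    | succ a => exact not_not.1 (Nat.find_min hex ha)
  have hpos : Nat.find hex ≠ 0 := by
    intro h
    have := Nat.find_spec hex
    rw [h] at this
    exact this (Found.zero.exists_succ hj (Or.inl ⟨by decide, h0, h1⟩))
  obtain ⟨k, hk⟩ := Nat.exists_eq_succ_of_ne_zero hpos
  have hf' : ∀ a, ∃ i, a ≤ Nat.find hex → Found y a i := fun a => by
    by_cases ha : a ≤ Nat.find hex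
    · obtain ⟨i, hi⟩ := hf a ha
      exact ⟨i, fun _ => hi⟩
    · exact ⟨0, fun h => absurd h ha⟩
  choose I hI using hf'
  refine ⟨k, I, fun a ha => hI a (by omega), fun j hj hm => ?_⟩
  have h2 := Nat.find_spec hex
  rw [hk] at h2
  exact h2 ((hI (k + 1) (by omega)).exists_succ hj hm)

namespace IsRun

variable {k : ℕ} {I : ℕ → Fin (m + 1)}

theorem step (h : IsRun y k I) {a : ℕ} (ha : a ≤ k) : I a < I (a + 1) ∧ Marks (a + 1) (y (I (a + 1))) ∧
    ∀ l, I a < l → l < I (a + 1) → ¬Marks (a + 1) (y l) := by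
  obtain ⟨i, h1, h2⟩ := (h.found (a + 1) (by omega)).exists_pred
  obtain rfl := h1.unique (h.found a (by omega))
  exact h2

theorem found_iff (h : IsRun y k I) {a : ℕ} {i : Fin (m + 1)} :
    Found y a i ↔ a ≤ k + 1 ∧ i = I a := by
  constructor
  · intro hi
    suffices ha : a ≤ k + 1 from ⟨ha, hi.unique (h.found a ha)⟩
    by_contra hlt
    have key : ∀ b i, Found y b i → k + 2 ≤ b → ∃ i, Found y (k + 2) i := by
      intro b
      induction b with
      | zero => intro i _ hb; omega
      | succ b ih =>
        intro i hi hb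
        by_cases hbk : k + 2 ≤ b
        · obtain ⟨i', h1, -⟩ := hi.exists_pred
          exact ih i' h1 hbk
        · obtain rfl : b = k + 1 := by omega
          exact ⟨i, hi⟩
    obtain ⟨j, hj⟩ := key a i hi (by omega)
    exact (h.found (k + 1) le_rfl).not_stops hj h.stops
  · rintro ⟨ha, rfl⟩
    exact h.found a ha

theorem stops_iff (h : IsRun y k I) {a : ℕ} (ha : a ≤ k + 1) : Stops y a (I a) ↔ a = k + 1 := by
  constructor
  · intro hs
    by_contra hne
    exact (h.found a ha).not_stops (h.found (a + 1) (by omega)) hs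
  · rintro rfl
    exact h.stops

/-- The last step has number `k + 1`, so the terminal rule for an odd number of steps appears under
`Even k`, and the other one under `Odd k`. -/
theorem drawn_iff (h : IsRun y k I) {p q : Fin (m + 1)} : Drawn y p q ↔
    (∃ a, a < k ∧ p = I (a + 1) ∧ q = Fin.last m) ∨
    (∃ a, a < k ∧ q = I (a + 1) ∧ I a ≤ p ∧ p < q) ∨
    (Even k ∧ ∃ l, y l = zeroPt F ∧ (∀ j, l < j → y j ≠ zeroPt F) ∧
      (p = l ∧ l < q ∧ q.val + 1 ≤ m ∨ q.val + 1 = m ∧ I k ≤ p ∧ p ≤ l)) ∨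
    (Odd k ∧ (p = I k ∧ I (k + 1) ≤ q ∨ q = I (k + 1) ∧ I k ≤ p ∧ p < q)) := by
  constructor
  · rintro (⟨a, i, h1, h2⟩ | ⟨a, s, i, p, h1, h2, h3, h4, h5⟩ |
      ⟨a, i, l, q, h1, h2, h3, h4, h5, h6, h7⟩ | ⟨a, s, i, l, p, r, h1, h2, h3, h4, h5, h6, h7, h8, h9⟩ |
      ⟨a, s, i, q, h1, h2, h3, h4, h5⟩ | ⟨a, s, i, p, h1, h2, h3, h4, h5, h6⟩)
    · obtain ⟨ha, rfl⟩ := h.found_iff.1 h1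
      rw [h.stops_iff ha] at h2
      exact Or.inl ⟨a, by omega, rfl, rfl⟩
    · obtain ⟨ha, rfl⟩ := h.found_iff.1 h2
      obtain ⟨-, rfl⟩ := h.found_iff.1 h1
      rw [h.stops_iff ha] at h3
      exact Or.inr (Or.inl ⟨a, by omega, rfl, h4, h5⟩)
    · obtain ⟨ha, rfl⟩ := h.found_iff.1 h1
      rw [h.stops_iff ha] at h2
      obtain rfl : a = k := by omega
      rw [Nat.odd_add_one, Nat.not_odd_iff_even] at h3
      exact Or.inr (Or.inr (Or.inl ⟨h3, p, h4, h5, Or.inl ⟨rfl, h6, h7⟩⟩))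
    · obtain ⟨ha, rfl⟩ := h.found_iff.1 h2
      obtain ⟨-, rfl⟩ := h.found_iff.1 h1
      rw [h.stops_iff ha] at h3
      obtain rfl : a = k := by omega
      rw [Nat.odd_add_one, Nat.not_odd_iff_even] at h4
      exact Or.inr (Or.inr (Or.inl ⟨h4, l, h5, h6, Or.inr ⟨h9, h7, h8⟩⟩))
    · obtain ⟨ha, rfl⟩ := h.found_iff.1 h2
      obtain ⟨-, rfl⟩ := h.found_iff.1 h1
      rw [h.stops_iff ha] at h3
      obtain rfl : a = k := by omega
      rw [Nat.even_add_one, Nat.not_even_iff_odd] at h4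
      exact Or.inr (Or.inr (Or.inr ⟨h4, Or.inl ⟨rfl, h5⟩⟩))
    · obtain ⟨ha, rfl⟩ := h.found_iff.1 h2
      obtain ⟨-, rfl⟩ := h.found_iff.1 h1
      rw [h.stops_iff ha] at h3
      obtain rfl : a = k := by omega
      rw [Nat.even_add_one, Nat.not_even_iff_odd] at h4
      exact Or.inr (Or.inr (Or.inr ⟨h4, Or.inr ⟨rfl, h5, h6⟩⟩))
  · have hns : ∀ a, a < k → ¬Stops y (a + 1) (I (a + 1)) := fun a ha => by
      rw [h.stops_iff (by omega)]
      omega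
    have h0 := h.found k (by omega)
    have h1 := h.found (k + 1) le_rfl
    rintro (⟨a, ha, rfl, rfl⟩ | ⟨a, ha, rfl, h2, h3⟩ |
      ⟨hk, l, h4, h5, ⟨rfl, h6, h7⟩ | ⟨h6, h7, h8⟩⟩ | ⟨hk, ⟨rfl, h4⟩ | ⟨rfl, h4, h5⟩⟩)
    · exact Drawn.toLast a _ (h.found _ (by omega)) (hns a ha)
    · exact Drawn.fan a _ _ _ (h.found _ (by omega)) (h.found _ (by omega)) (hns a ha) h2 h3
    · exact Drawn.oddRight k _ p q h1 h.stops hk.add_one h4 h5 h6 h7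
    · exact Drawn.oddLeft k _ _ l p q h0 h1 h.stops hk.add_one h4 h5 h7 h8 h6
    · exact Drawn.evenRight k _ _ q h0 h1 h.stops hk.add_one h4
    · exact Drawn.evenLeft k _ _ p h0 h1 h.stops hk.add_one h4 h5

theorem apply_even (h : IsRun y k I) (hy : y ∈ X F m) {a : ℕ} (ha : a ≤ k + 1) (hev : Even a) :
    y (I a) = zeroPt F := by
  cases a with
  | zero =>
    rw [(h.found 0 (by omega)).unique Found.zero]
    exact hy.1
  | succ a =>
    rcases (h.step (a := a) (by omega)).2.1 with h1 | h1
    · exact absurd hev (Nat.not_even_iff_odd.2 h1.1)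
    · exact h1.2

theorem apply_odd (h : IsRun y k I) {a : ℕ} (ha : a ≤ k + 1) (hodd : Odd a) :
    y (I a) ≠ zeroPt F ∧ y (I a) ≠ inftyPt F := by
  cases a with
  | zero => exact absurd hodd (by decide)
  | succ a =>
    rcases (h.step (a := a) (by omega)).2.1 with h1 | h1
    · exact h1.2
    · exact absurd h1.1 (Nat.not_even_iff_odd.2 hodd)

theorem apply_ne_inftyPt (h : IsRun y k I) (hy : y ∈ X F m) {a : ℕ} (ha : a ≤ k + 1) :
    y (I a) ≠ inftyPt F := by
  rcases Nat.even_or_odd a with h1 | h1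
  · rw [h.apply_even hy ha h1]
    exact zeroPt_ne_inftyPt
  · exact (h.apply_odd ha h1).2

theorem val_lt (h : IsRun y k I) (hy : y ∈ X F m) {a : ℕ} (ha : a ≤ k + 1) : (I a).val < m := by
  by_contra hm
  have h1 : I a = Fin.last m := Fin.ext (by have := (I a).2; rw [Fin.val_last]; omega)
  exact h.apply_ne_inftyPt hy ha (h1 ▸ hy.2.1)

/-- Between `I a` and `I (a + 1)`, the values differ from the value at `I (a + 1)`. -/
theorem apply_between (h : IsRun y k I) (hy : y ∈ X F m) {a : ℕ} (ha : a ≤ k) {p : Fin (m + 1)}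
    (hp : I a ≤ p) (hp' : p < I (a + 1)) :
    (Even a → y p = zeroPt F ∨ y p = inftyPt F) ∧ (Odd a → y p ≠ zeroPt F) := by
  rcases hp.eq_or_lt with rfl | hlt
  · exact ⟨fun he => Or.inl (h.apply_even hy (by omega) he), fun ho => (h.apply_odd (by omega) ho).1⟩
  · have h1 := (h.step ha).2.2 p hlt hp'
    unfold Marks at h1
    constructor
    · intro he
      have := he.add_one
      tauto
    · intro ho
      have := ho.add_one
      tauto

/-- The last zero of `y`, if the number of steps is odd. -/
theorem exists_last_zero (h : IsRun y k I) (hy : y ∈ X F m) (hk : Even k) :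
    ∃ l, y l = zeroPt F ∧ (∀ j, l < j → y j ≠ zeroPt F) ∧ I k ≤ l ∧ l < I (k + 1) := by
  classical
  let s := Finset.univ.filter fun j => y j = zeroPt F
  have hmem : ∀ j, j ∈ s ↔ y j = zeroPt F := fun j => by simp [s]
  have hs : s.Nonempty := ⟨I k, (hmem _).2 (h.apply_even hy (by omega) hk)⟩
  have h0 := (hmem _).1 (s.max'_mem hs)
  refine ⟨s.max' hs, h0, fun j hj hj0 => ?_, ?_, ?_⟩
  · exact absurd (s.le_max' j ((hmem _).2 hj0)) (not_le.2 hj)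
  · exact s.le_max' _ ((hmem _).2 (h.apply_even hy (by omega) hk))
  · by_contra hle
    rcases (not_lt.1 hle).eq_or_lt with heq | hlt
    · exact (h.apply_odd le_rfl hk.add_one).1 (heq ▸ h0)
    · exact h.stops _ hlt (Or.inr ⟨hk.add_one.add_one, h0⟩)

theorem last_zero_unique {l l' : Fin (m + 1)} (h : y l = zeroPt F) (h' : ∀ j, l < j → y j ≠ zeroPt F)
    (hl : y l' = zeroPt F) (hl' : ∀ j, l' < j → y j ≠ zeroPt F) : l = l' := by
  rcases lt_trichotomy l l' with h1 | h1 | h1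
  · exact absurd hl (h' _ h1)
  · exact h1
  · exact absurd h (hl' _ h1)

/-- Only the tail from `I k` to `m` depends on the terminal rule. For even `k` it is the fan of the
last zero `l` up to `m - 1`, the fan of `m - 1` back to `I k`, and the triangle `I k`, `m - 1`, `m`.
For odd `k` it is the fan of `I (k + 1)` back to `I k`, followed by the fan of `I k` up to `m`. The
earlier steps are attached by `Dissect.chain`. -/
theorem exists_dissect (h : IsRun y k I) (hy : y ∈ X F m) :
    ∃ R, Dissect 0 m R ∧ natSet (upsilon y) = {d ∈ R | d.1 + 1 < d.2 ∧ ¬(d.1 = 0 ∧ d.2 = m)} := by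
  have hI : ∀ a, a ≤ k → (I a).val < (I (a + 1)).val := fun a ha => (h.step ha).1
  have hI0 : (I 0).val = 0 := by rw [(h.found 0 (by omega)).unique Found.zero]; rfl
  have hk1 := h.val_lt hy (a := k + 1) le_rfl
  have hIk := hI k le_rfl
  obtain ⟨Rt, hRt, hmem⟩ : ∃ Rt, Dissect (I k) m Rt ∧ ∀ p q, p + 1 < q → ((p, q) ∈ Rt ↔
      (p = I k ∧ q = m) ∨
      (Even k ∧ ∃ l : Fin (m + 1), y l = zeroPt F ∧ (∀ j, l < j → y j ≠ zeroPt F) ∧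
        (p = l ∧ q + 1 ≤ m ∨ q + 1 = m ∧ (I k).val ≤ p ∧ p ≤ l)) ∨
      (Odd k ∧ (p = I k ∧ (I (k + 1)).val ≤ q ∧ q ≤ m ∨ q = I (k + 1) ∧ (I k).val ≤ p))) := by
    rcases Nat.even_or_odd k with hk | hk
    · obtain ⟨l, hl, hl', h1, h2⟩ := h.exists_last_zero hy hk
      rw [Fin.le_def] at h1
      rw [Fin.lt_def] at h2
      have hlm : l.val < m - 1 := by omega
      have hd := ((Dissect.fan_left hlm).extend_left h1).node (Dissect.side (m - 1))
      rw [Nat.sub_add_cancel (by omega)] at hd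
      refine ⟨_, hd, fun p q hpq => ?_⟩
      have hno := Nat.not_odd_iff_even.2 hk
      have hex : (∃ l : Fin (m + 1), y l = zeroPt F ∧ (∀ j, l < j → y j ≠ zeroPt F) ∧
          (p = l ∧ q + 1 ≤ m ∨ q + 1 = m ∧ (I k).val ≤ p ∧ p ≤ l)) ↔
          (p = l ∧ q + 1 ≤ m ∨ q + 1 = m ∧ (I k).val ≤ p ∧ p ≤ l) := by
        constructor
        · rintro ⟨l', h3, h4, h5⟩
          rwa [last_zero_unique hl hl' h3 h4]
        · exact fun h5 => ⟨l, hl, hl', h5⟩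
      rw [hex]
      simp only [hk, hno, true_and, false_and, or_false, Set.mem_ofPred_eq, Set.mem_insert_iff,
        Set.mem_union, Set.mem_singleton_iff, Prod.mk.injEq]
      clear hex
      omega
    · refine ⟨_, (Dissect.fan_right hIk).extend_right hk1.le, fun p q hpq => ?_⟩
      have hno := Nat.not_even_iff_odd.2 hk
      simp only [hk, hno, true_and, false_and, false_or, Set.mem_ofPred_eq, Set.mem_union]
      omega
  have hd := Dissect.chain (I := fun a => (I a).val) (fun a ha => hI a ha.le) hRt
  simp only [hI0] at hd
  refine ⟨_, hd, ?_⟩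
  have key : ∀ p q : Fin (m + 1), p.val + 1 < q.val → ¬(p.val = 0 ∧ q.val = m) →
      (Drawn y p q ↔ (p.val, q.val) ∈ Rt ∨ ∃ a, a < k ∧ ((p.val, q.val) = ((I a).val, m) ∨
        (I a).val ≤ p ∧ p.val < q ∧ q.val ≤ (I (a + 1)).val ∧
          (q.val = I (a + 1) ∨ p.val + 1 = q))) := by
    intro p q hpq hd
    have hq := q.2
    rw [h.drawn_iff, hmem _ _ hpq]
    simp only [Fin.le_def, Fin.lt_def, Fin.ext_iff, Fin.val_last, Prod.mk.injEq]
    constructor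
    · rintro (⟨a, ha, h1, h2⟩ | ⟨a, ha, h1, h2, h3⟩ | ⟨hk, l, h1, h2, h3⟩ | ⟨hk, h1⟩)
      · by_cases hak : a + 1 = k
        · subst hak
          exact Or.inl (Or.inl ⟨h1, h2⟩)
        · exact Or.inr ⟨a + 1, by omega, Or.inl ⟨h1, h2⟩⟩
      · exact Or.inr ⟨a, ha, Or.inr ⟨h2, h3, h1.le, Or.inl h1⟩⟩
      · exact Or.inl (Or.inr (Or.inl ⟨hk, l, h1, h2, by omega⟩))
      · exact Or.inl (Or.inr (Or.inr ⟨hk, by omega⟩))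
    · rintro ((⟨h1, h2⟩ | ⟨hk, l, h1, h2, h3⟩ | ⟨hk, h1⟩) | ⟨a, ha, ⟨h1, h2⟩ | ⟨h1, h2, h3, h4⟩⟩)
      · cases k with
        | zero => omega
        | succ k => exact Or.inl ⟨k, by omega, h1, h2⟩
      · exact Or.inr (Or.inr (Or.inl ⟨hk, l, h1, h2, by omega⟩))
      · exact Or.inr (Or.inr (Or.inr ⟨hk, by omega⟩))
      · cases a with
        | zero => omega
        | succ a => exact Or.inl ⟨a, by omega, h1, h2⟩
      · exact Or.inr (Or.inl ⟨a, ha, by omega, h1, h2⟩)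
  ext ⟨p, q⟩
  constructor
  · intro hpq
    obtain ⟨hp, hq, ⟨⟨h1, h2⟩, h3⟩⟩ := exists_of_mem_natSet hpq
    simp only at h1 h2
    have h4 : ¬(p = 0 ∧ q = m) := by omega
    exact ⟨(key _ _ h1 h4).1 h3, h1, h4⟩
  · rintro ⟨h1, h2, h3⟩
    have h4 := hd.bounds h1
    simp only at h2 h3
    refine (mem_natSet (⟨p, by omega⟩ : Fin (m + 1)) ⟨q, by omega⟩).2 ⟨⟨h2, ?_⟩, ?_⟩
    · simp only
      omega
    · exact (key _ _ h2 h3).2 h1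

theorem isTriangulation (h : IsRun y k I) (hy : y ∈ X F m) : IsTriangulation (upsilon y) := by
  obtain ⟨R, hR, heq⟩ := h.exists_dissect hy
  rw [← isTri_natSet_iff, heq]
  exact hR.isTri

/-- A vertex found is never `∞`, and it differs from all values since the previous one found. If `k`
is even, the vertices from `I k` to the last zero `l` are `0` or `∞`, whereas `m - 1` is neither,
being after `l` and next to `m`. If `k` is odd, only `0` and `∞` occur from `I (k + 1)` on, whereas
`I k` has neither value. -/
theorem isProperColoring (h : IsRun y k I) (hy : y ∈ X F m) : IsProperColoring y (upsilon y) := by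
  rintro ⟨p, q⟩ ⟨hd, hpq⟩
  simp only at hpq ⊢
  rw [h.drawn_iff] at hpq
  rcases hpq with ⟨a, ha, rfl, rfl⟩ | ⟨a, ha, rfl, h2, h3⟩ |
      ⟨hk, l, h4, h5, ⟨rfl, h6, h7⟩ | ⟨h6, h7, h8⟩⟩ | ⟨hk, ⟨rfl, h4⟩ | ⟨rfl, h4, h5⟩⟩
  · rw [hy.2.1]
    exact h.apply_ne_inftyPt hy (by omega)
  · have h1 := h.apply_between hy ha.le h2 h3
    rcases Nat.even_or_odd a with ha' | ha'
    · have h4 := h.apply_odd (by omega) ha'.add_one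
      rcases h1.1 ha' with h5 | h5 <;> rw [h5]
      · exact h4.1.symm
      · exact h4.2.symm
    · rw [h.apply_even hy (by omega) ha'.add_one]
      exact h1.2 ha'
  · rw [h4]
    exact (h5 q h6).symm
  · obtain ⟨l', h9, h10, h11, h12⟩ := h.exists_last_zero hy hk
    obtain rfl := last_zero_unique h4 h5 h9 h10
    have h13 := h.val_lt hy (a := k + 1) le_rfl
    have hlq : l < q := by
      rw [Fin.lt_def] at h12 ⊢
      omega
    have hq0 := h5 q hlq
    have hqi : y q ≠ inftyPt F := by
      have h14 := hy.2.2 ⟨q, by omega⟩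
      rw [← hy.2.1]
      have h15 : (⟨q, by omega⟩ : Fin m).succ = Fin.last m := Fin.ext h6
      rwa [h15] at h14
    rcases (h.apply_between hy le_rfl h7 (lt_of_le_of_lt h8 h12)).1 hk with h14 | h14 <;> rw [h14]
    · exact hq0.symm
    · exact hqi.symm
  · have h1 := h.apply_odd (by omega) hk
    rcases h4.eq_or_lt with rfl | h4
    · rw [h.apply_even hy le_rfl hk.add_one]
      exact h1.1
    · have h2 := h.stops q h4
      have h3 := hk.add_one.add_one
      unfold Marks at h2
      intro heq
      rw [← heq] at h2
      tauto
  · rw [h.apply_even hy le_rfl hk.add_one]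
    exact (h.apply_between hy le_rfl h4 h5).2 hk

end IsRun

end Run

end

/-! ### Colorings by three points -/

section

/-- The point `[1 : 1]`. -/
def onePt (F : Type*) [Field F] : P1 F :=
  Projectivization.mk F ![1, 1] (vec_ne_zero.2 (Or.inl one_ne_zero))

theorem onePt_ne_zeroPt {F : Type*} [Field F] : onePt F ≠ zeroPt F := by
  rw [onePt, zeroPt, Ne, mk_eq_mk_iff_mul]
  simp

theorem onePt_ne_inftyPt {F : Type*} [Field F] : onePt F ≠ inftyPt F := by
  rw [onePt, inftyPt, Ne, mk_eq_mk_iff_mul]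
  simp

theorem eq_onePt {p : P1 (ZMod 2)} (h0 : p ≠ zeroPt (ZMod 2)) (h1 : p ≠ inftyPt (ZMod 2)) :
    p = onePt (ZMod 2) := by
  obtain ⟨a, b, h, rfl⟩ := exists_eq_mk p
  rw [zeroPt, Ne, mk_eq_mk_iff_mul] at h0
  rw [inftyPt, Ne, mk_eq_mk_iff_mul] at h1
  rw [onePt, mk_eq_mk_iff_mul]
  clear h
  revert a b
  decide

open Classical in
/-- The three points of the projective line over the field with two elements, numbered. -/
noncomputable def ptIndex (p : P1 (ZMod 2)) : Fin 3 :=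
  if p = zeroPt (ZMod 2) then 0 else if p = inftyPt (ZMod 2) then 1 else 2

theorem ptIndex_injective : Function.Injective ptIndex := by
  intro p q h
  unfold ptIndex at h
  split_ifs at h with h1 h2 h3 h4 h5 h6 h7
  · rw [h1, h2]
  · exact absurd h (by decide)
  · exact absurd h (by decide)
  · exact absurd h (by decide)
  · rw [h4, h6]
  · exact absurd h (by decide)
  · exact absurd h (by decide)
  · exact absurd h (by decide)
  · rw [eq_onePt h1 h4, eq_onePt h7 (by assumption)]

theorem pt_unique {x y z w : P1 (ZMod 2)} (hxy : x ≠ y) (hzx : z ≠ x) (hzy : z ≠ y) (hwx : w ≠ x)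
    (hwy : w ≠ y) : z = w := by
  have key : ∀ x y z w : Fin 3, x ≠ y → z ≠ x → z ≠ y → w ≠ x → w ≠ y → z = w := by decide
  have hi := ptIndex_injective
  exact hi (key _ _ _ _ (hi.ne hxy) (hi.ne hzx) (hi.ne hzy) (hi.ne hwx) (hi.ne hwy))

theorem exists_third_pt (x y : P1 (ZMod 2)) : x ≠ y → ∃ z, z ≠ x ∧ z ≠ y := by
  intro _
  have h1 := zeroPt_ne_inftyPt (F := ZMod 2)
  have h2 := onePt_ne_zeroPt (F := ZMod 2)
  have h3 := onePt_ne_inftyPt (F := ZMod 2)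
  by_contra! h
  have h4 := h (zeroPt _)
  have h5 := h (inftyPt _)
  have h6 := h (onePt _)
  by_cases h7 : zeroPt (ZMod 2) = x
  · subst h7
    exact h3 ((h6 h2).trans (h5 h1.symm).symm)
  · have h8 := h4 h7
    subst h8
    by_cases h9 : inftyPt (ZMod 2) = x
    · subst h9
      exact h2 (h6 h3)
    · exact h1 (h5 h9).symm

open Classical in
/-- The embedding of the projective line over the field with two elements. -/
noncomputable def liftPt (F : Type*) [Field F] (p : P1 (ZMod 2)) : P1 F :=
  if p = zeroPt (ZMod 2) then zeroPt F else if p = inftyPt (ZMod 2) then inftyPt F else onePt F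

theorem liftPt_zeroPt (F : Type*) [Field F] : liftPt F (zeroPt (ZMod 2)) = zeroPt F :=
  if_pos rfl

theorem liftPt_inftyPt (F : Type*) [Field F] : liftPt F (inftyPt (ZMod 2)) = inftyPt F := by
  rw [liftPt, if_neg zeroPt_ne_inftyPt.symm, if_pos rfl]

theorem liftPt_injective (F : Type*) [Field F] : Function.Injective (liftPt F) := by
  intro p q h
  unfold liftPt at h
  split_ifs at h with h1 h2 h3 h4 h5 h6 h7
  · rw [h1, h2]
  · exact absurd h zeroPt_ne_inftyPt
  · exact absurd h onePt_ne_zeroPt.symm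
  · exact absurd h zeroPt_ne_inftyPt.symm
  · rw [h4, h6]
  · exact absurd h onePt_ne_inftyPt.symm
  · exact absurd h onePt_ne_zeroPt
  · exact absurd h onePt_ne_inftyPt
  · rw [eq_onePt h1 h4, eq_onePt h7 (by assumption)]

/-- With only two values and no equal neighbours the values alternate, so parity of the distance
decides. This transfers zeros from one labelling to another at the same places. -/
theorem alternate {α : Type*} {m : ℕ} {z : Fin (m + 1) → α}
    (hz : ∀ i : Fin m, z i.castSucc ≠ z i.succ) {u v : α} (huv : u ≠ v) {s t : Fin (m + 1)}
    (hst : s ≤ t) (hs : z s = u) (h : ∀ p, s ≤ p → p ≤ t → z p = u ∨ z p = v) :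
    z t = u ↔ Even (t.val - s.val) := by
  obtain ⟨d, hd⟩ : ∃ d, t.val - s.val = d := ⟨_, rfl⟩
  rw [hd]
  induction d generalizing t with
  | zero =>
    rw [Fin.le_def] at hst
    obtain rfl : t = s := Fin.ext (by omega)
    simp [hs]
  | succ d ih =>
    rw [Fin.le_def] at hst
    have ht := t.2
    let i : Fin m := ⟨t.val - 1, by omega⟩
    have hi : i.succ = t := Fin.ext (by simp only [i, Fin.val_succ]; omega)
    have hic : i.castSucc.val = t.val - 1 := rfl
    have hsi : s ≤ i.castSucc := by rw [Fin.le_def]; omega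
    have hit : i.castSucc ≤ t := by rw [Fin.le_def]; omega
    have h1 := ih hsi (fun p hp hp' => h p hp (hp'.trans hit)) (by omega)
    have h2 := hz i
    rw [hi] at h2
    rw [Nat.even_add_one, ← h1]
    rcases h _ hsi hit with h3 | h3 <;> rcases h t (hsi.trans hit) le_rfl with h4 | h4 <;>
      rw [h3, h4] at h2 <;> simp_all [huv.symm]

/-! ### The algorithm and colorings by three points. -/

section Upsilon

variable {F : Type*} [Field F] {m : ℕ} {y : Fin (m + 1) → P1 F}

/-- With only `0` and `∞` as values the labelling would alternate, and this one is excluded. -/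
theorem exists_isRun_of_mem_X' (hy : y ∈ X' F m) : ∃ k I, IsRun y k I := by
  classical
  by_contra hno
  have h01 : ∀ j, y j = zeroPt F ∨ y j = inftyPt F := by
    intro j
    by_contra! hj
    refine hno (exists_isRun (j := j) (Fin.pos_of_ne_zero ?_) hj.1 hj.2)
    rintro rfl
    exact hj.1 hy.1.1
  refine hy.2 (funext fun i => ?_)
  have h1 := alternate hy.1.2.2 zeroPt_ne_inftyPt (Fin.zero_le i) hy.1.1 fun p _ _ => h01 p
  rw [Fin.val_zero, Nat.sub_zero] at h1
  split_ifs with h2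
  · exact h1.2 h2
  · exact (h01 i).resolve_left fun h3 => h2 (h1.1 h3)

theorem isTriangulation_upsilon (hy : y ∈ X' F m) : IsTriangulation (upsilon y) := by
  obtain ⟨k, I, h⟩ := exists_isRun_of_mem_X' hy
  exact h.isTriangulation hy.1

theorem isProperColoring_upsilon (hy : y ∈ X' F m) : IsProperColoring y (upsilon y) := by
  obtain ⟨k, I, h⟩ := exists_isRun_of_mem_X' hy
  exact h.isProperColoring hy.1

theorem IsTriangulation.eq_of_subset {N : ℕ} {T T' : Set (Fin N × Fin N)} (h : IsTriangulation T)
    (h' : IsTriangulation T') (hsub : T ⊆ T') : T' = T :=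
  Set.Subset.antisymm (fun d hd => h.2.2 d (h'.1 d hd) fun _ he => h'.2.1 d hd _ (hsub he)) hsub

/-- A triangulation has at most one proper coloring by the projective line over the field with two
elements. -/
theorem coloring_unique {y y' : Fin (m + 1) → P1 (ZMod 2)} (hy : y ∈ X (ZMod 2) m)
    (hy' : y' ∈ X (ZMod 2) m) {T : Set (Fin (m + 1) × Fin (m + 1))} (hT : IsTriangulation T)
    (h : IsProperColoring y T) (h' : IsProperColoring y' T) : y = y' := by
  funext i
  -- Two colors of a triangle force the third, starting from the prescribed colors of the long side.
  refine (isTri_natSet_iff.2 hT).propagate (fun k => ∀ hk : k < m + 1, y ⟨k, hk⟩ = y' ⟨k, hk⟩)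
    ?_ ?_ ?_ i.2 i.2
  · intro _
    exact hy.1.trans hy'.1.symm
  · intro _
    exact hy.2.1.trans hy'.2.1.symm
  · intro a b c hab hbc hc h1 h2 h3 ha hc' hb
    have h4 := h.ne_of_edge hy hab hb h1
    have h5 := h.ne_of_edge hy hbc hc h2
    have h6 := h.ne_of_edge hy (hab.trans hbc) hc h3
    have h7 := h'.ne_of_edge hy' hab hb h1
    have h8 := h'.ne_of_edge hy' hbc hc h2
    rw [← ha] at h7
    rw [← hc'] at h8
    exact pt_unique h6 h4.symm h5 h7.symm h8

/-- The algorithm recovers its output from any coloring by three colors. -/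
theorem upsilon_eq_of_isProperColoring (hm : 2 ≤ m) (hy : y ∈ X' F m)
    {y' : Fin (m + 1) → P1 (ZMod 2)} (hy' : y' ∈ X (ZMod 2) m)
    (hp : IsProperColoring y' (upsilon y)) : upsilon y' = upsilon y := by
  obtain ⟨k, I, h⟩ := exists_isRun_of_mem_X' hy
  have hT := h.isTriangulation hy.1
  -- Triangulations are maximal, so it suffices that each segment drawn for `y` is drawn for `y'`.
  refine hT.eq_of_subset (isTriangulation_upsilon (mem_X'_of_isProperColoring hm hy' hT hp)) ?_
  have hne : ∀ p q, p < q → Drawn y p q → y' p ≠ y' q := by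
    intro p q hpq hd
    have hE : Edge (m + 1) (natSet (upsilon y)) p q := by
      rw [edge_iff hpq]
      by_cases hdiag : IsDiagonal (p, q)
      · exact Or.inr ((mem_natSet p q).2 ⟨hdiag, hd⟩)
      · left
        unfold IsDiagonal at hdiag
        simp only at hdiag
        rw [Fin.lt_def] at hpq
        omega
    exact hp.ne_of_edge hy' hpq q.2 hE
  -- For `0 < a ≤ k` the vertex `I a` is joined to `m`, of color `∞`, and to `I (a - 1)`; so the
  -- colors at these vertices alternate between `0` and `1`.
  have hval : ∀ a, a ≤ k → (Even a → y' (I a) = zeroPt _) ∧ (Odd a → y' (I a) = onePt _) := by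
    intro a ha
    induction a with
    | zero =>
      rw [(h.found 0 (by omega)).unique Found.zero, hy'.1]
      exact ⟨fun _ => rfl, fun h => absurd h (by decide)⟩
    | succ a ih =>
      have h1 := hne (I (a + 1)) (Fin.last m) (Fin.lt_def.2 (h.val_lt hy.1 (by omega)))
        (h.drawn_iff.2 (Or.inl ⟨a, ha, rfl, rfl⟩))
      rw [hy'.2.1] at h1
      have h2 := hne (I a) (I (a + 1)) (h.step (by omega)).1
        (h.drawn_iff.2 (Or.inr (Or.inl ⟨a, ha, rfl, le_rfl, (h.step (by omega)).1⟩)))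
      obtain ⟨h3, h4⟩ := ih (by omega)
      rw [Nat.even_add_one, Nat.odd_add_one, Nat.not_even_iff_odd, Nat.not_odd_iff_even]
      refine ⟨fun ho => ?_, fun he => ?_⟩
      · rw [h4 ho] at h2
        by_contra h5
        exact h2 (eq_onePt h5 h1).symm
      · rw [h3 he] at h2
        exact eq_onePt h2.symm h1
  have hmark : ∀ {a} {p : P1 (ZMod 2)}, Odd a → (Marks a p ↔ p = onePt _) := by
    intro a p ha
    have := Nat.not_even_iff_odd.2 ha
    constructor
    · rintro (h1 | h1)
      · exact eq_onePt h1.2.1 h1.2.2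
      · exact absurd h1.1 this
    · rintro rfl
      exact Or.inl ⟨ha, onePt_ne_zeroPt, onePt_ne_inftyPt⟩
  have hmark' : ∀ {a} {p : P1 (ZMod 2)}, Even a → (Marks a p ↔ p = zeroPt _) := by
    intro a p ha
    have := Nat.not_odd_iff_even.2 ha
    constructor
    · rintro (h1 | h1)
      · exact absurd h1.1 this
      · exact h1.2
    · rintro rfl
      exact Or.inr ⟨ha, rfl⟩
  -- The vertex `I (a + 1)` is joined to all vertices from `I a` on, so its color does not occur
  -- among them and the run for `y'` finds it next.
  have hfound : ∀ a, a ≤ k → Found y' a (I a) := by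
    intro a ha
    induction a with
    | zero =>
      rw [(h.found 0 (by omega)).unique Found.zero]
      exact Found.zero
    | succ a ih =>
      have hst := (h.step (a := a) (by omega)).1
      have h1 : ∀ p, I a ≤ p → p < I (a + 1) → y' p ≠ y' (I (a + 1)) := fun p hp hp' =>
        hne p _ hp' (h.drawn_iff.2 (Or.inr (Or.inl ⟨a, ha, rfl, hp, hp'⟩)))
      rcases Nat.even_or_odd (a + 1) with hev | hodd
      · refine Found.succ a _ _ (ih (by omega)) hst ((hmark' hev).2 ((hval _ ha).1 hev)) ?_
        intro l hl hl'
        rw [hmark' hev, ← (hval _ ha).1 hev]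
        exact h1 l hl.le hl'
      · refine Found.succ a _ _ (ih (by omega)) hst ((hmark hodd).2 ((hval _ ha).2 hodd)) ?_
        intro l hl hl'
        rw [hmark hodd, ← (hval _ ha).2 hodd]
        exact h1 l hl.le hl'
  -- The last step needs less than equality of the indices found. For even `k` the index `i'` may
  -- differ from `I (k + 1)`, but the drawing uses only the last zero `l`, which has to be the same
  -- for `y'`.
  have hlast : ∃ i', Found y' (k + 1) i' ∧ Stops y' (k + 1) i' ∧ (Odd k → i' = I (k + 1)) ∧
      (∀ l, y l = zeroPt F → (∀ j, l < j → y j ≠ zeroPt F) → Even k →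
        y' l = zeroPt _ ∧ ∀ j, l < j → y' j ≠ zeroPt _) := by
    have hI := h.val_lt hy.1 (a := k + 1) le_rfl
    have hstep := (h.step (a := k) le_rfl).1
    rcases Nat.even_or_odd k with hk | hk
    · obtain ⟨l, hl, hl', h1, h2⟩ := h.exists_last_zero hy.1 hk
      have hdr : ∀ p q, p < q → (p = l ∧ l < q ∧ q.val + 1 ≤ m ∨ q.val + 1 = m ∧ I k ≤ p ∧ p ≤ l) →
          y' p ≠ y' q := fun p q hpq hc =>
        hne p q hpq (h.drawn_iff.2 (Or.inr (Or.inr (Or.inl ⟨hk, l, hl, hl', hc⟩))))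
      let r : Fin (m + 1) := ⟨m - 1, by omega⟩
      have hr : r.val + 1 = m := Nat.sub_add_cancel (by omega)
      have hlr : l < r := by rw [Fin.lt_def] at h2 ⊢; omega
      have hrinf : y' r ≠ inftyPt _ := by
        have h3 := hy'.2.2 ⟨m - 1, by omega⟩
        rw [← hy'.2.1, show Fin.last m = (⟨m - 1, by omega⟩ : Fin m).succ from Fin.ext hr.symm]
        exact h3
      have hr1 : y' r = onePt _ := by
        refine eq_onePt (fun h3 => hdr (I k) r (h1.trans_lt hlr) (Or.inr ⟨hr, le_rfl, h1⟩) ?_) hrinf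
        rw [(hval k le_rfl).1 hk, h3]
      have hp1 : ∀ p, I k ≤ p → p ≤ l → y' p ≠ onePt _ := fun p hp hp' =>
        hr1 ▸ hdr p r (hp'.trans_lt hlr) (Or.inr ⟨hr, hp, hp'⟩)
      -- Both `y` and `y'` take only the values `0` and `∞` from `I k` to `l` and are `0` at `I k`.
      -- Hence `y l = 0` gives an even distance, and this gives `y' l = 0`.
      have hpar := (alternate hy.1.2.2 zeroPt_ne_inftyPt h1 (h.apply_even hy.1 (by omega) hk)
        fun p hp hp' => (h.apply_between hy.1 le_rfl hp (hp'.trans_lt h2)).1 hk).1 hl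
      have hl0 : y' l = zeroPt _ :=
        (alternate hy'.2.2 zeroPt_ne_inftyPt h1 ((hval k le_rfl).1 hk) fun p hp hp' => by
          by_contra! h3
          exact hp1 p hp hp' (eq_onePt h3.1 h3.2)).2 hpar
      have hl0' : ∀ j, l < j → y' j ≠ zeroPt _ := by
        intro j hj
        by_cases hjm : j.val + 1 ≤ m
        · rw [← hl0]
          exact (hdr l j hj (Or.inl ⟨rfl, hj, hjm⟩)).symm
        · rw [show j = Fin.last m from Fin.ext (by have := j.2; rw [Fin.val_last]; omega), hy'.2.1]
          exact zeroPt_ne_inftyPt.symm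
      obtain ⟨i', hi'⟩ := (hfound k le_rfl).exists_succ (h1.trans_lt hlr)
        ((hmark hk.add_one).2 hr1)
      obtain ⟨s, hs, hsi, hmi, -⟩ := hi'.exists_pred
      obtain rfl := hs.unique (hfound k le_rfl)
      rw [hmark hk.add_one] at hmi
      have hli : l < i' := by
        by_contra h3
        exact hp1 i' hsi.le (not_lt.1 h3) hmi
      refine ⟨i', hi', fun j hj hm => ?_, fun ho => absurd hk (Nat.not_even_iff_odd.2 ho),
        fun l' h3 h4 _ => ?_⟩
      · exact hl0' j (hli.trans hj) ((hmark' hk.add_one.add_one).1 hm)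
      · obtain rfl := IsRun.last_zero_unique hl hl' h3 h4
        exact ⟨hl0, hl0'⟩
    · have hdr : ∀ p q, p < q → (p = I k ∧ I (k + 1) ≤ q ∨ q = I (k + 1) ∧ I k ≤ p ∧ p < q) →
          y' p ≠ y' q := fun p q hpq hc =>
        hne p q hpq (h.drawn_iff.2 (Or.inr (Or.inr (Or.inr ⟨hk, hc⟩))))
      have hs1 := (hval k le_rfl).2 hk
      have hq1 : ∀ q, I (k + 1) ≤ q → y' q ≠ onePt _ := fun q hq => by
        rw [← hs1]
        exact (hdr _ q (hstep.trans_le hq) (Or.inl ⟨rfl, hq⟩)).symm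
      have hq2 : ∀ q, I (k + 1) ≤ q → y' q = zeroPt _ ∨ y' q = inftyPt _ := fun q hq => by
        by_contra! h3
        exact hq1 q hq (eq_onePt h3.1 h3.2)
      -- From `I (k + 1)` on, both `y` and `y'` alternate between `0` and `∞` and end with `∞`, so
      -- they agree at `I (k + 1)`.
      have hpar := alternate hy.1.2.2 zeroPt_ne_inftyPt (Fin.le_last (I (k + 1)))
        (h.apply_even hy.1 le_rfl hk.add_one) fun p hp _ => by
          rcases hp.eq_or_lt with rfl | hp
          · exact Or.inl (h.apply_even hy.1 le_rfl hk.add_one)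
          · have h3 := h.stops p hp
            have h4 := hk.add_one.add_one
            unfold Marks at h3
            tauto
      rw [hy.1.2.1] at hpar
      have hi0 : y' (I (k + 1)) = zeroPt _ := by
        refine (hq2 _ le_rfl).resolve_right fun h3 => ?_
        have h4 := alternate hy'.2.2 zeroPt_ne_inftyPt.symm (Fin.le_last (I (k + 1))) h3
          fun p hp _ => (hq2 p hp).symm
        exact zeroPt_ne_inftyPt (hpar.2 (h4.1 hy'.2.1)).symm
      refine ⟨I (k + 1), Found.succ k _ _ (hfound k le_rfl) hstep ((hmark' hk.add_one).2 hi0) ?_,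
        fun j hj hm => ?_, fun _ => rfl, fun l _ _ he => absurd hk (Nat.not_odd_iff_even.2 he)⟩
      · intro l hl hl' hm
        refine hdr l _ hl' (Or.inr ⟨rfl, hl.le, hl'⟩) ?_
        rw [hi0, (hmark' hk.add_one).1 hm]
      · exact hq1 j hj.le ((hmark hk.add_one.add_one).1 hm)
  obtain ⟨i', hi', hfin, hodd, heven⟩ := hlast
  have hns : ∀ a, a < k → ¬Stops y' (a + 1) (I (a + 1)) := by
    intro a ha
    by_cases hak : a + 1 = k
    · subst hak
      exact (hfound _ le_rfl).not_stops hi'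
    · exact (hfound _ ha).not_stops (hfound (a + 2) (by omega))
  rintro ⟨p, q⟩ ⟨hd, hpq⟩
  refine ⟨hd, ?_⟩
  simp only at hpq ⊢
  rw [h.drawn_iff] at hpq
  rcases hpq with ⟨a, ha, rfl, rfl⟩ | ⟨a, ha, rfl, h2, h3⟩ |
      ⟨hk, l, h4, h5, ⟨rfl, h6, h7⟩ | ⟨h6, h7, h8⟩⟩ | ⟨hk, ⟨rfl, h4⟩ | ⟨rfl, h4, h5⟩⟩
  · exact Drawn.toLast a _ (hfound _ ha) (hns a ha)
  · exact Drawn.fan a _ _ _ (hfound _ ha.le) (hfound _ ha) (hns a ha) h2 h3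
  · obtain ⟨h8, h9⟩ := heven _ h4 h5 hk
    exact Drawn.oddRight k _ p q hi' hfin hk.add_one h8 h9 h6 h7
  · obtain ⟨h9, h10⟩ := heven _ h4 h5 hk
    exact Drawn.oddLeft k _ _ l p q (hfound k le_rfl) hi' hfin hk.add_one h9 h10 h7 h8 h6
  · rw [← hodd hk] at h4
    exact Drawn.evenRight k _ _ q (hfound k le_rfl) hi' hfin hk.add_one h4
  · rw [← hodd hk] at h5 ⊢
    exact Drawn.evenLeft k _ _ p (hfound k le_rfl) hi' hfin hk.add_one h4 h5

end Upsilon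

end

/-! ### Coverings -/

section

section

variable {F : Type*} [Field F] {m : ℕ}

theorem exists_coloring_upsilon {y : Fin (m + 1) → P1 F} (hy : y ∈ X' F m) :
    ∃ y' ∈ X (ZMod 2) m, IsProperColoring y' (upsilon y) := by
  obtain ⟨k, I, h⟩ := exists_isRun_of_mem_X' hy
  obtain ⟨R, hR, heq⟩ := h.exists_dissect hy.1
  obtain ⟨f, h0, h1, hf⟩ := hR.exists_coloring exists_third_pt (zeroPt_ne_inftyPt (F := ZMod 2))
  refine ⟨fun i => f i, ⟨h0, h1, fun i => hf _ _ (hR.side_mem (Nat.zero_le _) i.2)⟩,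
    fun d hd => hf _ _ ?_⟩
  have h2 : (d.1.val, d.2.val) ∈ natSet (upsilon y) := (mem_natSet _ _).2 hd
  rw [heq] at h2
  exact h2.1

theorem liftPt_comp_mem_X {y : Fin (m + 1) → P1 (ZMod 2)} (hy : y ∈ X (ZMod 2) m) :
    (fun i => liftPt F (y i)) ∈ X F m :=
  ⟨by simp only [hy.1, liftPt_zeroPt], by simp only [hy.2.1, liftPt_inftyPt],
    fun i => (liftPt_injective F).ne (hy.2.2 i)⟩

theorem isProperColoring_liftPt_iff {y : Fin (m + 1) → P1 (ZMod 2)}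
    {T : Set (Fin (m + 1) × Fin (m + 1))} :
    IsProperColoring (fun i => liftPt F (y i)) T ↔ IsProperColoring y T :=
  forall₂_congr fun _ _ => (liftPt_injective F).ne_iff

variable (F)

theorem liftPt_comp_mem_X' (hm : 2 ≤ m) {y : Fin (m + 1) → P1 (ZMod 2)} (hy : y ∈ X' (ZMod 2) m) :
    (fun i => liftPt F (y i)) ∈ X' F m :=
  mem_X'_of_isProperColoring hm (liftPt_comp_mem_X hy.1) (isTriangulation_upsilon hy)
    (isProperColoring_liftPt_iff.2 (isProperColoring_upsilon hy))

theorem upsilon_liftPt_comp (hm : 2 ≤ m) {y : Fin (m + 1) → P1 (ZMod 2)} (hy : y ∈ X' (ZMod 2) m) :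
    upsilon (fun i => liftPt F (y i)) = upsilon y := by
  have h := liftPt_comp_mem_X' F hm hy
  exact (upsilon_eq_of_isProperColoring hm h hy.1
    (isProperColoring_liftPt_iff.1 (isProperColoring_upsilon h))).symm

/-- Each output has a coloring by three points that reproduces it, and each coloring by three points
embeds into the line over `F` without change of the output. -/
theorem image_upsilon (hm : 2 ≤ m) : upsilon '' X' F m = upsilon '' X' (ZMod 2) m := by
  refine Set.Subset.antisymm ?_ ?_
  · rintro _ ⟨y, hy, rfl⟩
    obtain ⟨y', hy', hp⟩ := exists_coloring_upsilon hy
    exact ⟨y', mem_X'_of_isProperColoring hm hy' (isTriangulation_upsilon hy) hp,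
      upsilon_eq_of_isProperColoring hm hy hy' hp⟩
  · rintro _ ⟨y, hy, rfl⟩
    exact ⟨_, liftPt_comp_mem_X' F hm hy, upsilon_liftPt_comp F hm hy⟩

theorem injOn_upsilon : Set.InjOn upsilon (X' (ZMod 2) m) := by
  intro y hy y' hy' h
  have h1 := isProperColoring_upsilon hy'
  rw [← h] at h1
  exact coloring_unique hy.1 hy'.1 (isTriangulation_upsilon hy) (isProperColoring_upsilon hy) h1

end

theorem LabeledSeed.isCovering_iff {n m : ℕ} {K : Type*} [Field K] (S : LabeledSeed n m K) {F : Type*} [Field F]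
    {C : Set (Seed n m K)} (hC : C ⊆ S.seeds) :
    S.IsCovering F C ↔ ∀ φ ∈ S.clusterManifold F, ∃ s ∈ C, φ ∈ S.torus F s := by
  have hsub : ⋃ s ∈ C, S.torus F s ⊆ S.clusterManifold F :=
    Set.biUnion_subset_biUnion_left hC
  constructor
  · rintro ⟨-, heq⟩ φ hφ
    rw [← heq] at hφ
    simpa using hφ
  · intro hall
    refine ⟨hC, Set.Subset.antisymm hsub fun φ hφ => ?_⟩
    simpa using hall φ hφ

namespace Coordinates.IsModel

variable {n m : ℕ} {K : Type*} [Field K] {P : Coordinates n m K} {S : LabeledSeed n m K}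

theorem seedOf_mem (h : P.IsModel S) {T : Set (Fin (n + 3) × Fin (n + 3))}
    (hT : IsTriangulation T) : P.seedOf S T ∈ S.seeds := by
  obtain ⟨S', d, h1, -, -, h4⟩ := h.exists_seedOf hT
  exact ⟨S', h1, h4⟩

/-- The covering property holds because each labelling properly colors its own output. For
minimality, take a point over the embedded coloring of one output: another torus of the set
containing it would give a second triangulation properly colored by the same three colors, and
`coloring_unique` then identifies the inputs. -/
theorem isMinimalCovering (h : P.IsModel S) (hrank : S.Q.ReallyFullRank) (F : Type*) [Field F] :
    S.IsMinimalCovering F (P.seedOf S '' (upsilon '' X' (ZMod 2) (n + 2))) := by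
  have hmodel := h.isTriangulationModel hrank
  have hC : P.seedOf S '' (upsilon '' X' (ZMod 2) (n + 2)) ⊆ S.seeds := by
    rintro _ ⟨_, ⟨y, hy, rfl⟩, rfl⟩
    exact h.seedOf_mem (isTriangulation_upsilon hy)
  refine ⟨(S.isCovering_iff hC).2 fun φ hφ => ?_, fun D hD => ?_⟩
  · obtain ⟨y, hy, hφy⟩ := h.exists_labelling hφ
    refine ⟨_, ⟨upsilon y, ?_, rfl⟩, (hφy.mem_torus_iff hmodel (isTriangulation_upsilon hy)).2
      (isProperColoring_upsilon hy)⟩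
    rw [← image_upsilon F (by omega)]
    exact ⟨y, hy, rfl⟩
  · obtain ⟨hsub, hne⟩ := hD
    obtain ⟨s, hs, hsD⟩ := Set.not_subset.1 hne
    obtain ⟨_, ⟨y, hy, rfl⟩, rfl⟩ := hs
    have hT := isTriangulation_upsilon hy
    have hp : IsProperColoring (fun i => liftPt F (y i)) (upsilon y) :=
      isProperColoring_liftPt_iff.2 (isProperColoring_upsilon hy)
    obtain ⟨φ, hφ⟩ := h.exists_liesOver hrank (liftPt_comp_mem_X (F := F) hy.1) hT hp
    refine ⟨Set.biUnion_subset_biUnion_left (hsub.trans hC), fun hsup => hsD ?_⟩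
    have hmem : φ ∈ S.clusterManifold F :=
      Set.mem_biUnion (h.seedOf_mem hT) ((hφ.mem_torus_iff hmodel hT).2 hp)
    obtain ⟨s, hs, hφs⟩ := Set.mem_iUnion₂.1 (hsup hmem)
    obtain ⟨_, ⟨y', hy', rfl⟩, rfl⟩ := hsub hs
    have hT' := isTriangulation_upsilon hy'
    have h1 := isProperColoring_liftPt_iff.1 ((hφ.mem_torus_iff hmodel hT').1 hφs)
    rwa [← coloring_unique hy.1 hy'.1 hT' h1 (isProperColoring_upsilon hy')] at hs

theorem ncard_seeds_upsilon (h : P.IsModel S) (hrank : S.Q.ReallyFullRank) :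
    (P.seedOf S '' (upsilon '' X' (ZMod 2) (n + 2))).ncard = Nat.card (X' (ZMod 2) (n + 2)) := by
  rw [Set.InjOn.ncard_image, injOn_upsilon.ncard_image, Nat.card_coe_set_eq]
  refine (h.isTriangulationModel hrank).2.1.injOn.mono ?_
  rintro _ ⟨y, hy, rfl⟩
  exact isTriangulation_upsilon hy

/-! ### The set of seeds attached to a pattern `π`. -/

variable {κ : Type*}

/-- If equal symbols of `π` imply equal values of `y`, then a triangulation properly colored by `y`
is properly colored by `π`, and exactly such triangulations are left out of the set. -/
theorem not_mem_torus (h : P.IsModel S) (hrank : S.Q.ReallyFullRank) {F : Type*} [Field F]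
    {π : Fin (n + 3) → κ} {y : Fin (n + 3) → P1 F} (hπ : ∀ i j, π i = π j → y i = y j)
    {φ : S.ClusterVariety F} (hφ : LiesOver P.var φ y) {s : Seed n m K}
    (hs : s ∈ P.seedOf S '' {T | IsTriangulation T ∧ ¬IsProperColoring π T}) :
    φ ∉ S.torus F s := by
  obtain ⟨T, ⟨hT, hp⟩, rfl⟩ := hs
  rw [hφ.mem_torus_iff (h.isTriangulationModel hrank) hT]
  exact fun hy => hp fun d hd heq => hy d hd (hπ _ _ heq)

theorem exists_mem_clusterManifold (h : P.IsModel S) (hrank : S.Q.ReallyFullRank) {F : Type*}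
    [Field F] {y : Fin (n + 3) → P1 F} (hy : y ∈ X' F (n + 2)) :
    ∃ φ ∈ S.clusterManifold F, LiesOver P.var φ y := by
  have hT := isTriangulation_upsilon hy
  have hp := isProperColoring_upsilon hy
  obtain ⟨φ, hφ⟩ := h.exists_liesOver hrank hy.1 hT hp
  exact ⟨φ, Set.mem_biUnion (h.seedOf_mem hT)
    ((hφ.mem_torus_iff (h.isTriangulationModel hrank) hT).2 hp), hφ⟩

theorem seeds_subset (h : P.IsModel S) (π : Fin (n + 3) → κ) :
    P.seedOf S '' {T | IsTriangulation T ∧ ¬IsProperColoring π T} ⊆ S.seeds := by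
  rintro _ ⟨T, ⟨hT, -⟩, rfl⟩
  exact h.seedOf_mem hT

theorem not_isCovering (h : P.IsModel S) (hrank : S.Q.ReallyFullRank) {F : Type*} [Field F]
    {π : Fin (n + 3) → κ} {y : Fin (n + 3) → P1 F} (hπ : ∀ i j, π i = π j → y i = y j)
    (hy : y ∈ X' F (n + 2)) :
    ¬S.IsCovering F (P.seedOf S '' {T | IsTriangulation T ∧ ¬IsProperColoring π T}) := by
  rw [S.isCovering_iff (h.seeds_subset π)]
  intro hall
  obtain ⟨φ, hφ, hφy⟩ := h.exists_mem_clusterManifold hrank hy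
  obtain ⟨s, hs, hφs⟩ := hall φ hφ
  exact h.not_mem_torus hrank hπ hφy hs hφs

theorem isCovering (h : P.IsModel S) (hrank : S.Q.ReallyFullRank) {F : Type*} [Field F]
    {π : Fin (n + 3) → κ} (hπ : ∀ y ∈ X' F (n + 2), ∃ T, IsTriangulation T ∧
      IsProperColoring y T ∧ ¬IsProperColoring π T) :
    S.IsCovering F (P.seedOf S '' {T | IsTriangulation T ∧ ¬IsProperColoring π T}) := by
  rw [S.isCovering_iff (h.seeds_subset π)]
  intro φ hφ
  obtain ⟨y, hy, hφy⟩ := h.exists_labelling hφ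
  obtain ⟨T, hT, hyT, hπT⟩ := hπ y hy
  exact ⟨_, ⟨T, ⟨hT, hπT⟩, rfl⟩, (hφy.mem_torus_iff (h.isTriangulationModel hrank) hT).2 hyT⟩

end Coordinates.IsModel

/-- A labelling by three points has a properly colored triangulation that contains a given
diagonal, if all points occur on both sides of it. -/
theorem exists_isTriangulation_mem {m : ℕ} {y : Fin (m + 1) → P1 (ZMod 2)} (hy : y ∈ X (ZMod 2) m)
    {i j t t' : Fin (m + 1)} (hd : IsDiagonal (i, j)) (hij : y i ≠ y j)
    (ht : i < t ∧ t < j) (hti : y t ≠ y i) (htj : y t ≠ y j) (ht' : t' ≤ i ∨ j ≤ t')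
    (ht0 : y t' ≠ zeroPt _) (ht1 : y t' ≠ inftyPt _) :
    ∃ T, IsTriangulation T ∧ IsProperColoring y T ∧ (i, j) ∈ T := by
  let f : ℕ → P1 (ZMod 2) := fun t => if h : t < m + 1 then y ⟨t, h⟩ else zeroPt _
  have hfy : ∀ t : Fin (m + 1), f t = y t := fun t => dif_pos t.2
  have hs : ∀ p, p < m → f p ≠ f (p + 1) := by
    intro p hp
    have := hy.2.2 ⟨p, hp⟩
    rwa [← hfy, ← hfy] at this
  have hf0 : f 0 = zeroPt _ := (hfy 0).trans hy.1
  have hfm : f m = inftyPt _ := (hfy (Fin.last m)).trans hy.2.1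
  simp only [IsDiagonal, Fin.lt_def, Fin.le_def] at hd ht ht'
  obtain ⟨d, hd'⟩ : ∃ d, j.val = i.val + 1 + d := ⟨j.val - i.val - 1, by omega⟩
  have hjm := j.2
  obtain ⟨e, he⟩ : ∃ e, m = e + d := ⟨m - d, by omega⟩
  obtain ⟨R₁, hR₁, hp₁⟩ := exists_dissect f (a := i) (c := i.val + 1 + d)
    (fun p _ hp => hs p (by omega)) (by rw [← hd', hfy, hfy]; exact hij)
    ⟨t, ht.1, by omega, by rwa [hfy, hfy], by rwa [← hd', hfy, hfy]⟩
  -- The outer polygon arises by contracting the segment `ij` to one side: `g` skips the `d`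
  -- vertices strictly between `i` and `j`. It always contains `0` and `m`, so a vertex with the
  -- third color suffices to triangulate it; the inner polygon is glued back in place of that side.
  let g : ℕ → ℕ := fun p => if p ≤ i then p else p + d
  have hgi : ∀ p, p ≤ i.val → g p = p := fun p hp => if_pos hp
  have hgj : ∀ p, i.val < p → g p = p + d := fun p hp => if_neg (by omega)
  have hge : g e = m := by rw [hgj _ (by omega), he]
  have hg0 : g 0 = 0 := hgi _ (Nat.zero_le _)
  obtain ⟨b, hb⟩ : ∃ b, g b = t'.val := by
    rcases ht' with h1 | h1
    · exact ⟨t', hgi _ h1⟩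
    · refine ⟨t' - d, ?_⟩
      rw [hgj _ (by omega)]
      omega
  have hbt : f (g b) = y t' := by rw [hb, hfy]
  have hbe : b < e := by
    by_contra h
    have h1 := t'.2
    rw [hgj _ (by omega)] at hb
    obtain rfl : b = e := by omega
    rw [hge, hfm] at hbt
    exact ht1 hbt.symm
  have hb0 : 0 < b := by
    rw [Nat.pos_iff_ne_zero]
    rintro rfl
    rw [hg0, hf0] at hbt
    exact ht0 hbt.symm
  obtain ⟨R₂, hR₂, hp₂⟩ := exists_dissect (fun p => f (g p)) (a := 0) (c := e)
    (by
      intro p _ hp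
      rcases lt_trichotomy p i.val with h1 | h1 | h1
      · rw [hgi _ h1.le, hgi _ h1]
        exact hs p (by omega)
      · rw [hgi _ h1.le, hgj _ (by omega), h1, ← hd', hfy, hfy]
        exact hij
      · rw [hgj _ h1, hgj _ (by omega), add_right_comm]
        exact hs _ (by omega))
    (by
      simp only [hg0, hge, hf0, hfm]
      exact zeroPt_ne_inftyPt)
    ⟨b, hb0, hbe, by simp only [hg0, hf0, hbt]; exact ht0, by simp only [hge, hfm, hbt]; exact ht1⟩
  obtain ⟨R, hR, hsub, hmem⟩ := hR₂.glue hR₁ (Nat.zero_le _) (by omega)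
  rw [← he] at hR
  have hp : ∀ p q, (p, q) ∈ R → f p ≠ f q := by
    intro p q hpq
    rcases hmem p q hpq with h1 | ⟨p', q', h1, rfl, rfl⟩
    · exact hp₁ p q h1
    · exact hp₂ p' q' h1
  obtain ⟨T, hT⟩ := exists_natSet_eq hR.isTri
  refine ⟨T, isTri_natSet_iff.1 (hT ▸ hR.isTri), fun d hd => ?_, ?_⟩
  · have h1 : (d.1.val, d.2.val) ∈ natSet T := (mem_natSet _ _).2 hd
    rw [hT] at h1
    rw [← hfy, ← hfy]
    exact hp _ _ h1.1
  · rw [← mem_natSet, hT]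
    refine ⟨hsub ?_, hd.1, fun h => hd.2 ⟨h.1, ?_⟩⟩
    · rw [hd']
      exact hR₁.top_mem
    · simp only at h
      omega

end

/-! ### Patterns that are not covered -/

section

/-! ### A finite search over colorings by three colors. -/

section Search

/-- For the colors `l` of the first vertices: the ends of the segment `p` have different colors, all
three colors occur on one side of it, and the color `2` on the other side. -/
def splits (l : List ℕ) (p : ℕ × ℕ) : Bool :=
  decide (p.2 < l.length) && l.getD p.1 0 != l.getD p.2 0 &&
  ([0, 1, 2].all fun c => (List.range l.length).any fun t =>
    decide (p.1 ≤ t) && decide (t ≤ p.2) && l.getD t 0 == c) &&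
  (List.range l.length).any fun t => (decide (t ≤ p.1) || decide (p.2 ≤ t)) && l.getD t 0 == 2

/-- Depth first search for a coloring that is not split by one of the segments `ps`. -/
def allSplit (ps : List (ℕ × ℕ)) : ℕ → List ℕ → Bool
  | 0, l => l.getD (l.length - 1) 0 != 1 || !(List.range l.length).any (fun t => l.getD t 0 == 2) ||
      ps.any (splits l)
  | k + 1, l => ps.any (splits l) || [0, 1, 2].all fun c =>
      c == l.getD (l.length - 1) 0 || allSplit ps k (l ++ [c])

variable {N : ℕ} {f : ℕ → ℕ} {ps : List (ℕ × ℕ)}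

/-- A segment that splits an initial part of a coloring splits the whole, since only the occurrence
of colors is required. Thus the search may stop at the first split. -/
theorem exists_split_of_any {k : ℕ} (hk : k ≤ N)
    (h : ps.any (splits ((List.range k).map f)) = true) :
    ∃ p ∈ ps, p.2 < N ∧ f p.1 ≠ f p.2 ∧ (∀ c < 3, ∃ t, p.1 ≤ t ∧ t ≤ p.2 ∧ f t = c) ∧
      ∃ t < N, (t ≤ p.1 ∨ p.2 ≤ t) ∧ f t = 2 := by
  obtain ⟨p, hp, h⟩ := List.any_eq_true.1 h
  have hget : ∀ t, t < k → ((List.range k).map f).getD t 0 = f t := fun t ht => by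
    simp [List.getD, ht]
  simp only [splits, Bool.and_eq_true, decide_eq_true_eq, List.length_map, List.length_range,
    bne_iff_ne, List.any_eq_true, List.all_eq_true, List.mem_range, beq_iff_eq,
    Bool.or_eq_true] at h
  obtain ⟨⟨⟨h1, h2⟩, h3⟩, t, h4, h5, h6⟩ := h
  have hp1 : p.1 < k := by
    obtain ⟨s, hs, ⟨h7, h8⟩, h9⟩ := h3 0 (by simp)
    omega
  rw [hget _ hp1, hget _ h1] at h2
  rw [hget _ h4] at h6
  refine ⟨p, hp, by omega, h2, fun c hc => ?_, t, by omega, h5, h6⟩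
  obtain ⟨s, hs, ⟨h7, h8⟩, h9⟩ := h3 c (by
    simp only [List.mem_cons, List.not_mem_nil, or_false]
    omega)
  rw [hget _ hs] at h9
  exact ⟨s, h7, h8, h9⟩

/-- The branch of the search tree given by `f` is followed; the exits for equal neighbours, a wrong
last color and a missing color `2` are excluded by the hypotheses. -/
theorem exists_split (hf : ∀ t, f t < 3) (hs : ∀ t, t + 1 < N → f t ≠ f (t + 1))
    (h1 : f (N - 1) = 1) (h2 : ∃ t < N, f t = 2) {d k : ℕ} (hk : 0 < k) (hdk : k + d = N)
    (h : allSplit ps d ((List.range k).map f) = true) :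
    ∃ p ∈ ps, p.2 < N ∧ f p.1 ≠ f p.2 ∧ (∀ c < 3, ∃ t, p.1 ≤ t ∧ t ≤ p.2 ∧ f t = c) ∧
      ∃ t < N, (t ≤ p.1 ∨ p.2 ≤ t) ∧ f t = 2 := by
  have hget : ∀ k t, t < k → ((List.range k).map f).getD t 0 = f t := fun k t ht => by
    simp [List.getD, ht]
  induction d generalizing k with
  | zero =>
    obtain rfl : k = N := hdk
    rw [allSplit, Bool.or_eq_true, Bool.or_eq_true] at h
    rcases h with (h | h) | h
    · rw [List.length_map, List.length_range, hget _ _ (by omega), h1] at h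
      exact absurd h (by decide)
    · obtain ⟨t, ht, ht'⟩ := h2
      rw [Bool.not_eq_true', List.any_eq_false] at h
      refine absurd ?_ (h t (by simpa using ht))
      rw [hget _ _ ht, ht']
      rfl
    · exact exists_split_of_any le_rfl h
  | succ d ih =>
    rw [allSplit, Bool.or_eq_true] at h
    rcases h with h | h
    · exact exists_split_of_any (by omega) h
    · rw [List.all_eq_true] at h
      have h3 := h (f k) (by
        have := hf k
        simp only [List.mem_cons, List.not_mem_nil, or_false]
        omega)
      rw [Bool.or_eq_true, List.length_map, List.length_range, hget _ _ (by omega), beq_iff_eq] at h3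
      rcases h3 with h3 | h3
      · have h4 := hs (k - 1) (by omega)
        rw [Nat.sub_add_cancel hk] at h4
        exact absurd h3.symm h4
      · refine ih (k := k + 1) (by omega) (by omega) ?_
        rw [List.range_succ, List.map_append]
        exact h3

end Search

/-- The search provides a diagonal with equal symbols of `π` at its ends that splits `y`. A properly
colored triangulation for `y` can be made to contain it, and then `π` is not proper. -/
theorem exists_isTriangulation_of_allSplit {m : ℕ} {κ : Type*} {π : Fin (m + 1) → κ}
    {ps : List (Fin (m + 1) × Fin (m + 1))} (hps : ∀ p ∈ ps, IsDiagonal p ∧ π p.1 = π p.2)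
    (h : allSplit (ps.map fun p => (p.1.val, p.2.val)) m [0] = true)
    {y : Fin (m + 1) → P1 (ZMod 2)} (hy : y ∈ X' (ZMod 2) m) :
    ∃ T, IsTriangulation T ∧ IsProperColoring y T ∧ ¬IsProperColoring π T := by
  have hX := hy.1
  let f : ℕ → ℕ := fun t => if h : t < m + 1 then ptIndex (y ⟨t, h⟩) else 0
  have hfy : ∀ t : Fin (m + 1), f t = ptIndex (y t) := fun t => dif_pos t.2
  have hinj : ∀ s t : Fin (m + 1), f s = f t ↔ y s = y t := fun s t => by
    rw [hfy, hfy, ← Fin.ext_iff, ptIndex_injective.eq_iff]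
  have h0 : f 0 = 0 := by
    have := hfy 0
    rw [Fin.val_zero, hX.1] at this
    rw [this]
    simp [ptIndex]
  have h1 : f m = 1 := by
    have := hfy (Fin.last m)
    rw [Fin.val_last, hX.2.1] at this
    rw [this]
    simp [ptIndex, zeroPt_ne_inftyPt.symm]
  have h2 : ∀ t : Fin (m + 1), f t = 2 ↔ y t ≠ zeroPt _ ∧ y t ≠ inftyPt _ := by
    intro t
    rw [hfy]
    unfold ptIndex
    split_ifs with h3 h4
    · simp [h3]
    · simp [h4]
    · simp [h3, h4]
  obtain ⟨k, I, hI⟩ := exists_isRun_of_mem_X' hy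
  obtain ⟨p, hp, h3, h4, h5, t', h6, h7, h8⟩ := exists_split (N := m + 1) (f := f) (k := 1) (d := m)
    (ps := ps.map fun p => (p.1.val, p.2.val))
    (fun t => by
      simp only [f]
      split_ifs
      · exact Fin.is_lt _
      · omega)
    (fun t ht => by
      have := hX.2.2 ⟨t, by omega⟩
      rwa [Ne, ← hinj] at this)
    h1 ⟨I 1, (I 1).2, (h2 _).2 (hI.apply_odd (by omega) (by decide))⟩ one_pos (by omega)
    (by simpa [h0] using h)
  obtain ⟨⟨i, j⟩, hij, rfl⟩ := List.mem_map.1 hp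
  obtain ⟨hd, hπ⟩ := hps _ hij
  simp only at h3 h4 h5 h7 hπ
  obtain ⟨c, hc, hci, hcj⟩ : ∃ c < 3, c ≠ f i ∧ c ≠ f j := by
    have key : ∀ a b : Fin 3, ∃ c : Fin 3, c ≠ a ∧ c ≠ b := by decide
    obtain ⟨c, h9, h10⟩ := key (ptIndex (y i)) (ptIndex (y j))
    rw [hfy, hfy]
    exact ⟨c, c.2, Fin.val_ne_of_ne h9, Fin.val_ne_of_ne h10⟩
  obtain ⟨t, ht1, ht2, rfl⟩ := h5 c hc
  have hti : i.val ≠ t := by rintro rfl; exact hci rfl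
  have htj : j.val ≠ t := by rintro rfl; exact hcj rfl
  have hj := j.2
  have h9 := (h2 ⟨t', h6⟩).1 h8
  obtain ⟨T, hT, hyT, hmem⟩ := exists_isTriangulation_mem hX (i := i) (j := j) (t := ⟨t, by omega⟩)
    (t' := ⟨t', h6⟩) hd (by rwa [Ne, ← hinj])
    ⟨by rw [Fin.lt_def]; simp only; omega, by rw [Fin.lt_def]; simp only; omega⟩
    (by rwa [Ne, ← hinj]) (by rwa [Ne, ← hinj]) h7 h9.1 h9.2
  exact ⟨T, hT, hyT, fun hp => hp _ hmem hπ⟩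

/-! ### The patterns for types `A_9` and `A_11`. -/

section Patterns

variable {F : Type*} [Field F]

/-- The values `0, ∞, a, b`. -/
def fourPts (a b : P1 F) : Fin 4 → P1 F := ![zeroPt F, inftyPt F, a, b]

theorem fourPts_injective {a b : P1 F} (ha : a ≠ zeroPt F) (ha' : a ≠ inftyPt F) (hb : b ≠ zeroPt F)
    (hb' : b ≠ inftyPt F) (hab : a ≠ b) : Function.Injective (fourPts a b) := by
  intro i j h
  have h1 := zeroPt_ne_inftyPt (F := F)
  fin_cases i <;> fin_cases j <;> simp_all [fourPts, eq_comm]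

theorem fourPts_comp_mem_X' {m : ℕ} {π : Fin (m + 1) → Fin 4} (h0 : π 0 = 0) (h1 : π (Fin.last m) = 1)
    (hs : ∀ i : Fin m, π i.castSucc ≠ π i.succ) (h2 : ∃ i, π i = 2) {a b : P1 F} (ha : a ≠ zeroPt F)
    (ha' : a ≠ inftyPt F) (hb : b ≠ zeroPt F) (hb' : b ≠ inftyPt F) (hab : a ≠ b) :
    (fun i => fourPts a b (π i)) ∈ X' F m := by
  refine ⟨⟨by simp only [h0]; rfl, by simp only [h1]; rfl,
    fun i => (fourPts_injective ha ha' hb hb' hab).ne (hs i)⟩, fun h => ?_⟩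
  obtain ⟨i, hi⟩ := h2
  have h3 := congrFun h i
  simp only [hi] at h3
  have h4 : fourPts a b 2 = a := rfl
  rw [h4] at h3
  split_ifs at h3
  · exact ha h3
  · exact ha' h3

theorem exists_ne_of_isEmpty_ringEquiv (h : IsEmpty (F ≃+* ZMod 2)) :
    ∃ a b : P1 F, a ≠ zeroPt F ∧ a ≠ inftyPt F ∧ b ≠ zeroPt F ∧ b ≠ inftyPt F ∧ a ≠ b := by
  obtain ⟨x, hx0, hx1⟩ : ∃ x : F, x ≠ 0 ∧ x ≠ 1 := by
    classical
    by_contra! hx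
    have hx' : ∀ x : F, x = 0 ∨ x = 1 := fun x => or_iff_not_imp_left.2 (hx x)
    let _ : Fintype F := ⟨{0, 1}, fun x => by simpa using hx' x⟩
    have hcard : Fintype.card F = 2 := Finset.card_pair zero_ne_one
    exact h.false (ZMod.ringEquivOfPrime F Nat.prime_two hcard).symm
  refine ⟨onePt F, Projectivization.mk F ![1, x] (vec_ne_zero.2 (Or.inl one_ne_zero)),
    onePt_ne_zeroPt, onePt_ne_inftyPt, ?_, ?_, ?_⟩
  · rw [zeroPt, Ne, mk_eq_mk_iff_mul]
    simpa using hx0.symm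
  · rw [inftyPt, Ne, mk_eq_mk_iff_mul]
    simp
  · rw [onePt, Ne, mk_eq_mk_iff_mul]
    simpa using hx1

/-- The pattern of the labelling `witness`. -/
def pattern₁₂ : Fin 12 → Fin 4 := ![0, 2, 1, 2, 3, 0, 1, 3, 2, 0, 3, 1]

/-- A pattern for the 14-gon. -/
def pattern₁₄ : Fin 14 → Fin 4 := ![0, 1, 0, 1, 0, 1, 0, 2, 0, 3, 1, 2, 3, 1]

theorem witness_eq (a b : P1 F) : witness a b = fun i => fourPts a b (pattern₁₂ i) := by
  funext i
  fin_cases i <;> rfl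

theorem exists_isTriangulation_pattern₁₂ {y : Fin 12 → P1 (ZMod 2)} (hy : y ∈ X' (ZMod 2) 11) :
    ∃ T, IsTriangulation T ∧ IsProperColoring y T ∧ ¬IsProperColoring pattern₁₂ T :=
  -- These are all pairs of vertices with equal symbols.
  exists_isTriangulation_of_allSplit (ps := [(0, 5), (0, 9), (5, 9), (2, 6), (2, 11), (6, 11),
    (1, 3), (1, 8), (3, 8), (4, 7), (4, 10), (7, 10)]) (by simp only [IsDiagonal]; decide +kernel)
    (by decide +kernel) hy

theorem exists_isTriangulation_pattern₁₄ {y : Fin 14 → P1 (ZMod 2)} (hy : y ∈ X' (ZMod 2) 13) :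
    ∃ T, IsTriangulation T ∧ IsProperColoring y T ∧ ¬IsProperColoring pattern₁₄ T :=
  exists_isTriangulation_of_allSplit (ps := [(0, 2), (0, 4), (0, 6), (0, 8), (2, 4), (2, 6), (2, 8),
    (4, 6), (4, 8), (6, 8), (1, 3), (1, 5), (1, 10), (1, 13), (3, 5), (3, 10), (3, 13), (5, 10),
    (5, 13), (10, 13), (7, 11), (9, 12)]) (by simp only [IsDiagonal]; decide +kernel)
    (by decide +kernel) hy

end Patterns

end

end ClusterCovering

theorem theorem1p3 :
    -- (a)
    (∀ {K : Type u} [Field K] (n m : ℕ) (S : LabeledSeed n m K), 0 < n →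
      S.IsFree → S.IsTypeA → S.Q.ReallyFullRank →
      ∃ (χ : Fin (n + 3) × Fin (n + 3) → K) (τ : Set (Fin (n + 3) × Fin (n + 3)) → Seed n m K)
        (C : Set (Seed n m K)),
        IsTriangulationModel S χ τ ∧
        (∀ (F : Type v) [Field F], ∀ y ∈ X' F (n + 2),
          IsTriangulation (upsilon y) ∧ IsProperColoring y (upsilon y)) ∧
        C = τ '' (upsilon '' X' (ZMod 2) (n + 2)) ∧
        (∀ (F : Type v) [Field F], C = τ '' (upsilon '' X' F (n + 2))) ∧
        S.IsMinimalCovering (ZMod 2) C ∧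
        (∀ (F : Type v) [Field F], S.IsMinimalCovering F C) ∧
        C.ncard = Nat.card (X' (ZMod 2) (n + 2))) ∧
    -- (b) in type `A_9` (triangulations of the 12-gon), with the witness
    (∀ {K : Type u} [Field K] (m : ℕ) (S : LabeledSeed 9 m K),
      S.IsFree → S.IsTypeA → S.Q.ReallyFullRank →
      ∃ (χ : Fin 12 × Fin 12 → K) (τ : Set (Fin 12 × Fin 12) → Seed 9 m K) (C : Set (Seed 9 m K)),
        IsTriangulationModel S χ τ ∧
        S.IsCovering (ZMod 2) C ∧
        ∀ (F : Type v) [Field F], IsEmpty (F ≃+* ZMod 2) →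
          ¬S.IsCovering F C ∧
          ∀ a b : P1 F, a ≠ zeroPt F → a ≠ inftyPt F → b ≠ zeroPt F → b ≠ inftyPt F → a ≠ b →
            witness a b ∈ X' F 11 ∧
            (∃ φ ∈ S.clusterManifold F, LiesOver χ φ (witness a b)) ∧
            ∀ φ : S.ClusterVariety F, LiesOver χ φ (witness a b) → ∀ s ∈ C, φ ∉ S.torus F s) ∧
    -- (b) in type `A_11`
    (∀ {K : Type u} [Field K] (m : ℕ) (S : LabeledSeed 11 m K),
      S.IsFree → S.IsTypeA → S.Q.ReallyFullRank →
      ∃ C : Set (Seed 11 m K),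
        S.IsCovering (ZMod 2) C ∧
        ∀ (F : Type v) [Field F], IsEmpty (F ≃+* ZMod 2) → ¬S.IsCovering F C) := by
  refine ⟨?_, ?_, ?_⟩
  · intro K _ n m S _ hfree hA hrank
    obtain ⟨P, h⟩ := Coordinates.exists_isModel S hfree.1 hA
    refine ⟨P.var, P.seedOf S, _, h.isTriangulationModel hrank,
      fun F _ y hy => ⟨isTriangulation_upsilon hy, isProperColoring_upsilon hy⟩, rfl,
      fun F _ => ?_, h.isMinimalCovering hrank _, fun F _ => h.isMinimalCovering hrank F,
      h.ncard_seeds_upsilon hrank⟩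
    rw [image_upsilon F (by omega)]
  · intro K _ m S hfree hA hrank
    obtain ⟨P, h⟩ := Coordinates.exists_isModel S hfree.1 hA
    have hπ : ∀ {F : Type v} [Field F] {a b : P1 F} (i j : Fin 12), pattern₁₂ i = pattern₁₂ j →
        witness a b i = witness a b j := fun i j hij => by
      simp only [witness_eq, hij]
    have hX : ∀ {F : Type v} [Field F] {a b : P1 F}, a ≠ zeroPt F → a ≠ inftyPt F →
        b ≠ zeroPt F → b ≠ inftyPt F → a ≠ b → witness a b ∈ X' F 11 := by
      intro F _ a b ha ha' hb hb' hab
      rw [witness_eq]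
      exact fourPts_comp_mem_X' (by decide) (by decide) (by decide) ⟨1, rfl⟩ ha ha' hb hb' hab
    -- The set left open consists of the seeds of the triangulations that `pattern₁₂` does not
    -- properly color.
    refine ⟨P.var, P.seedOf S, _, h.isTriangulationModel hrank,
      h.isCovering hrank fun y hy => exists_isTriangulation_pattern₁₂ hy, fun F _ hF => ⟨?_, ?_⟩⟩
    · obtain ⟨a, b, ha, ha', hb, hb', hab⟩ := exists_ne_of_isEmpty_ringEquiv hF
      exact h.not_isCovering hrank hπ (hX ha ha' hb hb' hab)
    · intro a b ha ha' hb hb' hab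
      exact ⟨hX ha ha' hb hb' hab, h.exists_mem_clusterManifold hrank (hX ha ha' hb hb' hab),
        fun φ hφ s hs => h.not_mem_torus hrank hπ hφ hs⟩
  · intro K _ m S hfree hA hrank
    obtain ⟨P, h⟩ := Coordinates.exists_isModel S hfree.1 hA
    refine ⟨_, h.isCovering hrank fun y hy => exists_isTriangulation_pattern₁₄ hy, fun F _ hF => ?_⟩
    obtain ⟨a, b, ha, ha', hb, hb', hab⟩ := exists_ne_of_isEmpty_ringEquiv hF
    exact h.not_isCovering hrank (y := fun i => fourPts a b (pattern₁₄ i))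
      (fun i j hij => by rw [hij])
      (fourPts_comp_mem_X' (by decide) (by decide) (by decide) ⟨7, rfl⟩ ha ha' hb hb' hab)
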